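/- Let $g_0(t)=-\tfrac{t^2}{2}+\cos t-1$ (the screw function of the screw line $t\mapsto(\cos t,\sin t,t)$), $G_{g}(t,s)=g(t-s)-g(t)-g(-s)+g(0)$, and consider the following objects. * $\mathcal H(G_{g_0})$: the Hilbert space obtained from the space $\mathcal L(G_{g_0})$ of continuous compactly supported $\phi:\mathbb R\to\mathbb C$ with $\int\phi=0$ and $\langle\phi_1,\phi_2\rangle=\iint G_{g_0}(t,s)\phi_1(s)\overline{\phi_2(t)}\,ds\,dt$, by dividing out the null vectors and completing. * $\tau_0=\delta_0+\tfrac12\delta_1+\tfrac12\delta_{-1}$. * $E_0(z)=z^3+2iz^2-z-i$, $E^\sharp(z)=\overline{E(\bar z)}$, $\Theta_0=E_0^\sharp/E_0$; $\mu_{\Theta_0}$ is the measure on $\sigma(\Theta_0)=\{\gamma\in\mathbb R:\Theta_0(\gamma)=-1\}$ with point masses $2\pi/|\Theta_0'(\gamma)|$. * $\mathcal K(\Theta_0)=H^2\ominus\Theta_0H^2\subset L^2(\mathbb R)$, where $H^2$ is the Hardy space of the upper half-plane. * $\mathcal H(E_0)$: the de Branges space of all entire $f$ with $f/E_0,\ f^\sharp/E_0\in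 H^2$, with $\|f\|=\|f/E_0\|_{L^2(\mathbb R)}$. * $H_0$: the Hamiltonian on $[0,5)$ equal to $\begin{pmatrix}0&0\\0&1\end{pmatrix}$ on $[0,\tfrac12)\cup[\tfrac92,5)$ and to $\begin{pmatrix}1&0\\0&0\end{pmatrix}$ on $[\tfrac12,\tfrac92)$. $L^2(H_0)$ is the space of classes of measurable $\mathfrak F:[0,5)\to\mathbb C^2$ with norm $\|\mathfrak F\|^2=\tfrac1\pi\int_0^5\mathfrak F^*H_0\mathfrak F\,dt<\infty$, and $\widehat L^2(H_0)$ is its subspace of classes of those $\mathfrak F$ for which $(\cos\theta\ \ \sin\theta)\,\mathfrak F$ is a.e. constant on every indivisible interval of type $\theta$ of $H_0$, i.e. every open interval on which $(\cos\theta\ \ \sin\theta)\,J H_0=0$ a.e., where $J=\begin{pmatrix}0&-1\\1&0\end{pmatrix}$. Put $C(t,z)=-tz,\ -\tfrac z2,\ (2t-9)z^3-(t-4)z$ and $D(t,z)=1,\ 1+\tfrac{1-2t}{4}z^2,\ 1-2z^2$ for $0\le t<\tfrac12$, $\tfrac12\le t<\tfrac92$, $\tfrac92\le t\le5$, respectively.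 Let $F_0=\frac{z^2-1}{\sqrt\pi}$, $F_{\pm1}=\frac{z(z\pm1)}{\sqrt{2\pi}}$ and $$\mathfrak S_t(z)=\sqrt\pi\,it\,\frac{F_0(z)}{E_0(z)}+\sqrt{\tfrac\pi2}\,(e^{it}-1)\frac{F_1(z)}{E_0(z)}-\sqrt{\tfrac\pi2}\,(e^{-it}-1)\frac{F_{-1}(z)}{E_0(z)},\qquad \widehat{\mathcal P}_\phi(z)=\int\phi(t)\,\mathfrak S_t(z)\,dt,$$ $$L_0(t,s)=\sqrt\pi\left\{-is\begin{bmatrix}C(t,0)\\D(t,0)\end{bmatrix}+\frac{e^{is}-1}{2}\begin{bmatrix}C(t,1)\\D(t,1)\end{bmatrix}-\frac{e^{-is}-1}{2}\begin{bmatrix}C(t,-1)\\D(t,-1)\end{bmatrix}\right\}.$$ Then the row $[C\ \ D]$ is the second row of the fundamental solution of $\frac{d}{dt}W(t,z)J=zW(t,z)H_0(t)$, $W(0,z)=I$, on $[0,5]$, and $E_0(z)=C(5,z)-iD(5,z)$. The six spaces $\mathcal H(G_{g_0})$, $L^2(\tau_0)$, $L^2(\mu_{\Theta_0})$, $\mathcal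 K(\Theta_0)$, $\mathcal H(E_0)$, $\widehat L^2(H_0)$ are three-dimensional, and the following formulas (on $\phi\in\mathcal L(G_{g_0})$ in the case of the maps from $\mathcal H(G_{g_0})$) define isometric isomorphisms of Hilbert spaces: 1. $\Phi_1:\mathcal H(G_{g_0})\to L^2(\tau_0)$, $\ \Phi_1(\phi,\gamma)=\int\phi(t)\frac{e^{i\gamma t}-1}{\gamma}\,dt$ (with the value $it$ of the quotient at $\gamma=0$); 2. $\frac1{\sqrt\pi}E_0\widehat{\mathcal P}:\mathcal H(G_{g_0})\to\mathcal H(E_0)$, $\ \phi\mapsto\frac1{\sqrt\pi}E_0\widehat{\mathcal P}_\phi$; 3. $\mathsf L_0:\mathcal H(G_{g_0})\to\widehat L^2(H_0)$, $\ (\mathsf L_0\phi)(t)=\int L_0(t,s)\phi(s)\,ds$; 4. the Weyl transform $\mathsf W:\widehat L^2(H_0)\to\mathcal H(E_0)$, $\ (\mathsf W\mathfrak F)(z)=\frac1\pi\int_0^5[\,C(t,z)\ \ D(t,z)\,]\,H_0(t)\,\mathfrak F(t)\,dt$; 5. $\mathcal H(E_0)\to\mathcal K(\Theta_0)$, $f\mapsto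 f/E_0$, and the restriction $\mathcal K(\Theta_0)\to L^2(\mu_{\Theta_0})$, $F\mapsto F|_{\sigma(\Theta_0)}$ (for the continuous representative of $F$); their composition is denoted $r_{\Theta_0}$; 6. $M:L^2(\tau_0)\to L^2(\mu_{\Theta_0})$, multiplication by $-\frac{i}{\sqrt\pi}$. The diagram they form commutes: $$\mathsf W\circ\mathsf L_0=\tfrac1{\sqrt\pi}E_0\widehat{\mathcal P},\qquad r_{\Theta_0}\circ\tfrac1{\sqrt\pi}E_0\widehat{\mathcal P}=M\circ\Phi_1 .$$ -/

import Mathlib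

open MeasureTheory Filter Topology Complex
open scoped ComplexConjugate ENNReal

noncomputable section

namespace ScrewLine

/-! ### The Hilbert space of the screw function -/

/-- The kernel `G_g(t,s) = g(t-s) - g(t) - g(-s) + g(0)`. -/
def screwKernel (g : ℝ → ℂ) (t s : ℝ) : ℂ := g (t - s) - g t - g (-s) + g 0

/-- The screw function `g₀(t) = -t²/2 + cos t - 1`. -/
def g₀ (t : ℝ) : ℂ := ((-t ^ 2 / 2 + Real.cos t - 1 : ℝ) : ℂ)

/-- Continuous compactly supported functions on the line with integral zero. -/
def testSubmodule : Submodule ℂ (ℝ → ℂ) where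
  carrier := {φ | Continuous φ ∧ HasCompactSupport φ ∧ ∫ t, φ t = 0}
  zero_mem' := ⟨continuous_const, HasCompactSupport.zero, by simp⟩
  add_mem' := by
    rintro φ ψ ⟨hφ, hφc, hφ0⟩ ⟨hψ, hψc, hψ0⟩
    refine ⟨hφ.add hψ, hφc.add hψc, ?_⟩
    have := integral_add (hφ.integrable_of_hasCompactSupport hφc (μ := volume))
      (hψ.integrable_of_hasCompactSupport hψc)
    simpa [hφ0, hψ0] using this
  smul_mem' := by
    rintro c φ ⟨hφ, hφc, hφ0⟩
    refine ⟨hφ.const_smul c, ?_, ?_⟩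
    · exact hφc.smul_left (f := fun _ => c)
    · have := integral_const_mul (μ := volume) c φ
      simpa [hφ0] using this

/-- The space `𝓛(G_g)` (for the whole line). It is a type of its own, because it carries the
seminorm of the kernel `G_g`. -/
def TestSpace (_g : ℝ → ℂ) : Type := testSubmodule

instance (g : ℝ → ℂ) : AddCommGroup (TestSpace g) :=
  inferInstanceAs (AddCommGroup testSubmodule)

instance (g : ℝ → ℂ) : Module ℂ (TestSpace g) :=
  inferInstanceAs (Module ℂ testSubmodule)

/-- The test function underlying an element of `𝓛(G_g)`. -/
def TestSpace.toSubmodule {g : ℝ → ℂ} : TestSpace g ≃ₗ[ℂ] testSubmodule :=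
  LinearEquiv.refl ℂ testSubmodule

instance (g : ℝ → ℂ) : CoeFun (TestSpace g) (fun _ => ℝ → ℂ) :=
  ⟨fun φ => (TestSpace.toSubmodule φ : ℝ → ℂ)⟩

/-- The form `⟨φ, ψ⟩_g = ∬ G_g(t,s) φ(s) conj(ψ(t)) ds dt`, linear in the first argument. -/
def screwForm (g : ℝ → ℂ) (φ ψ : ℝ → ℂ) : ℂ :=
  ∫ t, ∫ s, screwKernel g t s * φ s * conj (ψ t)

theorem screwKernel_g₀ (t s : ℝ) : screwKernel g₀ t s =
    ((Real.cos t - 1 : ℝ) : ℂ) * ((Real.cos s - 1 : ℝ) : ℂ)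
      + (Real.sin t : ℂ) * (Real.sin s : ℂ) + (t : ℂ) * (s : ℂ) := by
  unfold screwKernel g₀
  norm_cast
  simp only [Real.cos_sub, Real.cos_neg, Real.cos_zero]
  ring_nf
  simp

theorem integrable_mul_test (φ : TestSpace g₀) (e : ℝ → ℝ) (he : Continuous e) :
    Integrable (fun t => (e t : ℂ) * φ t) :=
  Continuous.integrable_of_hasCompactSupport
    ((continuous_ofReal.comp he).mul (TestSpace.toSubmodule φ).2.1)
    (TestSpace.toSubmodule φ).2.2.1.mul_left

/-- The moment of a test function against a real weight. -/
def moment (e : ℝ → ℝ) (φ : ℝ → ℂ) : ℂ := ∫ t, (e t : ℂ) * φ t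

theorem screwForm_g₀ (φ ψ : TestSpace g₀) : screwForm g₀ φ ψ =
    moment (fun t => Real.cos t - 1) φ * conj (moment (fun t => Real.cos t - 1) ψ)
      + moment Real.sin φ * conj (moment Real.sin ψ)
      + moment (fun t => t) φ * conj (moment (fun t => t) ψ) := by
  have h1 : Continuous fun t : ℝ => Real.cos t - 1 := by fun_prop
  have h2 : Continuous Real.sin := Real.continuous_sin
  have h3 : Continuous fun t : ℝ => t := continuous_id
  have key : ∀ t : ℝ, ∫ s, screwKernel g₀ t s * φ s * conj (ψ t) =
      moment (fun t => Real.cos t - 1) φ * conj (((Real.cos t - 1 : ℝ) : ℂ) * ψ t)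
      + moment Real.sin φ * conj ((Real.sin t : ℂ) * ψ t)
      + moment (fun t => t) φ * conj ((t : ℂ) * ψ t) := by
    intro t
    have i1 := (integrable_mul_test φ _ h1).mul_const (conj (((Real.cos t - 1 : ℝ) : ℂ) * ψ t))
    have i2 := (integrable_mul_test φ _ h2).mul_const (conj ((Real.sin t : ℂ) * ψ t))
    have i3 := (integrable_mul_test φ _ h3).mul_const (conj ((t : ℂ) * ψ t))
    have i12 := i1.add i2
    unfold moment
    rw [← integral_mul_const, ← integral_mul_const, ← integral_mul_const,
      ← integral_add i1 i2]
    refine Eq.trans ?_ (integral_add i12 i3)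
    refine integral_congr_ae (Eventually.of_forall fun s => ?_)
    simp only [screwKernel_g₀, map_mul, conj_ofReal]
    ring
  have c : ∀ e : ℝ → ℝ, Continuous e → Integrable (fun t => conj ((e t : ℂ) * ψ t)) := by
    intro e he
    exact (LinearIsometryEquiv.integrable_comp_iff (conjLIE : ℂ ≃ₗᵢ[ℝ] ℂ)).2
      (integrable_mul_test ψ e he)
  have j1 := (c _ h1).const_mul (moment (fun t => Real.cos t - 1) φ)
  have j2 := (c _ h2).const_mul (moment Real.sin φ)
  have j3 := (c _ h3).const_mul (moment (fun t => t) φ)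
  unfold screwForm
  simp only [key]
  have j12 := j1.add j2
  refine (integral_add j12 j3).trans ?_
  have e12 := integral_add j1 j2
  simp only [Pi.add_apply]
  rw [e12, integral_const_mul, integral_const_mul,
    integral_const_mul, integral_conj, integral_conj, integral_conj]
  rfl

theorem moment_add (e : ℝ → ℝ) (he : Continuous e) (φ ψ : TestSpace g₀) :
    moment e (φ + ψ : TestSpace g₀) = moment e φ + moment e ψ := by
  unfold moment
  rw [← integral_add (integrable_mul_test φ e he) (integrable_mul_test ψ e he)]
  refine integral_congr_ae (Eventually.of_forall fun t => ?_)
  simp only [map_add, Submodule.coe_add, Pi.add_apply]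
  ring

theorem moment_smul (e : ℝ → ℝ) (c : ℂ) (φ : TestSpace g₀) :
    moment e (c • φ : TestSpace g₀) = c * moment e φ := by
  unfold moment
  rw [← integral_const_mul]
  refine integral_congr_ae (Eventually.of_forall fun t => ?_)
  simp only [map_smul, Submodule.coe_smul, Pi.smul_apply, smul_eq_mul]
  ring

/-- The semi-inner product on `𝓛(G_{g₀})`. Mathlib's inner products are linear in the second
argument, so the arguments are exchanged. -/
@[reducible] def testCore : PreInnerProductSpace.Core ℂ (TestSpace g₀) where
  inner φ ψ := screwForm g₀ ψ φ
  conj_inner_symm φ ψ := by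
    simp only [screwForm_g₀, map_add, map_mul, conj_conj]
    ring
  re_inner_nonneg φ := by
    simp only [screwForm_g₀, mul_conj]
    norm_cast
    have h := fun z : ℂ => normSq_nonneg z
    exact add_nonneg (add_nonneg (h _) (h _)) (h _)
  add_left φ ψ χ := by
    simp only [screwForm_g₀]
    rw [moment_add _ (by fun_prop), moment_add _ (by fun_prop), moment_add _ (by fun_prop)]
    simp only [map_add]
    ring
  smul_left φ ψ c := by
    simp only [screwForm_g₀, moment_smul, map_mul]
    ring

instance : SeminormedAddCommGroup (TestSpace g₀) :=
  @InnerProductSpace.Core.toSeminormedAddCommGroup ℂ (TestSpace g₀) _ _ _ testCore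

instance : InnerProductSpace ℂ (TestSpace g₀) := InnerProductSpace.ofCore testCore

/-- The Hilbert space `𝓗(G_{g₀})`: the completion of `𝓛(G_{g₀}) / 𝓛°(G_{g₀})`. -/
abbrev ScrewHilbert : Type :=
  UniformSpace.Completion (SeparationQuotient (TestSpace g₀))

/-- The element of `𝓗(G_{g₀})` defined by a test function. -/
def screwClass (φ : TestSpace g₀) : ScrewHilbert :=
  ((SeparationQuotient.mk φ : SeparationQuotient (TestSpace g₀)) : ScrewHilbert)

/-! ### The spectral measure and the transform `Φ₁` -/

/-- `τ₀ = δ₀ + ½ δ₁ + ½ δ₋₁`. -/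
def τ₀ : Measure ℝ :=
  Measure.dirac 0 + (2⁻¹ : ℝ≥0∞) • Measure.dirac 1 + (2⁻¹ : ℝ≥0∞) • Measure.dirac (-1)

/-- The function `(e^{izt} - 1)/z`, with its limit `it` at `z = 0`. -/
def screwExp (z : ℂ) (t : ℝ) : ℂ := if z = 0 then I * t else (exp (I * z * t) - 1) / z

/-- `Φ₁(φ, z) = ∫ φ(t) (e^{izt} - 1)/z dt`. -/
def Φ₁ (φ : ℝ → ℂ) (z : ℂ) : ℂ := ∫ t, φ t * screwExp z t

/-! ### Hardy space, model space, de Branges space -/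

/-- `F` belongs to the Hardy space `H²` of the upper half-plane: it is analytic there and
`sup_{v>0} ∫ |F(u+iv)|² du < ∞`. Only the values of `F` on the upper half-plane matter. -/
def IsHardy (F : ℂ → ℂ) : Prop :=
  DifferentiableOn ℂ F {z | 0 < z.im} ∧
    (⨆ (v : ℝ) (_ : 0 < v), ∫⁻ u : ℝ, ‖F (u + v * I)‖ₑ ^ 2) < ∞

theorem IsHardy.zero : IsHardy 0 := by
  refine ⟨differentiableOn_const 0, ?_⟩
  simp

theorem IsHardy.continuous_line {F : ℂ → ℂ} (hF : IsHardy F) {v : ℝ} (hv : 0 < v) :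
    Continuous fun u : ℝ => F (u + v * I) := by
  refine hF.1.continuousOn.comp_continuous (by fun_prop) ?_
  intro u
  simpa using hv

theorem IsHardy.add {F G : ℂ → ℂ} (hF : IsHardy F) (hG : IsHardy G) : IsHardy (F + G) := by
  refine ⟨hF.1.add hG.1, ?_⟩
  have hlt := ENNReal.add_lt_top.2
    ⟨ENNReal.mul_lt_top (show (2 : ℝ≥0∞) < ∞ by simp) hF.2,
      ENNReal.mul_lt_top (show (2 : ℝ≥0∞) < ∞ by simp) hG.2⟩
  refine lt_of_le_of_lt ?_ hlt
  refine iSup₂_le fun v hv => ?_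
  have m1 : Measurable fun u : ℝ => 2 * ‖F (u + v * I)‖ₑ ^ 2 :=
    ((hF.continuous_line hv).enorm.measurable.pow_const 2).const_mul 2
  calc ∫⁻ u : ℝ, ‖(F + G) (u + v * I)‖ₑ ^ 2
      ≤ ∫⁻ u : ℝ, (2 * ‖F (u + v * I)‖ₑ ^ 2 + 2 * ‖G (u + v * I)‖ₑ ^ 2) := by
        refine lintegral_mono fun u => ?_
        have h1 : ‖(F + G) (u + v * I)‖ₑ ≤ ‖F (u + v * I)‖ₑ + ‖G (u + v * I)‖ₑ :=
          enorm_add_le _ _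
        refine (pow_le_pow_left' h1 2).trans ?_
        have h2 := ENNReal.rpow_add_le_mul_rpow_add_rpow ‖F (u + v * I)‖ₑ ‖G (u + v * I)‖ₑ
          (p := 2) (by norm_num)
        have h3 : (2 : ℝ≥0∞) ^ ((2 : ℝ) - 1) = 2 := by norm_num
        rw [h3] at h2
        rw [← mul_add]
        exact_mod_cast h2
    _ = 2 * (∫⁻ u : ℝ, ‖F (u + v * I)‖ₑ ^ 2) + 2 * ∫⁻ u : ℝ, ‖G (u + v * I)‖ₑ ^ 2 := by
        rw [lintegral_add_left m1, lintegral_const_mul' _ _ (by simp),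
          lintegral_const_mul' _ _ (by simp)]
    _ ≤ _ := by
        gcongr
        · exact le_iSup₂ (f := fun (v : ℝ) (_ : 0 < v) => ∫⁻ u : ℝ, ‖F (u + v * I)‖ₑ ^ 2) v hv
        · exact le_iSup₂ (f := fun (v : ℝ) (_ : 0 < v) => ∫⁻ u : ℝ, ‖G (u + v * I)‖ₑ ^ 2) v hv

theorem IsHardy.smul {F : ℂ → ℂ} (hF : IsHardy F) (c : ℂ) : IsHardy (c • F) := by
  refine ⟨hF.1.const_smul c, ?_⟩
  have hlt := ENNReal.mul_lt_top (show ‖c‖ₑ ^ 2 < ∞ by simp) hF.2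
  refine lt_of_le_of_lt ?_ hlt
  refine iSup₂_le fun v hv => ?_
  simp only [Pi.smul_apply, enorm_smul, mul_pow]
  rw [lintegral_const_mul' _ _ (by simp)]
  gcongr
  exact le_iSup₂ (f := fun (v : ℝ) (_ : 0 < v) => ∫⁻ u : ℝ, ‖F (u + v * I)‖ₑ ^ 2) v hv

/-- `F` has the nontangential boundary value `c` at the real point `x`. -/
def HasNontangentialLimit (F : ℂ → ℂ) (x : ℝ) (c : ℂ) : Prop :=
  ∀ α : ℝ, 0 < α → Tendsto F (𝓝[{z : ℂ | 0 < z.im ∧ |z.re - x| < α * z.im}] (x : ℂ)) (𝓝 c)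

/-- `H²` as a subspace of `L²(ℝ)`, through nontangential boundary values. -/
def hardySubspace : Submodule ℂ (Lp ℂ 2 (volume : Measure ℝ)) where
  carrier := {f | ∃ F : ℂ → ℂ, IsHardy F ∧ ∀ᵐ x : ℝ, HasNontangentialLimit F x (f x)}
  zero_mem' := by
    refine ⟨0, IsHardy.zero, ?_⟩
    filter_upwards [Lp.coeFn_zero ℂ 2 (volume : Measure ℝ)] with x hx α _
    rw [hx]
    exact tendsto_const_nhds
  add_mem' := by
    rintro f g ⟨F, hF, hFf⟩ ⟨G, hG, hGg⟩
    refine ⟨F + G, hF.add hG, ?_⟩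
    filter_upwards [hFf, hGg, Lp.coeFn_add f g] with x h1 h2 h3 α hα
    rw [h3]
    exact (h1 α hα).add (h2 α hα)
  smul_mem' := by
    rintro c f ⟨F, hF, hFf⟩
    refine ⟨c • F, hF.smul c, ?_⟩
    filter_upwards [hFf, Lp.coeFn_smul c f] with x h1 h2 α hα
    rw [h2]
    exact (h1 α hα).const_smul c

/-- The subset `Θ H²` of `L²(ℝ)`. -/
def mulHardy (Θ : ℂ → ℂ) : Set (Lp ℂ 2 (volume : Measure ℝ)) :=
  {k | ∃ h ∈ hardySubspace, k =ᵐ[volume] fun x : ℝ => Θ x * h x}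

/-- The model space `𝓚(Θ) = H² ⊖ Θ H²`, a subspace of `L²(ℝ)`. -/
def modelSpace (Θ : ℂ → ℂ) : Submodule ℂ (Lp ℂ 2 (volume : Measure ℝ)) :=
  hardySubspace ⊓ (Submodule.span ℂ (mulHardy Θ))ᗮ

/-- `E♯(z) = conj (E (conj z))`. -/
def sharp (E : ℂ → ℂ) (z : ℂ) : ℂ := conj (E (conj z))

/-- The Hermite-Biehler class (no real zeros allowed). -/
structure IsHermiteBiehler (E : ℂ → ℂ) : Prop where
  entire : Differentiable ℂ E
  lt : ∀ z : ℂ, 0 < z.im → ‖sharp E z‖ < ‖E z‖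
  real_ne_zero : ∀ x : ℝ, E x ≠ 0

/-- The entire functions `f` with `f/E` and `f♯/E` in `H²`. -/
def deBrangesSubmodule (E : ℂ → ℂ) : Submodule ℂ (ℂ → ℂ) where
  carrier := {f | Differentiable ℂ f ∧ IsHardy (fun z => f z / E z) ∧
    IsHardy (fun z => sharp f z / E z)}
  zero_mem' := by
    refine ⟨differentiable_const 0, ?_, ?_⟩
    · have : (fun z => (0 : ℂ → ℂ) z / E z) = 0 := by ext z; simp
      rw [this]
      exact IsHardy.zero
    · have : (fun z => sharp (0 : ℂ → ℂ) z / E z) = 0 := by ext z; simp [sharp]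
      rw [this]
      exact IsHardy.zero
  add_mem' := by
    rintro f g ⟨h1, h2, h3⟩ ⟨k1, k2, k3⟩
    refine ⟨h1.add k1, ?_, ?_⟩
    · convert h2.add k2 using 1
      ext z; simp [add_div]
    · convert h3.add k3 using 1
      ext z; simp [sharp, add_div]
  smul_mem' := by
    rintro c f ⟨h1, h2, h3⟩
    refine ⟨h1.const_smul c, ?_, ?_⟩
    · convert h2.smul c using 1
      ext z; simp [mul_div_assoc]
    · convert h3.smul (conj c) using 1
      ext z; simp [sharp, mul_div_assoc]

/-- The de Branges space `𝓗(E)`. -/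
def DeBrangesSpace (E : ℂ → ℂ) (_hE : IsHermiteBiehler E) : Type := deBrangesSubmodule E

section deBranges

variable {E : ℂ → ℂ} {hE : IsHermiteBiehler E}

instance : AddCommGroup (DeBrangesSpace E hE) :=
  inferInstanceAs (AddCommGroup (deBrangesSubmodule E))

instance : Module ℂ (DeBrangesSpace E hE) :=
  inferInstanceAs (Module ℂ (deBrangesSubmodule E))

/-- The entire function underlying an element of `𝓗(E)`. -/
def DeBrangesSpace.toSubmodule : DeBrangesSpace E hE ≃ₗ[ℂ] deBrangesSubmodule E :=
  LinearEquiv.refl ℂ (deBrangesSubmodule E)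

instance : CoeFun (DeBrangesSpace E hE) (fun _ => ℂ → ℂ) :=
  ⟨fun f => (DeBrangesSpace.toSubmodule f : ℂ → ℂ)⟩

theorem DeBrangesSpace.continuous_boundary (f : DeBrangesSpace E hE) :
    Continuous fun x : ℝ => f x / E x :=
  (f.toSubmodule.2.1.continuous.comp continuous_ofReal).div (hE.entire.continuous.comp continuous_ofReal)
    hE.real_ne_zero

theorem DeBrangesSpace.memLp_boundary (f : DeBrangesSpace E hE) :
    MemLp (fun x : ℝ => f x / E x) 2 volume := by
  refine ⟨f.continuous_boundary.aestronglyMeasurable, ?_⟩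
  rw [eLpNorm_lt_top_iff_lintegral_rpow_enorm_lt_top (by norm_num) (by norm_num)]
  let v : ℕ → ℝ := fun n => 1 / ((n : ℝ) + 1)
  have hv : ∀ n, 0 < v n := fun n => by positivity
  have hv0 : Tendsto v atTop (𝓝 0) := tendsto_one_div_add_atTop_nhds_zero_nat
  let q : ℂ → ℂ := fun z => f z / E z
  have hq : IsHardy q := f.toSubmodule.2.2.1
  have hlim : ∀ u : ℝ, Tendsto (fun n => ‖q (u + v n * I)‖ₑ ^ 2) atTop (𝓝 (‖q u‖ₑ ^ 2)) := by
    intro u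
    have h1 : ContinuousAt q u :=
      f.toSubmodule.2.1.continuous.continuousAt.div hE.entire.continuous.continuousAt (hE.real_ne_zero u)
    have h2 : Tendsto (fun n => (u : ℂ) + v n * I) atTop (𝓝 (u : ℂ)) := by
      have : Tendsto (fun n => (u : ℂ) + (v n : ℂ) * I) atTop (𝓝 ((u : ℂ) + ((0 : ℝ) : ℂ) * I)) :=
        ((continuous_ofReal.tendsto 0).comp hv0 |>.mul_const I).const_add _
      simpa using this
    exact ENNReal.Tendsto.pow (h1.tendsto.comp h2).enorm
  have hbound := hq.2
  calc ∫⁻ u : ℝ, ‖f u / E u‖ₑ ^ (2 : ℝ≥0∞).toReal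
      = ∫⁻ u : ℝ, liminf (fun n => ‖q (u + v n * I)‖ₑ ^ 2) atTop := by
        refine lintegral_congr fun u => ?_
        rw [(hlim u).liminf_eq]
        simp [q]
    _ ≤ liminf (fun n => ∫⁻ u : ℝ, ‖q (u + v n * I)‖ₑ ^ 2) atTop :=
        lintegral_liminf_le fun n =>
          (hq.continuous_line (hv n)).enorm.measurable.pow_const 2
    _ ≤ ⨆ (v : ℝ) (_ : 0 < v), ∫⁻ u : ℝ, ‖q (u + v * I)‖ₑ ^ 2 := by
        refine liminf_le_of_le (by isBoundedDefault) ?_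
        intro b hb
        obtain ⟨n, hn⟩ := hb.exists
        exact hn.trans (le_iSup₂
          (f := fun (v : ℝ) (_ : 0 < v) => ∫⁻ u : ℝ, ‖q (u + v * I)‖ₑ ^ 2) (v n) (hv n))
    _ < ∞ := hbound

/-- The isometry `f ↦ f/E` of `𝓗(E)` into `L²(ℝ)`, which defines the norm of `𝓗(E)`. -/
def deBrangesToL2 : DeBrangesSpace E hE →ₗ[ℂ] Lp ℂ 2 (volume : Measure ℝ) where
  toFun f := f.memLp_boundary.toLp _
  map_add' f g := by
    rw [← MemLp.toLp_add]
    refine MemLp.toLp_congr _ _ (Eventually.of_forall fun x => ?_)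
    change (f x + g x) / E x = f x / E x + g x / E x
    rw [add_div]
  map_smul' c f := by
    rw [RingHom.id_apply, ← MemLp.toLp_const_smul]
    refine MemLp.toLp_congr _ _ (Eventually.of_forall fun x => ?_)
    change (c * f x) / E x = c * (f x / E x)
    rw [mul_div_assoc]

theorem deBrangesToL2_injective :
    Function.Injective (deBrangesToL2 : DeBrangesSpace E hE →ₗ[ℂ] _) := by
  rw [injective_iff_map_eq_zero]
  intro f hf
  have h1 : (fun x : ℝ => f x / E x) =ᵐ[volume] fun _ => 0 := by
    have h2 := f.memLp_boundary.coeFn_toLp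
    have h3 : f.memLp_boundary.toLp _ = 0 := hf
    rw [h3] at h2
    exact h2.symm.trans (Lp.coeFn_zero ℂ 2 volume)
  have h4 := Continuous.ae_eq_iff_eq volume f.continuous_boundary continuous_const |>.1 h1
  have h5 : ∀ x : ℝ, f x = 0 := fun x => by
    have := congrFun h4 x
    simpa [hE.real_ne_zero x] using this
  have han : AnalyticOnNhd ℂ f Set.univ := f.toSubmodule.2.1.differentiableOn.analyticOnNhd isOpen_univ
  have hfr : ∃ᶠ z in 𝓝[≠] (0 : ℂ), f z = 0 := by
    have ht : Tendsto (fun n : ℕ => ((1 / ((n : ℝ) + 1) : ℝ) : ℂ)) atTop (𝓝[≠] (0 : ℂ)) := by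
      refine tendsto_nhdsWithin_iff.2 ⟨?_, Eventually.of_forall fun n => ?_⟩
      · have := (continuous_ofReal.tendsto 0).comp
          (tendsto_one_div_add_atTop_nhds_zero_nat (𝕜 := ℝ))
        rw [ofReal_zero] at this
        exact this
      · have : (0 : ℝ) < 1 / ((n : ℝ) + 1) := by positivity
        exact ofReal_ne_zero.2 this.ne'
    exact ht.frequently (Frequently.of_forall fun n => h5 _)
  have h6 := han.eq_of_frequently_eq (g := fun _ => 0)
    (analyticOnNhd_const) hfr
  exact DeBrangesSpace.toSubmodule.injective (Subtype.ext h6)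

instance : NormedAddCommGroup (DeBrangesSpace E hE) :=
  NormedAddCommGroup.induced _ _ deBrangesToL2 deBrangesToL2_injective

/-- `𝓗(E)` with the inner product of `L²(ℝ)` of the quotients by `E`. -/
instance : InnerProductSpace ℂ (DeBrangesSpace E hE) :=
  InnerProductSpace.induced (deBrangesToL2 : DeBrangesSpace E hE →ₗ[ℂ] _)

end deBranges

/-- `E₀(z) = z³ + 2iz² - z - i`. -/
def E₀ (z : ℂ) : ℂ := z ^ 3 + 2 * I * z ^ 2 - z - I

theorem re_add_im_ofReal (a b : ℝ) : ((a : ℂ) + (b : ℂ) * I).re = a := by simp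

theorem im_add_im_ofReal (a b : ℝ) : ((a : ℂ) + (b : ℂ) * I).im = b := by simp

theorem E₀_im_pos (z : ℂ) (hz : 0 < z.im) : ‖sharp E₀ z‖ < ‖E₀ z‖ := by
  have hs : sharp E₀ z = z ^ 3 - 2 * I * z ^ 2 - z + I := by
    simp only [sharp, E₀, map_sub, map_add, map_mul, map_pow, conj_conj, conj_I, conj_ofNat]
    ring
  rw [hs, E₀]
  have h : normSq (z ^ 3 - 2 * I * z ^ 2 - z + I) < normSq (z ^ 3 + 2 * I * z ^ 2 - z - I) := by
    obtain ⟨x, y⟩ := z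
    simp only at hz
    have e : normSq ((⟨x, y⟩ : ℂ) ^ 3 + 2 * I * (⟨x, y⟩ : ℂ) ^ 2 - ⟨x, y⟩ - I)
        - normSq ((⟨x, y⟩ : ℂ) ^ 3 - 2 * I * (⟨x, y⟩ : ℂ) ^ 2 - ⟨x, y⟩ + I)
        = 4 * y * (((x ^ 2 - y ^ 2 - 1) ^ 2 + (2 * x * y) ^ 2)
          + (x ^ 2 + y ^ 2) * ((x + 1) ^ 2 + y ^ 2) / 2
          + (x ^ 2 + y ^ 2) * ((x - 1) ^ 2 + y ^ 2) / 2) := by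
      simp [normSq_apply, pow_succ]
      ring
    have hpos : 0 < 4 * y * (((x ^ 2 - y ^ 2 - 1) ^ 2 + (2 * x * y) ^ 2)
          + (x ^ 2 + y ^ 2) * ((x + 1) ^ 2 + y ^ 2) / 2
          + (x ^ 2 + y ^ 2) * ((x - 1) ^ 2 + y ^ 2) / 2) := by
      positivity
    linarith
  rw [normSq_eq_norm_sq, normSq_eq_norm_sq] at h
  exact lt_of_pow_lt_pow_left₀ 2 (norm_nonneg _) h

theorem E₀_isHermiteBiehler : IsHermiteBiehler E₀ where
  entire := by unfold E₀; fun_prop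
  lt := E₀_im_pos
  real_ne_zero x := by
    intro h
    have e : E₀ x = ((x ^ 3 - x : ℝ) : ℂ) + ((2 * x ^ 2 - 1 : ℝ) : ℂ) * I := by
      unfold E₀; push_cast; ring
    rw [e] at h
    have h1 : x ^ 3 - x = 0 := by
      have := congrArg re h
      rwa [re_add_im_ofReal, zero_re] at this
    have h2 : 2 * x ^ 2 - 1 = 0 := by
      have := congrArg im h
      rwa [im_add_im_ofReal, zero_im] at this
    have h3 : x = 0 := by
      have : x * (2 * x ^ 2 - 1) = 2 * (x ^ 3 - x) + x := by ring
      rw [h1, h2] at this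
      linarith
    rw [h3] at h2
    norm_num at h2

/-- The meromorphic inner function `Θ₀ = E₀♯ / E₀`. -/
def Θ₀ (z : ℂ) : ℂ := sharp E₀ z / E₀ z

/-- The measure `μ_Θ`: point masses `2π / |Θ'(γ)|` at the points `γ` of
`σ(Θ) = {γ ∈ ℝ | Θ(γ) = -1}`. -/
def clarkMeasure (Θ : ℂ → ℂ) : Measure ℝ :=
  Measure.sum fun γ : {x : ℝ // Θ x = -1} =>
    ENNReal.ofReal (2 * Real.pi / ‖deriv Θ ((γ : ℝ) : ℂ)‖) • Measure.dirac (γ : ℝ)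

/-- The model space `𝓚(Θ₀)`. -/
abbrev K₀ : Type := modelSpace Θ₀

/-- The de Branges space `𝓗(E₀)`. -/
abbrev HE₀ : Type := DeBrangesSpace E₀ E₀_isHermiteBiehler

/-! ### The screw line in the model space -/

/-- The orthonormal basis `F₀, F₁, F₋₁` of `𝓗(E₀)`. -/
def F₀ (z : ℂ) : ℂ := (z ^ 2 - 1) / (Real.sqrt Real.pi : ℂ)

/-- See `F₀`. -/
def F₁ (z : ℂ) : ℂ := z * (z + 1) / (Real.sqrt (2 * Real.pi) : ℂ)

/-- See `F₀`. -/
def Fm₁ (z : ℂ) : ℂ := z * (z - 1) / (Real.sqrt (2 * Real.pi) : ℂ)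

/-- The screw line `𝔖_t(z)` in the model space. -/
def screwS (t : ℝ) (z : ℂ) : ℂ :=
  (Real.sqrt Real.pi : ℂ) * (I * t) * (F₀ z / E₀ z)
    + (Real.sqrt (Real.pi / 2) : ℂ) * (exp (I * t) - 1) * (F₁ z / E₀ z)
    - (Real.sqrt (Real.pi / 2) : ℂ) * (exp (-(I * t)) - 1) * (Fm₁ z / E₀ z)

/-- `𝓟̂_φ(z) = ∫ φ(t) 𝔖_t(z) dt`. -/
def Phat (φ : ℝ → ℂ) (z : ℂ) : ℂ := ∫ t, φ t * screwS t z

/-! ### Hamiltonians and the spaces `L²(H)`, `L̂²(H)` -/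

/-- A Hamiltonian on `[0, L)`. -/
structure Hamiltonian (L : ℝ) where
  toFun : ℝ → Matrix (Fin 2) (Fin 2) ℝ
  posSemidef : ∀ᵐ t ∂(volume.restrict (Set.Ico 0 L)), (toFun t).PosSemidef
  ne_zero : ∀ᵐ t ∂(volume.restrict (Set.Ico 0 L)), toFun t ≠ 0
  locallyIntegrable : ∀ i j, LocallyIntegrableOn (fun t => toFun t i j) (Set.Ico 0 L)

section L2H

variable {L : ℝ}

/-- The pointwise form `F(t)^* H(t) G(t)`. -/
def hForm (H : Hamiltonian L) (F G : ℝ → Fin 2 → ℂ) (t : ℝ) : ℂ :=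
  ∑ i, ∑ j, conj (F t i) * (H.toFun t i j : ℂ) * G t j

theorem hForm_self (H : Hamiltonian L) (F : ℝ → Fin 2 → ℂ) {t : ℝ}
    (ht : (H.toFun t).PosSemidef) : ∃ r : ℝ, 0 ≤ r ∧ hForm H F F t = r := by
  have hs : H.toFun t 1 0 = H.toFun t 0 1 := by simpa using ht.1.apply 0 1
  have h1 := ht.dotProduct_mulVec_nonneg (fun i => (F t i).re)
  have h2 := ht.dotProduct_mulVec_nonneg (fun i => (F t i).im)
  refine ⟨_, add_nonneg h1 h2, ?_⟩
  apply Complex.ext <;>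
  simp [hForm, Fin.sum_univ_two, dotProduct, Matrix.mulVec, hs] <;> ring

theorem hForm_conj (H : Hamiltonian L) (F G : ℝ → Fin 2 → ℂ) {t : ℝ}
    (ht : (H.toFun t).PosSemidef) : conj (hForm H F G t) = hForm H G F t := by
  have hs : H.toFun t 1 0 = H.toFun t 0 1 := by simpa using ht.1.apply 0 1
  simp only [hForm, Fin.sum_univ_two, map_add, map_mul, conj_conj, conj_ofReal, hs]
  ring

theorem aestronglyMeasurable_hForm (H : Hamiltonian L) {F G : ℝ → Fin 2 → ℂ}
    (hF : AEStronglyMeasurable F (volume.restrict (Set.Ico 0 L)))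
    (hG : AEStronglyMeasurable G (volume.restrict (Set.Ico 0 L))) :
    AEStronglyMeasurable (hForm H F G) (volume.restrict (Set.Ico 0 L)) := by
  have a : ∀ i j, AEStronglyMeasurable
      (fun t => conj (F t i) * (H.toFun t i j : ℂ) * G t j) (volume.restrict (Set.Ico 0 L)) := by
    intro i j
    have h1 : AEStronglyMeasurable (fun t => conj (F t i)) (volume.restrict (Set.Ico 0 L)) :=
      (continuous_conj.comp (continuous_apply (A := fun _ : Fin 2 => ℂ) i)).comp_aestronglyMeasurable hF
    have h2 : AEStronglyMeasurable (fun t => (H.toFun t i j : ℂ))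
        (volume.restrict (Set.Ico 0 L)) :=
      continuous_ofReal.comp_aestronglyMeasurable (H.locallyIntegrable i j).aestronglyMeasurable
    exact (h1.mul h2).mul ((continuous_apply j).comp_aestronglyMeasurable hG)
  have e : hForm H F G = fun t => ∑ i, ∑ j, conj (F t i) * (H.toFun t i j : ℂ) * G t j := rfl
  rw [e]
  simp only [Fin.sum_univ_two]
  exact ((a 0 0).add (a 0 1)).add ((a 1 0).add (a 1 1))

/-- Measurable `ℂ²`-valued functions on `[0, L)` with `∫ F^* H F < ∞`. -/
def preL2 (H : Hamiltonian L) : Submodule ℂ (ℝ → Fin 2 → ℂ) where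
  carrier := {F | AEStronglyMeasurable F (volume.restrict (Set.Ico 0 L)) ∧
    Integrable (hForm H F F) (volume.restrict (Set.Ico 0 L))}
  zero_mem' := by
    refine ⟨aestronglyMeasurable_const, ?_⟩
    have : hForm H 0 0 = fun _ => 0 := by ext t; simp [hForm]
    rw [this]
    exact integrable_zero _ _ _
  add_mem' := by
    rintro F G ⟨hF, hFi⟩ ⟨hG, hGi⟩
    refine ⟨hF.add hG, ?_⟩
    refine Integrable.mono' ((hFi.norm.const_mul 2).add (hGi.norm.const_mul 2))
      (aestronglyMeasurable_hForm H (hF.add hG) (hF.add hG)) ?_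
    filter_upwards [H.posSemidef] with t ht
    obtain ⟨a, ha, ea⟩ := hForm_self H F ht
    obtain ⟨b, hb, eb⟩ := hForm_self H G ht
    obtain ⟨c, hc, ec⟩ := hForm_self H (F + G) ht
    obtain ⟨d, hd, ed⟩ := hForm_self H (F - G) ht
    have par : hForm H (F + G) (F + G) t + hForm H (F - G) (F - G) t
        = 2 * hForm H F F t + 2 * hForm H G G t := by
      simp only [hForm, Fin.sum_univ_two, Pi.add_apply, Pi.sub_apply, map_add, map_sub]
      ring
    rw [ea, eb, ec, ed] at par
    have par' : c + d = 2 * a + 2 * b := by exact_mod_cast par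
    simp only [Pi.add_apply, ea, eb, ec, norm_real, Real.norm_of_nonneg ha,
      Real.norm_of_nonneg hb, Real.norm_of_nonneg hc]
    linarith
  smul_mem' := by
    rintro c F ⟨hF, hFi⟩
    refine ⟨hF.const_smul c, ?_⟩
    have : hForm H (c • F) (c • F) = fun t => (conj c * c) * hForm H F F t := by
      ext t
      simp only [hForm, Fin.sum_univ_two, Pi.smul_apply, smul_eq_mul, map_mul]
      ring
    rw [this]
    exact hFi.const_mul _

theorem integrable_hForm (H : Hamiltonian L) {F G : ℝ → Fin 2 → ℂ}
    (hF : F ∈ preL2 H) (hG : G ∈ preL2 H) :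
    Integrable (hForm H F G) (volume.restrict (Set.Ico 0 L)) := by
  have p1 := ((preL2 H).add_mem hF hG).2
  have p2 := ((preL2 H).sub_mem hF hG).2
  have p3 := ((preL2 H).add_mem hF ((preL2 H).smul_mem I hG)).2
  have p4 := ((preL2 H).sub_mem hF ((preL2 H).smul_mem I hG)).2
  have e : hForm H F G = fun t => (1 / 4 : ℂ) * (hForm H (F + G) (F + G) t
      - hForm H (F - G) (F - G) t - I * hForm H (F + I • G) (F + I • G) t
      + I * hForm H (F - I • G) (F - I • G) t) := by
    ext t
    simp only [hForm, Fin.sum_univ_two, Pi.add_apply, Pi.sub_apply, Pi.smul_apply, smul_eq_mul,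
      map_add, map_sub, map_mul, conj_I]
    ring_nf
    simp only [I_sq]
    ring
  rw [e]
  exact (((p1.sub p2).sub (p3.const_mul I)).add (p4.const_mul I)).const_mul _

/-- The functions of `preL2 H`, as a type that carries the seminorm `‖·‖_H`. -/
def PreL2 (H : Hamiltonian L) : Type := preL2 H

instance (H : Hamiltonian L) : AddCommGroup (PreL2 H) := inferInstanceAs (AddCommGroup (preL2 H))

instance (H : Hamiltonian L) : Module ℂ (PreL2 H) := inferInstanceAs (Module ℂ (preL2 H))

/-- The function underlying an element of `PreL2 H`. -/
def PreL2.toSubmodule {H : Hamiltonian L} : PreL2 H ≃ₗ[ℂ] preL2 H :=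
  LinearEquiv.refl ℂ (preL2 H)

instance (H : Hamiltonian L) : CoeFun (PreL2 H) (fun _ => ℝ → Fin 2 → ℂ) :=
  ⟨fun F => (PreL2.toSubmodule F : ℝ → Fin 2 → ℂ)⟩

/-- The semi-inner product `(1/π) ∫_{[0,L)} F^* H G`. -/
@[reducible] def preL2Core (H : Hamiltonian L) : PreInnerProductSpace.Core ℂ (PreL2 H) where
  inner F G := (1 / Real.pi : ℂ) * ∫ t in Set.Ico 0 L, hForm H F G t
  conj_inner_symm F G := by
    rw [map_mul, ← integral_conj]
    congr 1
    · simp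
    · refine integral_congr_ae ?_
      filter_upwards [H.posSemidef] with t ht
      exact hForm_conj H _ _ ht
  re_inner_nonneg F := by
    have h : ∫ t in Set.Ico 0 L, hForm H F F t
        = ((∫ t in Set.Ico 0 L, (hForm H F F t).re : ℝ) : ℂ) := by
      refine Eq.trans ?_ integral_ofReal
      refine integral_congr_ae ?_
      filter_upwards [H.posSemidef] with t ht
      obtain ⟨r, _, hr⟩ := hForm_self H F ht
      rw [hr]; simp
    have h0 : 0 ≤ ∫ t in Set.Ico 0 L, (hForm H F F t).re := by
      refine integral_nonneg_of_ae ?_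
      filter_upwards [H.posSemidef] with t ht
      obtain ⟨r, hr0, hr⟩ := hForm_self H F ht
      rw [hr]; simpa using hr0
    rw [h]
    norm_cast
    exact mul_nonneg (by positivity) h0
  add_left F G K := by
    rw [← mul_add, ← integral_add (integrable_hForm H F.toSubmodule.2 K.toSubmodule.2) (integrable_hForm H G.toSubmodule.2 K.toSubmodule.2)]
    congr 1
    refine integral_congr_ae (Eventually.of_forall fun t => ?_)
    simp only [hForm, Fin.sum_univ_two, Submodule.coe_add, Pi.add_apply, map_add]
    ring
  smul_left F G c := by
    have e : ∫ t in Set.Ico 0 L, hForm H (c • F : PreL2 H) G t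
        = conj c * ∫ t in Set.Ico 0 L, hForm H F G t := by
      rw [← integral_const_mul]
      refine integral_congr_ae (Eventually.of_forall fun t => ?_)
      simp only [hForm, Fin.sum_univ_two, map_smul, Submodule.coe_smul, Pi.smul_apply, smul_eq_mul,
        map_mul]
      ring
    rw [e, mul_left_comm]

instance (H : Hamiltonian L) : SeminormedAddCommGroup (PreL2 H) :=
  @InnerProductSpace.Core.toSeminormedAddCommGroup ℂ (PreL2 H) _ _ _ (preL2Core H)

instance (H : Hamiltonian L) : InnerProductSpace ℂ (PreL2 H) :=
  InnerProductSpace.ofCore (preL2Core H)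

/-- The Hilbert space `L²(H)`, realized by classes of measurable functions. -/
abbrev L2H (H : Hamiltonian L) : Type := SeparationQuotient (PreL2 H)

/-- `ξ ∈ L²(H)` is the class of the function `F`. -/
def Represents {H : Hamiltonian L} (ξ : L2H H) (F : ℝ → Fin 2 → ℂ) : Prop :=
  ∃ F' : PreL2 H, (F' : ℝ → Fin 2 → ℂ) = F ∧ ξ = SeparationQuotient.mk F'

/-- `(a, b) ⊆ [0, L)` is an indivisible interval of type `θ` for `H`. -/
def IsIndivisible (H : Hamiltonian L) (θ a b : ℝ) : Prop :=
  0 ≤ a ∧ a < b ∧ b ≤ L ∧ ∀ᵐ t ∂(volume.restrict (Set.Ioo a b)),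
    Matrix.vecMul ![Real.cos θ, Real.sin θ] (!![0, -1; 1, 0] * H.toFun t) = 0

/-- `L̂²(H)`: the classes of functions `F` for which `(cos θ, sin θ) · F` is constant on every
indivisible interval of type `θ`. -/
def L2Hhat (H : Hamiltonian L) : Submodule ℂ (L2H H) where
  carrier := {ξ | ∃ F, Represents ξ F ∧ ∀ θ a b : ℝ, IsIndivisible H θ a b →
    ∃ c : ℂ, ∀ᵐ t ∂(volume.restrict (Set.Ioo a b)),
      (Real.cos θ : ℂ) * F t 0 + (Real.sin θ : ℂ) * F t 1 = c}
  zero_mem' := ⟨0, ⟨0, rfl, rfl⟩, fun θ a b _ => ⟨0, by simp⟩⟩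
  add_mem' := by
    rintro ξ η ⟨F, ⟨F', rfl, rfl⟩, hF'⟩ ⟨G, ⟨G', rfl, rfl⟩, hG'⟩
    refine ⟨_, ⟨F' + G', rfl, rfl⟩, fun θ a b h => ?_⟩
    obtain ⟨c, hc⟩ := hF' θ a b h
    obtain ⟨d, hd⟩ := hG' θ a b h
    refine ⟨c + d, ?_⟩
    filter_upwards [hc, hd] with t h1 h2
    rw [← h1, ← h2]
    simp only [map_add, Submodule.coe_add, Pi.add_apply]
    ring
  smul_mem' := by
    rintro k ξ ⟨F, ⟨F', rfl, rfl⟩, hF'⟩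
    refine ⟨_, ⟨k • F', rfl, rfl⟩, fun θ a b h => ?_⟩
    obtain ⟨c, hc⟩ := hF' θ a b h
    refine ⟨k * c, ?_⟩
    filter_upwards [hc] with t h1
    rw [← h1]
    simp only [map_smul, Submodule.coe_smul, Pi.smul_apply, smul_eq_mul]
    ring

end L2H

/-- The matrix function `H₀` on `[0, 5)`. -/
def H₀fun (t : ℝ) : Matrix (Fin 2) (Fin 2) ℝ :=
  if t < 1 / 2 ∨ 9 / 2 ≤ t then !![0, 0; 0, 1] else !![1, 0; 0, 0]

/-- The Hamiltonian `H₀` on `[0, 5)`. -/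
def H₀ : Hamiltonian 5 where
  toFun := H₀fun
  posSemidef := by
    refine Eventually.of_forall fun t => ?_
    have e1 : (!![0, 0; 0, 1] : Matrix (Fin 2) (Fin 2) ℝ) = Matrix.diagonal ![0, 1] := by
      ext i j; fin_cases i <;> fin_cases j <;> rfl
    have e2 : (!![1, 0; 0, 0] : Matrix (Fin 2) (Fin 2) ℝ) = Matrix.diagonal ![1, 0] := by
      ext i j; fin_cases i <;> fin_cases j <;> rfl
    unfold H₀fun
    split_ifs
    · rw [e1]; exact Matrix.PosSemidef.diagonal (by intro i; fin_cases i <;> simp)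
    · rw [e2]; exact Matrix.PosSemidef.diagonal (by intro i; fin_cases i <;> simp)
  ne_zero := by
    refine Eventually.of_forall fun t => ?_
    unfold H₀fun
    split_ifs
    · intro h; simpa using congrFun (congrFun h 1) 1
    · intro h; simpa using congrFun (congrFun h 0) 0
  locallyIntegrable := by
    intro i j
    have hm : Measurable fun t => H₀fun t i j := by
      have : (fun t => H₀fun t i j) = fun t => if t < 1 / 2 ∨ 9 / 2 ≤ t
          then (!![0, 0; 0, 1] : Matrix (Fin 2) (Fin 2) ℝ) i j
          else (!![1, 0; 0, 0] : Matrix (Fin 2) (Fin 2) ℝ) i j := by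
        ext t; unfold H₀fun; split_ifs <;> rfl
      rw [this]
      exact Measurable.ite (measurableSet_Iio.union measurableSet_Ici) measurable_const
        measurable_const
    have hb : ∀ t, ‖H₀fun t i j‖ ≤ 1 := by
      intro t
      unfold H₀fun
      split_ifs <;> fin_cases i <;> fin_cases j <;> simp
    refine LocallyIntegrable.locallyIntegrableOn ?_ _
    refine (locallyIntegrable_const (1 : ℝ)).mono hm.aestronglyMeasurable ?_
    exact Eventually.of_forall fun t => by simpa using hb t

/-! ### The Weyl transform and the map `𝖫₀` -/

/-- `C(t,z)`. -/
def C₀ (t : ℝ) (z : ℂ) : ℂ :=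
  if t < 1 / 2 then -t * z
  else if t < 9 / 2 then -z / 2
  else (2 * t - 9) * z ^ 3 - (t - 4) * z

/-- `D(t,z)`. -/
def D₀ (t : ℝ) (z : ℂ) : ℂ :=
  if t < 1 / 2 then 1
  else if t < 9 / 2 then 1 + (1 - 2 * t) / 4 * z ^ 2
  else 1 - 2 * z ^ 2

/-- The row `[C(t,z)  D(t,z)]`. -/
def row₀ (t : ℝ) (z : ℂ) : Fin 2 → ℂ := ![C₀ t z, D₀ t z]

/-- `w(t,z)` is the second row of the fundamental matrix `W(t,z)` of the Hamiltonian `H`, that is,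
of the solution of `(d/dt) W(t,z) J = z W(t,z) H(t)`, `W(0,z) = 1`, `J = [0, -1; 1, 0]`
(in integrated form, on `[0, L]`). -/
def IsFundamentalRow {L : ℝ} (H : Hamiltonian L) (w : ℝ → ℂ → Fin 2 → ℂ) : Prop :=
  ∀ z : ℂ, ∀ t ∈ Set.Icc 0 L, ∀ j : Fin 2,
    Matrix.vecMul (w t z) !![0, -1; 1, 0] j =
      Matrix.vecMul ![0, 1] (!![0, -1; 1, 0] : Matrix (Fin 2) (Fin 2) ℂ) j
        + z * ∫ s in (0 : ℝ)..t, Matrix.vecMul (w s z) ((H.toFun s).map ofReal) j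

/-- The Weyl transform `(1/π) ∫_{[0,5)} [C(t,z)  D(t,z)] H₀(t) F(t) dt`. -/
def weyl (F : ℝ → Fin 2 → ℂ) (z : ℂ) : ℂ :=
  (1 / Real.pi : ℂ) * ∫ t in Set.Ico (0 : ℝ) 5,
    dotProduct (row₀ t z) (Matrix.mulVec ((H₀.toFun t).map ofReal) (F t))

/-- The kernel `L₀(t,s)`, with the normalization that makes `𝖫₀` isometric. -/
def L₀ker (t s : ℝ) : Fin 2 → ℂ :=
  (Real.sqrt Real.pi : ℂ) • (-(I * s) • row₀ t 0 + ((exp (I * s) - 1) / 2) • row₀ t 1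
    - ((exp (-(I * s)) - 1) / 2) • row₀ t (-1))

/-- `(𝖫₀ φ)(t) = ∫ L₀(t,s) φ(s) ds`. -/
def L₀fun (φ : ℝ → ℂ) (t : ℝ) : Fin 2 → ℂ := fun i => ∫ s, L₀ker t s i * φ s

end ScrewLine

end

open ScrewLine

/-! Every space of the diagram is a copy of `EuclideanSpace ℂ (Fin 3)`, and every map becomes the
identity once each space is given the right orthonormal coordinates. The three coordinates belong to
the nodes 0, 1, -1, which are the zeros of (E₀ + E₀♯)/2 = z³ - z. So the work is to build one
surjective linear isometry between ℂ³ and each space. The maps of the theorem are compositions of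
these isometries and their inverses, commutativity is then automatic, and what remains is to check
that the compositions are given by the stated formulas.

For the screw function, G_{g₀}(t,s) = (cos t - 1)(cos s - 1) + sin t sin s + ts has rank three. By
the parallelogram law the form equals that of the vector (Φ₁(φ,0), Φ₁(φ,1)/√2, Φ₁(φ,-1)/√2)
(`inner_testCoord`). These vectors fill ℂ³ because 1, t, cos t, sin t are linearly independent
(`testCoord_surjective`). The quotient is therefore already complete.

For `H₀`, each indivisible interval lies inside one of the three pieces of `H₀`, so L̂²(H₀) consists
of step functions with three values (`IsStep.const_of_isIndivisible`,
`exists_isStep_of_mem_L2Hhat`). The component of [C D] that `H₀` sees is constant on each piece,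
namely 1, -z/2, 1 - 2z². Hence the Weyl transform of a step function is an explicit quadratic
polynomial.

The analytic part is that 𝓗(E₀) is the space of polynomials of degree at most two, with orthonormal
basis `F₀`, `F₁`, `Fm₁`, and that f ↦ f/E₀ maps it onto 𝓚(Θ₀). Orthonormality follows from Cauchy's
theorem, since E₀ has no zeros in the closed upper half-plane (`integral_cross`, `integral_sq_zero`,
`integral_sq_one`). For the identification of both spaces, divide with remainder by E₀♯: f = p + E₀♯
q with p quadratic (`exists_eq_quad_add`). The finite Blaschke product Θ₀ can be cancelled in H²
(`IsHardy.of_Θ₀_mul`). For f in 𝓗(E₀) this puts q and q♯ in H², and an entire function with that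
property vanishes (`eq_zero_of_isHardy_of_isHardy_sharp`). For F in 𝓚(Θ₀), apply the division to
E₀F: then F - p/E₀ = Θ₀q lies in Θ₀H² and also in its orthogonal complement, because p/E₀ is
orthogonal to Θ₀H² (`integral_mul_quad_div_E₀`). So it is zero.

Finally, each basis function vanishes at two of the nodes, and its quotient by E₀ at the third gives
the constant -i/√π of the map M. -/

noncomputable section

namespace ScrewLine

/-! ### Square integrable functions on the atoms `0, 1, -1` -/

/-- The measure with mass `a` at `0` and mass `b` at `1` and at `-1`. -/
def atoms (a b : ℝ) : Measure ℝ :=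
  ENNReal.ofReal a • Measure.dirac 0 + ENNReal.ofReal b • Measure.dirac 1
    + ENNReal.ofReal b • Measure.dirac (-1)

/-- The points `0, 1, -1`. -/
def node : Fin 3 → ℝ := ![0, 1, -1]

theorem node_injective : Function.Injective node := by
  intro i j h
  fin_cases i <;> fin_cases j <;> simp [node] at h ⊢ <;> norm_num at h

/-- Positive masses leave no null node, so identities in L² of the nodes reduce to three pointwise
ones. -/
theorem ae_atoms_iff {a b : ℝ} (ha : 0 < a) (hb : 0 < b) {p : ℝ → Prop} :
    (∀ᵐ x ∂(atoms a b), p x) ↔ ∀ i, p (node i) := by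
  have ha' : ENNReal.ofReal a ≠ 0 := by simpa using ha
  have hb' : ENNReal.ofReal b ≠ 0 := by simpa using hb
  simp only [atoms, ae_add_measure_iff, Measure.ae_ennreal_smul_measure_iff ha',
    Measure.ae_ennreal_smul_measure_iff hb', ae_dirac_eq, eventually_pure, Fin.forall_fin_succ,
    Fin.forall_fin_zero, node]
  simp [and_assoc]

theorem integral_atoms {a b : ℝ} (ha : 0 ≤ a) (hb : 0 ≤ b) (f : ℝ → ℂ) :
    ∫ x, f x ∂(atoms a b) = a * f 0 + b * f 1 + b * f (-1) := by
  have h : ∀ (c x : ℝ), Integrable f (ENNReal.ofReal c • Measure.dirac x) := fun c x =>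
    (integrable_dirac (by simp)).smul_measure (by simp)
  unfold atoms
  rw [integral_add_measure ((h a 0).add_measure (h b 1)) (h b _),
    integral_add_measure (h a 0) (h b 1)]
  simp [integral_smul_measure, ha, hb]

theorem memLp_atoms (a b : ℝ) (f : ℝ → ℂ) : MemLp f 2 (atoms a b) := by
  have hm : ∀ (c x : ℝ), AEStronglyMeasurable f (ENNReal.ofReal c • Measure.dirac x) :=
    fun c x => aestronglyMeasurable_dirac.smul_measure _
  have h : ∀ (c x : ℝ), Integrable (fun x => ‖f x‖ ^ 2) (ENNReal.ofReal c • Measure.dirac x) :=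
    fun c x => (integrable_dirac (by simp)).smul_measure (by simp)
  unfold atoms
  rw [memLp_two_iff_integrable_sq_norm
    (((hm a 0).add_measure (hm b 1)).add_measure (hm b (-1)))]
  exact ((h a 0).add_measure (h b 1)).add_measure (h b _)

/-- The function on the nodes with coordinates `v`. -/
def nodeFun (v : EuclideanSpace ℂ (Fin 3)) (x : ℝ) : ℂ :=
  if x = 0 then v 0 else (Real.sqrt 2 : ℂ) * (if x = 1 then v 1 else v 2)

@[simp] theorem nodeFun_zero (v : EuclideanSpace ℂ (Fin 3)) : nodeFun v 0 = v 0 := by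
  simp [nodeFun]

@[simp] theorem nodeFun_one (v : EuclideanSpace ℂ (Fin 3)) :
    nodeFun v 1 = (Real.sqrt 2 : ℂ) * v 1 := by
  simp [nodeFun]

@[simp] theorem nodeFun_neg_one (v : EuclideanSpace ℂ (Fin 3)) :
    nodeFun v (-1) = (Real.sqrt 2 : ℂ) * v 2 := by
  simp only [nodeFun]
  norm_num

theorem memLp_nodeFun {a : ℝ} {μ : Measure ℝ} (hμ : μ = atoms a (a / 2)) (κ : ℂ)
    (v : EuclideanSpace ℂ (Fin 3)) : MemLp (fun x => κ * nodeFun v x) 2 μ := by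
  subst hμ
  exact memLp_atoms _ _ _

/-- The map sending coordinates to `κ` times the function on the nodes. -/
def nodeMap {a : ℝ} {μ : Measure ℝ} (hμ : μ = atoms a (a / 2)) (κ : ℂ) :
    EuclideanSpace ℂ (Fin 3) →ₗ[ℂ] Lp ℂ 2 μ where
  toFun v := (memLp_nodeFun hμ κ v).toLp (fun x => κ * nodeFun v x)
  map_add' v w := by
    rw [← MemLp.toLp_add]
    refine MemLp.toLp_congr _ _ (Eventually.of_forall fun x => ?_)
    simp only [nodeFun, Pi.add_apply, PiLp.add_apply]
    split_ifs <;> ring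
  map_smul' c v := by
    rw [RingHom.id_apply, ← MemLp.toLp_const_smul]
    refine MemLp.toLp_congr _ _ (Eventually.of_forall fun x => ?_)
    simp only [nodeFun, Pi.smul_apply, PiLp.smul_apply, smul_eq_mul]
    split_ifs <;> ring

theorem nodeMap_apply {a : ℝ} {μ : Measure ℝ} (hμ : μ = atoms a (a / 2)) (κ : ℂ)
    (v : EuclideanSpace ℂ (Fin 3)) : nodeMap hμ κ v =ᵐ[μ] fun x => κ * nodeFun v x :=
  (memLp_nodeFun hμ κ v).coeFn_toLp

/-- The factor √2 in `nodeFun` compensates the halved mass at ±1, and |κ|²a = 1 normalizes the rest.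
The same lemma serves τ₀ (a = 1, κ = 1) and the Clark measure (a = π, κ = -i/√π). -/
theorem inner_nodeMap {a : ℝ} {μ : Measure ℝ} (hμ : μ = atoms a (a / 2)) {κ : ℂ} (ha : 0 < a)
    (hκ : normSq κ * a = 1) (v w : EuclideanSpace ℂ (Fin 3)) :
    inner ℂ (nodeMap hμ κ v) (nodeMap hμ κ w) = inner ℂ v w := by
  have h2 : (Real.sqrt 2 : ℂ) * Real.sqrt 2 = 2 := by
    norm_cast
    exact Real.mul_self_sqrt (by norm_num)
  have hκ' : conj κ * κ * a = 1 := by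
    rw [mul_comm (conj κ), mul_conj]
    exact_mod_cast hκ
  rw [L2.inner_def]
  have e : ∫ x, inner ℂ (nodeMap hμ κ v x) (nodeMap hμ κ w x) ∂μ
      = ∫ x, conj (κ * nodeFun v x) * (κ * nodeFun w x) ∂μ := by
    refine integral_congr_ae ?_
    filter_upwards [nodeMap_apply hμ κ v, nodeMap_apply hμ κ w] with x h1 h2
    rw [h1, h2, RCLike.inner_apply, mul_comm]
  rw [e, hμ, integral_atoms ha.le (by positivity)]
  simp only [nodeFun_zero, nodeFun_one, nodeFun_neg_one, PiLp.inner_apply, RCLike.inner_apply,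
    Fin.sum_univ_three, map_mul, conj_ofReal]
  push_cast
  linear_combination (conj (v 0) * w 0 + conj (v 1) * w 1 + conj (v 2) * w 2) * hκ'
    + (conj κ * κ * a / 2 * (conj (v 1) * w 1 + conj (v 2) * w 2)) * h2

theorem nodeMap_surjective {a : ℝ} {μ : Measure ℝ} (hμ : μ = atoms a (a / 2)) {κ : ℂ}
    (ha : 0 < a) (hκ : normSq κ * a = 1) : Function.Surjective (nodeMap hμ κ) := by
  have hκ0 : κ ≠ 0 := by
    rintro rfl
    simp at hκ
  have hs : (Real.sqrt 2 : ℂ) ≠ 0 := by simp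
  intro f
  refine ⟨WithLp.toLp 2 ![f 0 / κ, f 1 / (κ * Real.sqrt 2), f (-1) / (κ * Real.sqrt 2)],
    Lp.ext ((nodeMap_apply hμ κ _).trans ?_)⟩
  rw [EventuallyEq]
  have hb : 0 < a / 2 := by positivity
  subst hμ
  rw [ae_atoms_iff ha hb]
  intro i
  fin_cases i
  · simp [node]; field_simp
  · simp [node]; field_simp
  · simp [node]; field_simp

/-- Coordinates identify `L²` of the nodes with `ℂ³`. -/
def nodeEquiv {a : ℝ} {μ : Measure ℝ} (hμ : μ = atoms a (a / 2)) {κ : ℂ} (ha : 0 < a)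
    (hκ : normSq κ * a = 1) : EuclideanSpace ℂ (Fin 3) ≃ₗᵢ[ℂ] Lp ℂ 2 μ :=
  LinearIsometryEquiv.ofSurjective ((nodeMap hμ κ).isometryOfInner (inner_nodeMap hμ ha hκ))
    (nodeMap_surjective hμ ha hκ)

theorem nodeEquiv_apply {a : ℝ} {μ : Measure ℝ} (hμ : μ = atoms a (a / 2)) {κ : ℂ} (ha : 0 < a)
    (hκ : normSq κ * a = 1) (v : EuclideanSpace ℂ (Fin 3)) :
    nodeEquiv hμ ha hκ v =ᵐ[μ] fun x => κ * nodeFun v x :=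
  nodeMap_apply hμ κ v

theorem τ₀_eq_atoms : τ₀ = atoms 1 (1 / 2) := by
  have h : ENNReal.ofReal (1 / 2) = 2⁻¹ := by
    rw [one_div, ENNReal.ofReal_inv_of_pos (by norm_num)]
    simp
  rw [τ₀, atoms, h]
  simp

/-! ### The Clark measure of `Θ₀` -/

theorem sharp_E₀ (z : ℂ) : sharp E₀ z = z ^ 3 - 2 * I * z ^ 2 - z + I := by
  simp only [sharp, E₀, map_sub, map_add, map_mul, map_pow, conj_conj, conj_I, conj_ofNat]
  ring

theorem E₀_ofReal_ne_zero (x : ℝ) : E₀ x ≠ 0 := E₀_isHermiteBiehler.real_ne_zero x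

/-- The condition is E₀♯ + E₀ = 0, and this sum is 2(x³ - x). -/
theorem Θ₀_eq_neg_one_iff (x : ℝ) : Θ₀ x = -1 ↔ x ∈ Set.range node := by
  rw [Θ₀, div_eq_iff (E₀_ofReal_ne_zero x)]
  have e : sharp E₀ x = -1 * E₀ x ↔ x ^ 3 - x = 0 := by
    rw [sharp_E₀, E₀, ← sub_eq_zero]
    have : (x : ℂ) ^ 3 - 2 * I * x ^ 2 - x + I - -1 * (x ^ 3 + 2 * I * x ^ 2 - x - I)
        = ((2 * (x ^ 3 - x) : ℝ) : ℂ) := by push_cast; ring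
    rw [this, ofReal_eq_zero]
    simp
  rw [e]
  constructor
  · intro h
    have h' : x * ((x - 1) * (x + 1)) = 0 := by linear_combination h
    rcases mul_eq_zero.1 h' with h | h
    · exact ⟨0, by simp [node, h]⟩
    rcases mul_eq_zero.1 h with h | h
    · exact ⟨1, by simp [node]; linarith⟩
    · exact ⟨2, by simp [node]; linarith⟩
  · rintro ⟨i, rfl⟩
    fin_cases i <;> norm_num [node]

theorem hasDerivAt_Θ₀ (z : ℂ) (hz : E₀ z ≠ 0) : HasDerivAt Θ₀
    (((3 * z ^ 2 - 4 * I * z - 1) * E₀ z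
      - (z ^ 3 - 2 * I * z ^ 2 - z + I) * (3 * z ^ 2 + 4 * I * z - 1)) / E₀ z ^ 2) z := by
  have h3 := hasDerivAt_pow 3 z
  have h2 := (hasDerivAt_pow 2 z).const_mul (2 * I)
  have h1 := hasDerivAt_id z
  have a : HasDerivAt (fun z : ℂ => z ^ 3 - 2 * I * z ^ 2 - z + I)
      (3 * z ^ 2 - 4 * I * z - 1) z := by
    refine (((h3.sub h2).sub h1).add_const I).congr_deriv ?_
    norm_num; ring
  have b : HasDerivAt E₀ (3 * z ^ 2 + 4 * I * z - 1) z := by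
    refine (((h3.add h2).sub h1).sub_const I).congr_deriv ?_
    norm_num; ring
  have e : Θ₀ = fun z => (z ^ 3 - 2 * I * z ^ 2 - z + I) / E₀ z := by
    ext z; rw [Θ₀, sharp_E₀]
  rw [e]
  exact a.div b hz

theorem E₀_zero : E₀ 0 = -I := by simp [E₀]

theorem E₀_one : E₀ 1 = I := by simp [E₀]; ring

theorem E₀_neg_one : E₀ (-1) = I := by norm_num [E₀]; ring

theorem norm_deriv_Θ₀_zero : ‖deriv Θ₀ 0‖ = 2 := by
  rw [(hasDerivAt_Θ₀ 0 (by simp [E₀_zero])).deriv, E₀_zero]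
  have : ((3 * (0 : ℂ) ^ 2 - 4 * I * 0 - 1) * -I
    - (0 ^ 3 - 2 * I * 0 ^ 2 - 0 + I) * (3 * 0 ^ 2 + 4 * I * 0 - 1)) / (-I) ^ 2 = -2 * I := by
    rw [neg_sq, I_sq]; ring
  rw [this]
  simp

theorem norm_deriv_Θ₀_one : ‖deriv Θ₀ 1‖ = 4 := by
  rw [(hasDerivAt_Θ₀ 1 (by simp [E₀_one])).deriv, E₀_one]
  have : ((3 * (1 : ℂ) ^ 2 - 4 * I * 1 - 1) * I
    - (1 ^ 3 - 2 * I * 1 ^ 2 - 1 + I) * (3 * 1 ^ 2 + 4 * I * 1 - 1)) / I ^ 2 = -4 * I := by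
    rw [I_sq]; ring
  rw [this]
  simp

theorem norm_deriv_Θ₀_neg_one : ‖deriv Θ₀ (-1)‖ = 4 := by
  rw [(hasDerivAt_Θ₀ (-1) (by simp [E₀_neg_one])).deriv, E₀_neg_one]
  have : ((3 * (-1 : ℂ) ^ 2 - 4 * I * (-1) - 1) * I
    - ((-1) ^ 3 - 2 * I * (-1) ^ 2 - (-1) + I) * (3 * (-1) ^ 2 + 4 * I * (-1) - 1)) / I ^ 2
      = -4 * I := by
    rw [I_sq]; ring
  rw [this]
  simp

/-- The values 2, 4, 4 of |Θ₀'| at the nodes make the Clark measure equal to π times τ₀, which is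
why a scalar M can be isometric. -/
theorem clarkMeasure_Θ₀ : clarkMeasure Θ₀ = atoms Real.pi (Real.pi / 2) := by
  let e : Fin 3 ≃ {x : ℝ // Θ₀ x = -1} :=
    Equiv.ofBijective (fun i => ⟨node i, (Θ₀_eq_neg_one_iff _).2 ⟨i, rfl⟩⟩)
      ⟨fun i j h => node_injective (congrArg Subtype.val h), fun ⟨x, hx⟩ => by
        obtain ⟨i, hi⟩ := (Θ₀_eq_neg_one_iff x).1 hx
        exact ⟨i, Subtype.ext hi⟩⟩
  have h : clarkMeasure Θ₀ = Measure.sum fun i : Fin 3 =>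
      ENNReal.ofReal (2 * Real.pi / ‖deriv Θ₀ (node i : ℂ)‖) • Measure.dirac (node i) := by
    ext s hs
    rw [clarkMeasure, Measure.sum_apply _ hs, Measure.sum_apply _ hs, ← e.tsum_eq]
    rfl
  rw [h, Measure.sum_fintype, Fin.sum_univ_three, atoms]
  have h0 : 2 * Real.pi / ‖deriv Θ₀ (node 0 : ℂ)‖ = Real.pi := by
    simp [node, norm_deriv_Θ₀_zero]
  have h1 : 2 * Real.pi / ‖deriv Θ₀ (node 1 : ℂ)‖ = Real.pi / 2 := by
    simp [node, norm_deriv_Θ₀_one]; ring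
  have h2 : 2 * Real.pi / ‖deriv Θ₀ (node 2 : ℂ)‖ = Real.pi / 2 := by
    simp [node, norm_deriv_Θ₀_neg_one]; ring
  rw [h0, h1, h2]
  rfl

/-! ### The Hilbert space of the screw function -/

section Completion

variable {E V : Type*} [SeminormedAddCommGroup E] [InnerProductSpace ℂ E]
  [NormedAddCommGroup V] [InnerProductSpace ℂ V]

/-- A linear isometry factors through the separation quotient. -/
def separationLift (T : E →ₗᵢ[ℂ] V) : SeparationQuotient E →ₗᵢ[ℂ] V where
  toLinearMap := (SeparationQuotient.liftCLM T.toContinuousLinearMap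
    fun _ _ h => (h.map T.continuous).eq : SeparationQuotient E →L[ℂ] V)
  norm_map' x := by
    obtain ⟨y, rfl⟩ := SeparationQuotient.surjective_mk x
    exact T.norm_map y

/-- An isometry onto a complete space makes the separation quotient complete. Its image in the
completion is then closed as well as dense, so completing adds nothing. -/
theorem exists_completion_equiv [CompleteSpace V] (T : E →ₗᵢ[ℂ] V)
    (hT : Function.Surjective T) :
    ∃ S : UniformSpace.Completion (SeparationQuotient E) ≃ₗᵢ[ℂ] V,
      ∀ x : E, S ((SeparationQuotient.mk x : SeparationQuotient E)) = T x := by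
  let S₁ : SeparationQuotient E ≃ₗᵢ[ℂ] V := LinearIsometryEquiv.ofSurjective (separationLift T)
    fun v => by
      obtain ⟨x, rfl⟩ := hT v
      exact ⟨SeparationQuotient.mk x, rfl⟩
  have : CompleteSpace (SeparationQuotient E) :=
    (S₁.toIsometryEquiv.completeSpace_iff).2 inferInstance
  have hs : Function.Surjective (UniformSpace.Completion.toComplₗᵢ : SeparationQuotient E →ₗᵢ[ℂ]
      UniformSpace.Completion (SeparationQuotient E)) := by
    have hc : IsClosed (Set.range ((↑) : SeparationQuotient E →
        UniformSpace.Completion (SeparationQuotient E))) :=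
      UniformSpace.Completion.coe_isometry.isClosedEmbedding.isClosed_range
    rw [← Set.range_eq_univ, UniformSpace.Completion.coe_toComplₗᵢ, ← hc.closure_eq]
    exact UniformSpace.Completion.denseRange_coe.closure_range
  let S₂ := LinearIsometryEquiv.ofSurjective
    (UniformSpace.Completion.toComplₗᵢ : SeparationQuotient E →ₗᵢ[ℂ] _) hs
  refine ⟨S₂.symm.trans S₁, fun x => ?_⟩
  have : S₂.symm ((SeparationQuotient.mk x : SeparationQuotient E)) = SeparationQuotient.mk x :=
    S₂.symm_apply_apply (SeparationQuotient.mk x)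
  change S₁ (S₂.symm _) = _
  rw [this]
  rfl

end Completion

/-! ### Test functions in coordinates. -/

theorem Φ₁_zero (φ : TestSpace g₀) : Φ₁ φ 0 = I * moment (fun t => t) φ := by
  rw [Φ₁, moment, ← integral_const_mul]
  refine integral_congr_ae (Eventually.of_forall fun t => ?_)
  simp only [screwExp, if_true]
  ring

theorem Φ₁_one (φ : TestSpace g₀) :
    Φ₁ φ 1 = moment (fun t => Real.cos t - 1) φ + I * moment Real.sin φ := by
  rw [Φ₁, moment, moment, ← integral_const_mul, ← integral_add
    (integrable_mul_test φ _ (by fun_prop))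
    ((integrable_mul_test φ _ Real.continuous_sin).const_mul _)]
  refine integral_congr_ae (Eventually.of_forall fun t => ?_)
  simp only [screwExp, one_ne_zero, if_false, mul_one, div_one, mul_comm I (t : ℂ),
    exp_mul_I]
  push_cast
  ring

theorem Φ₁_neg_one (φ : TestSpace g₀) :
    Φ₁ φ (-1) = -moment (fun t => Real.cos t - 1) φ + I * moment Real.sin φ := by
  have h1 : Integrable fun t => -(((Real.cos t - 1 : ℝ) : ℂ) * φ t) :=
    (integrable_mul_test φ (fun t => Real.cos t - 1) (by fun_prop)).neg
  rw [Φ₁, moment, moment, ← integral_const_mul, ← integral_neg, ← integral_add h1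
    ((integrable_mul_test φ _ Real.continuous_sin).const_mul _)]
  refine integral_congr_ae (Eventually.of_forall fun t => ?_)
  have : I * -1 * (t : ℂ) = (-t : ℂ) * I := by ring
  simp only [screwExp, neg_eq_zero, one_ne_zero, if_false, this, exp_mul_I, cos_neg, sin_neg]
  push_cast
  ring

/-- The coordinates of a test function. -/
def testCoord : TestSpace g₀ →ₗ[ℂ] EuclideanSpace ℂ (Fin 3) where
  toFun φ := WithLp.toLp 2 ![Φ₁ φ 0, Φ₁ φ 1 / Real.sqrt 2, Φ₁ φ (-1) / Real.sqrt 2]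
  map_add' φ ψ := by
    ext i
    fin_cases i <;> simp only [Φ₁_zero, Φ₁_one, Φ₁_neg_one,
      moment_add (fun t => t) continuous_id,
      moment_add (fun t => Real.cos t - 1) (by fun_prop),
      moment_add Real.sin Real.continuous_sin] <;> simp <;> ring
  map_smul' c φ := by
    ext i
    fin_cases i <;> simp only [Φ₁_zero, Φ₁_one, Φ₁_neg_one, moment_smul] <;> simp <;> ring

theorem testCoord_zero (φ : TestSpace g₀) : testCoord φ 0 = Φ₁ φ 0 := rfl

theorem testCoord_one (φ : TestSpace g₀) : testCoord φ 1 = Φ₁ φ 1 / Real.sqrt 2 := rfl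

theorem testCoord_two (φ : TestSpace g₀) : testCoord φ 2 = Φ₁ φ (-1) / Real.sqrt 2 := rfl

theorem sqrt_two_mul_self : (Real.sqrt 2 : ℂ) * Real.sqrt 2 = 2 := by
  norm_cast
  exact Real.mul_self_sqrt (by norm_num)

/-- With A and B the moments against cos t - 1 and sin t, Φ₁ takes the values ±A + iB at ±1. The
polarized parallelogram law turns half the sum of these two terms into the two trigonometric terms
of the form, and the node 0 supplies the term from ts. -/
theorem inner_testCoord (φ ψ : TestSpace g₀) :
    inner ℂ (testCoord φ) (testCoord ψ) = inner ℂ φ ψ := by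
  have h : inner ℂ φ ψ = screwForm g₀ ψ φ := rfl
  have hs : (Real.sqrt 2 : ℂ) ≠ 0 := by simp
  rw [h, screwForm_g₀]
  simp only [PiLp.inner_apply, RCLike.inner_apply, Fin.sum_univ_three, testCoord_zero,
    testCoord_one, testCoord_two, Φ₁_zero, Φ₁_one, Φ₁_neg_one, map_add, map_mul, map_div₀,
    map_neg, conj_ofReal, conj_I]
  field_simp
  simp only [pow_two, sqrt_two_mul_self]
  ring_nf
  simp only [I_sq]
  ring

/-- A localized fundamental lemma: with a tent χ supported in [-R, R] and m the χ-weighted mean of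
w, the function χ·conj(w - m) is an admissible test function, and it gives ∫ χ|w - m|² = 0. -/
theorem eq_const_of_integral_mul_eq_zero (w : ℝ → ℂ) (hw : Continuous w)
    (h : ∀ φ : TestSpace g₀, ∫ t, w t * φ t = 0) (R : ℝ) (hR : 0 < R) :
    ∃ m, ∀ t, |t| < R → w t = m := by
  let χ : ℝ → ℝ := fun t => max 0 (R - |t|)
  have hχ : Continuous χ := by fun_prop
  have hχc : HasCompactSupport χ := by
    refine HasCompactSupport.of_support_subset_isCompact (isCompact_Icc (a := -R) (b := R)) ?_
    intro t ht
    rw [Function.mem_support] at ht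
    by_contra hc
    apply ht
    have : R ≤ |t| := by
      by_contra! h'
      exact hc (abs_le.1 h'.le)
    exact max_eq_left (by linarith)
  have hχ0 : ∀ t, 0 ≤ χ t := fun t => le_max_left _ _
  have hχint : 0 < ∫ t, χ t := by
    refine hχ.integral_pos_of_hasCompactSupport_nonneg_nonzero hχc hχ0 (x := 0) ?_
    simp only [χ, abs_zero, sub_zero]
    rw [max_eq_right hR.le]
    exact hR.ne'
  have hint : ∀ f : ℝ → ℂ, Continuous f → Integrable fun t => (χ t : ℂ) * f t := fun f hf =>
    Continuous.integrable_of_hasCompactSupport ((continuous_ofReal.comp hχ).mul hf)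
      ((hχc.comp_left (g := ((↑) : ℝ → ℂ)) (by simp)).mul_right)
  -- This choice of m is exactly what gives the test function below integral zero.
  set m : ℂ := (∫ t, (χ t : ℂ) * w t) / ((∫ t, χ t : ℝ) : ℂ) with hm
  have hm0 : ∫ t, (χ t : ℂ) * (w t - m) = 0 := by
    have h1 : (fun t => (χ t : ℂ) * (w t - m)) = fun t => (χ t : ℂ) * w t - (χ t : ℂ) * m := by
      ext t; ring
    rw [h1, integral_sub (hint w hw) (hint _ continuous_const), integral_mul_const,
      integral_complex_ofReal, hm]
    have : ((∫ t, χ t : ℝ) : ℂ) ≠ 0 := ofReal_ne_zero.2 hχint.ne'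
    field_simp
    simp
  let φ : TestSpace g₀ := TestSpace.toSubmodule.symm
    ⟨fun t => (χ t : ℂ) * conj (w t - m), by fun_prop,
      (hχc.comp_left (g := ((↑) : ℝ → ℂ)) (by simp)).mul_right, by
      have : ∀ t, (χ t : ℂ) * conj (w t - m) = conj ((χ t : ℂ) * (w t - m)) := by
        intro t; simp
      simp only [this, integral_conj, hm0, map_zero]⟩
  have hφ : ∀ t, φ t = (χ t : ℂ) * conj (w t - m) := fun t => rfl
  have h1 : ∫ t, χ t * normSq (w t - m) = 0 := by
    have h2 : ∫ t, (w t - m) * φ t = 0 := by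
      have h3 : ∫ t, m * φ t = 0 := by
        rw [integral_const_mul, (TestSpace.toSubmodule φ).2.2.2, mul_zero]
      simp only [sub_mul]
      rw [integral_sub _ _, h φ, h3, sub_zero]
      · simp only [hφ, mul_left_comm (w _)]
        exact hint _ (by fun_prop)
      · simp only [hφ, mul_left_comm m]
        exact hint _ (by fun_prop)
    have h4 : ∀ t, (w t - m) * φ t = ((χ t * normSq (w t - m) : ℝ) : ℂ) := by
      intro t
      rw [hφ, mul_left_comm, mul_conj]
      push_cast
      rfl
    simp only [h4] at h2
    rw [integral_complex_ofReal] at h2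
    exact_mod_cast h2
  refine ⟨m, fun t ht => ?_⟩
  by_contra hne
  have hc : Continuous fun t => χ t * normSq (w t - m) :=
    hχ.mul (continuous_normSq.comp (by fun_prop))
  have := hc.integral_pos_of_hasCompactSupport_nonneg_nonzero (μ := volume) hχc.mul_right
    (fun t => mul_nonneg (hχ0 t) (normSq_nonneg _)) (x := t) ?_
  · exact this.ne' h1
  · refine mul_ne_zero ?_ ?_
    · have : 0 < R - |t| := by linarith
      simp only [χ]
      rw [max_eq_right this.le]
      exact this.ne'
    · rw [Ne, normSq_eq_zero, sub_eq_zero]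
      exact hne

/-- A vector orthogonal to the range yields a combination w of t, cos t - 1, sin t that annihilates
all test functions of integral zero. Such a w is locally constant, and its coefficients can be read
off from a few values. -/
theorem testCoord_surjective : Function.Surjective testCoord := by
  rw [← LinearMap.range_eq_top, ← Submodule.orthogonal_eq_bot_iff, Submodule.eq_bot_iff]
  intro v hv
  set a : ℂ := I * conj (v 0) with ha
  set b : ℂ := (conj (v 1) - conj (v 2)) / Real.sqrt 2 with hb
  set c : ℂ := I * (conj (v 1) + conj (v 2)) / Real.sqrt 2 with hc
  let w : ℝ → ℂ := fun t => a * (t : ℂ) + b * ((Real.cos t - 1 : ℝ) : ℂ) + c * (Real.sin t : ℂ)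
  have hw : Continuous w := by fun_prop
  have key : ∀ φ : TestSpace g₀, ∫ t, w t * φ t = 0 := by
    intro φ
    have h1 := (integrable_mul_test φ (fun t => t) continuous_id).const_mul a
    have h2 := (integrable_mul_test φ (fun t => Real.cos t - 1) (by fun_prop)).const_mul b
    have h3 := (integrable_mul_test φ Real.sin Real.continuous_sin).const_mul c
    have e : ∫ t, w t * φ t = a * moment (fun t => t) φ
        + b * moment (fun t => Real.cos t - 1) φ + c * moment Real.sin φ := by
      simp only [moment]
      rw [← integral_const_mul, ← integral_const_mul, ← integral_const_mul,
        ← integral_add h1 h2]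
      refine Eq.trans ?_ (integral_add (h1.add h2) h3)
      refine integral_congr_ae (Eventually.of_forall fun t => ?_)
      simp only [w]
      ring
    have h0 : inner ℂ v (testCoord φ) = 0 :=
      Submodule.inner_left_of_mem_orthogonal (LinearMap.mem_range_self testCoord φ) hv
    simp only [PiLp.inner_apply, RCLike.inner_apply, Fin.sum_univ_three, testCoord_zero,
      testCoord_one, testCoord_two, Φ₁_zero, Φ₁_one, Φ₁_neg_one] at h0
    rw [e, ← h0, ha, hb, hc]
    ring
  -- Any radius larger than π would do: w is evaluated only at 0, ±π and π/2.
  obtain ⟨m, hm⟩ := eq_const_of_integral_mul_eq_zero w hw key 10 (by norm_num)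
  have hpi := Real.pi_pos
  have hpi4 := Real.pi_le_four
  have m0 : m = 0 := by
    rw [← hm 0 (by norm_num)]
    simp [w]
  have e1 := hm Real.pi (by rw [abs_lt]; constructor <;> linarith)
  have e2 := hm (-Real.pi) (by rw [abs_lt]; constructor <;> linarith)
  have e3 := hm (Real.pi / 2) (by rw [abs_lt]; constructor <;> linarith)
  have hpi' : (Real.pi : ℂ) ≠ 0 := ofReal_ne_zero.2 hpi.ne'
  simp only [w, m0, Real.cos_neg, Real.sin_neg, Real.cos_pi, Real.sin_pi, Real.cos_pi_div_two,
    Real.sin_pi_div_two] at e1 e2 e3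
  push_cast at e1 e2 e3
  have hb0 : b = 0 := by linear_combination (-1 / 4) * (e1 + e2)
  have ha0 : a = 0 := by
    have : a * Real.pi = 0 := by linear_combination (1 / 2) * (e1 - e2)
    exact (mul_eq_zero.1 this).resolve_right hpi'
  have hc0 : c = 0 := by linear_combination e3 - Real.pi / 2 * ha0 + hb0
  have hs : (Real.sqrt 2 : ℂ) ≠ 0 := by simp
  have v0 : v 0 = 0 := by simpa [ha] using ha0
  have k1 : conj (v 1) - conj (v 2) = 0 := by simpa [hb] using hb0
  have k2 : conj (v 1) + conj (v 2) = 0 := by simpa [hc] using hc0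
  have v1 : v 1 = 0 := by
    rw [← map_eq_zero (starRingEnd ℂ)]
    linear_combination (1 / 2) * (k1 + k2)
  have v2 : v 2 = 0 := by
    rw [← map_eq_zero (starRingEnd ℂ)]
    linear_combination (1 / 2) * (k2 - k1)
  ext i
  fin_cases i
  · exact v0
  · exact v1
  · exact v2

theorem exists_screwEquiv : ∃ S : ScrewHilbert ≃ₗᵢ[ℂ] EuclideanSpace ℂ (Fin 3),
    ∀ φ : TestSpace g₀, S (screwClass φ) = testCoord φ :=
  exists_completion_equiv (testCoord.isometryOfInner inner_testCoord) testCoord_surjective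

/-- The coordinates of the elements of `𝓗(G_{g₀})`. -/
def screwEquiv : ScrewHilbert ≃ₗᵢ[ℂ] EuclideanSpace ℂ (Fin 3) := exists_screwEquiv.choose

theorem screwEquiv_screwClass (φ : TestSpace g₀) : screwEquiv (screwClass φ) = testCoord φ :=
  exists_screwEquiv.choose_spec φ

/-! ### The space `L̂²(H₀)` -/

/-- The component of a vector function that `H₀` sees. -/
def active (F : ℝ → Fin 2 → ℂ) (t : ℝ) : ℂ := if t < 1 / 2 ∨ 9 / 2 ≤ t then F t 1 else F t 0

theorem hForm_H₀ (F G : ℝ → Fin 2 → ℂ) (t : ℝ) :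
    hForm H₀ F G t = conj (active F t) * active G t := by
  simp only [hForm, active, H₀, H₀fun, Fin.sum_univ_two]
  split_ifs <;> simp

theorem row_H₀_mulVec (w F : ℝ → Fin 2 → ℂ) (t : ℝ) :
    dotProduct (w t) (Matrix.mulVec ((H₀.toFun t).map ofReal) (F t))
      = active w t * active F t := by
  simp only [active, H₀, H₀fun, dotProduct, Matrix.mulVec, Fin.sum_univ_two]
  split_ifs <;> simp

/-- So an outer piece forces cos θ = 0 and the middle piece forces sin θ = 0. Both cannot hold,
hence no indivisible interval meets two pieces of different kind. -/
theorem vecMul_J_mul_H₀fun (c s t : ℝ) :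
    Matrix.vecMul ![c, s] (!![0, -1; 1, 0] * H₀fun t)
      = if t < 1 / 2 ∨ 9 / 2 ≤ t then ![0, -c] else ![s, 0] := by
  simp only [H₀fun]
  split_ifs <;> ext i <;> fin_cases i <;>
    simp [Matrix.vecMul, dotProduct, Fin.sum_univ_two]

/-- The breakpoints are null, so almost everywhere agreement on the open pieces suffices, even when
f jumps. -/
theorem integral_three_pieces {f f₁ f₂ f₃ : ℝ → ℂ} (c₁ : Continuous f₁) (c₂ : Continuous f₂)
    (c₃ : Continuous f₃)
    (h₁ : ∀ᵐ t ∂(volume.restrict (Set.Ioo (0 : ℝ) (1 / 2))), f t = f₁ t)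
    (h₂ : ∀ᵐ t ∂(volume.restrict (Set.Ioo (1 / 2 : ℝ) (9 / 2))), f t = f₂ t)
    (h₃ : ∀ᵐ t ∂(volume.restrict (Set.Ioo (9 / 2 : ℝ) 5)), f t = f₃ t) :
    IntegrableOn f (Set.Ico 0 5) ∧ ∫ t in Set.Ico (0 : ℝ) 5, f t =
      (∫ t in (0 : ℝ)..1 / 2, f₁ t) + (∫ t in (1 / 2 : ℝ)..9 / 2, f₂ t)
        + ∫ t in (9 / 2 : ℝ)..5, f₃ t := by
  have piece : ∀ (a b : ℝ) (g : ℝ → ℂ), a ≤ b → Continuous g →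
      (∀ᵐ t ∂(volume.restrict (Set.Ioo a b)), f t = g t) →
      IntervalIntegrable f volume a b ∧ ∫ t in a..b, f t = ∫ t in a..b, g t := by
    intro a b g hab hg h
    rw [Measure.restrict_congr_set Ioo_ae_eq_Ioc] at h
    constructor
    · rw [intervalIntegrable_iff_integrableOn_Ioc_of_le hab]
      exact (hg.integrableOn_Ioc).congr_fun_ae (h.mono fun t ht => ht.symm)
    · rw [intervalIntegral.integral_of_le hab, intervalIntegral.integral_of_le hab]
      exact integral_congr_ae h
  obtain ⟨i₁, e₁⟩ := piece _ _ _ (by norm_num) c₁ h₁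
  obtain ⟨i₂, e₂⟩ := piece _ _ _ (by norm_num) c₂ h₂
  obtain ⟨i₃, e₃⟩ := piece _ _ _ (by norm_num) c₃ h₃
  rw [integrableOn_Ico_iff_integrableOn_Ioo, ← integrableOn_Ioc_iff_integrableOn_Ioo,
    ← intervalIntegrable_iff_integrableOn_Ioc_of_le (by norm_num), integral_Ico_eq_integral_Ioc,
    ← intervalIntegral.integral_of_le (by norm_num), ← e₁, ← e₂, ← e₃,
    intervalIntegral.integral_add_adjacent_intervals i₁ i₂,
    intervalIntegral.integral_add_adjacent_intervals (i₁.trans i₂) i₃]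
  exact ⟨(i₁.trans i₂).trans i₃, rfl⟩

/-! ### Step functions in L²(H₀). -/

/-- The part of `F` that `H₀` sees is the step function with values `c`. -/
def IsStep (F : ℝ → Fin 2 → ℂ) (c : Fin 3 → ℂ) : Prop :=
  (∀ᵐ t ∂(volume.restrict (Set.Ioo (0 : ℝ) (1 / 2))), F t 1 = c 0) ∧
  (∀ᵐ t ∂(volume.restrict (Set.Ioo (1 / 2 : ℝ) (9 / 2))), F t 0 = c 1) ∧
  ∀ᵐ t ∂(volume.restrict (Set.Ioo (9 / 2 : ℝ) 5)), F t 1 = c 2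

theorem ae_Ioo_left : ∀ᵐ t ∂(volume.restrict (Set.Ioo (0 : ℝ) (1 / 2))),
    t < 1 / 2 := by
  filter_upwards [ae_restrict_mem measurableSet_Ioo] with t ht using ht.2

theorem ae_Ioo_mid : ∀ᵐ t ∂(volume.restrict (Set.Ioo (1 / 2 : ℝ) (9 / 2))),
    1 / 2 ≤ t ∧ t < 9 / 2 := by
  filter_upwards [ae_restrict_mem measurableSet_Ioo] with t ht using ⟨ht.1.le, ht.2⟩

theorem ae_Ioo_right : ∀ᵐ t ∂(volume.restrict (Set.Ioo (9 / 2 : ℝ) 5)),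
    9 / 2 ≤ t := by
  filter_upwards [ae_restrict_mem measurableSet_Ioo] with t ht using ht.1.le

theorem isStep_iff_active {F : ℝ → Fin 2 → ℂ} {c : Fin 3 → ℂ} : IsStep F c ↔
    (∀ᵐ t ∂(volume.restrict (Set.Ioo (0 : ℝ) (1 / 2))), active F t = c 0) ∧
    (∀ᵐ t ∂(volume.restrict (Set.Ioo (1 / 2 : ℝ) (9 / 2))), active F t = c 1) ∧
    ∀ᵐ t ∂(volume.restrict (Set.Ioo (9 / 2 : ℝ) 5)), active F t = c 2 := by
  unfold IsStep
  refine and_congr (eventually_congr ?_) (and_congr (eventually_congr ?_) (eventually_congr ?_))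
  · filter_upwards [ae_Ioo_left] with t ht
    rw [active, if_pos (Or.inl ht)]
  · filter_upwards [ae_Ioo_mid] with t ht
    rw [active, if_neg (by push Not; exact ht)]
  · filter_upwards [ae_Ioo_right] with t ht
    rw [active, if_pos (Or.inr ht)]

theorem IsStep.sub {F G : ℝ → Fin 2 → ℂ} {c d : Fin 3 → ℂ} (hF : IsStep F c) (hG : IsStep G d) :
    IsStep (F - G) (c - d) := by
  refine ⟨?_, ?_, ?_⟩
  · filter_upwards [hF.1, hG.1] with t h h'
    simp [h, h']
  · filter_upwards [hF.2.1, hG.2.1] with t h h'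
    simp [h, h']
  · filter_upwards [hF.2.2, hG.2.2] with t h h'
    simp [h, h']

/-- The weights are the lengths 1/2, 4, 1/2 of the pieces. -/
theorem IsStep.hForm {F G : ℝ → Fin 2 → ℂ} {c d : Fin 3 → ℂ} (hF : IsStep F c)
    (hG : IsStep G d) : IntegrableOn (hForm H₀ F G) (Set.Ico 0 5) ∧
      ∫ t in Set.Ico (0 : ℝ) 5, hForm H₀ F G t
        = conj (c 0) * d 0 / 2 + 4 * (conj (c 1) * d 1) + conj (c 2) * d 2 / 2 := by
  rw [isStep_iff_active] at hF hG
  have h := integral_three_pieces (f := ScrewLine.hForm H₀ F G)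
    (continuous_const (y := conj (c 0) * d 0))
    (continuous_const (y := conj (c 1) * d 1)) (continuous_const (y := conj (c 2) * d 2))
    (by filter_upwards [hF.1, hG.1] with t h h'; rw [hForm_H₀, h, h'])
    (by filter_upwards [hF.2.1, hG.2.1] with t h h'; rw [hForm_H₀, h, h'])
    (by filter_upwards [hF.2.2, hG.2.2] with t h h'; rw [hForm_H₀, h, h'])
  refine ⟨h.1, h.2.trans ?_⟩
  simp only [intervalIntegral.integral_const, real_smul]
  push_cast
  ring

/-- The component of [C D] selected by `H₀` is 1, -z/2 and 1 - 2z² on the successive pieces,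
independent of t. The other component does vary, but `H₀` kills it. -/
theorem IsStep.weyl {F : ℝ → Fin 2 → ℂ} {c : Fin 3 → ℂ} (hF : IsStep F c) (z : ℂ) :
    weyl F z = (1 / Real.pi : ℂ) * (c 0 / 2 - 2 * z * c 1 + (1 - 2 * z ^ 2) * c 2 / 2) := by
  rw [isStep_iff_active] at hF
  have h := integral_three_pieces (f := fun t =>
      dotProduct (row₀ t z) (Matrix.mulVec ((H₀.toFun t).map ofReal) (F t)))
    (continuous_const (y := c 0))
    (continuous_const (y := (-z / 2) * c 1)) (continuous_const (y := (1 - 2 * z ^ 2) * c 2))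
    (by
      filter_upwards [hF.1, ae_Ioo_left] with t h h'
      rw [row_H₀_mulVec (fun t => row₀ t z), h, active, if_pos (Or.inl h')]
      simp only [row₀, D₀, Matrix.cons_val_one, Matrix.cons_val_fin_one, if_pos h', one_mul])
    (by
      filter_upwards [hF.2.1, ae_Ioo_mid] with t h h'
      rw [row_H₀_mulVec (fun t => row₀ t z), h, active, if_neg (by push Not; exact h')]
      simp only [row₀, C₀, Matrix.cons_val_zero, if_neg h'.1.not_gt, if_pos h'.2])
    (by
      filter_upwards [hF.2.2, ae_Ioo_right] with t h h'
      rw [row_H₀_mulVec (fun t => row₀ t z), h, active, if_pos (Or.inr h')]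
      have h'' : ¬ t < 1 / 2 := by linarith
      simp only [row₀, D₀, Matrix.cons_val_one, Matrix.cons_val_fin_one, if_neg h'',
        if_neg h'.not_gt])
  rw [ScrewLine.weyl, h.2]
  simp only [intervalIntegral.integral_const, real_smul]
  push_cast
  ring

theorem IsStep.mem_preL2 {F : ℝ → Fin 2 → ℂ} {c : Fin 3 → ℂ} (hF : IsStep F c)
    (hm : AEStronglyMeasurable F (volume.restrict (Set.Ico 0 5))) : F ∈ preL2 H₀ :=
  ⟨hm, (hF.hForm hF).1⟩

/-- The integrand of the squared norm is |`active F`|², so null vectors are those whose visible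
component vanishes almost everywhere. -/
theorem PreL2.norm_eq_zero_iff_isStep (F : PreL2 H₀) : ‖F‖ = 0 ↔ IsStep F 0 := by
  have hin : inner ℂ F F = (1 / Real.pi : ℂ) * ∫ t in Set.Ico (0 : ℝ) 5, hForm H₀ F F t := rfl
  have hpi : (1 / Real.pi : ℂ) ≠ 0 := by simp [Real.pi_ne_zero]
  have h1 : ‖F‖ = 0 ↔ inner ℂ F F = 0 := by
    rw [inner_self_eq_norm_sq_to_K]
    simp
  rw [h1, hin, mul_eq_zero, or_iff_right hpi]
  constructor
  · intro h
    have e : ∀ t, hForm H₀ F F t = ((normSq (active F t) : ℝ) : ℂ) := fun t => by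
      rw [hForm_H₀, mul_comm, mul_conj]
    have hi : Integrable (fun t => normSq (active F t)) (volume.restrict (Set.Ico 0 5)) := by
      have := F.toSubmodule.2.2.re
      refine this.congr (Eventually.of_forall fun t => ?_)
      simp [e]
    simp only [e] at h
    rw [integral_complex_ofReal, ofReal_eq_zero,
      integral_eq_zero_iff_of_nonneg (fun t => normSq_nonneg _) hi] at h
    have h' : ∀ᵐ t ∂(volume.restrict (Set.Ico (0 : ℝ) 5)), active F t = 0 := by
      filter_upwards [h] with t ht
      simpa using ht
    rw [isStep_iff_active]
    refine ⟨ae_restrict_of_ae_restrict_of_subset ?_ h',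
      ae_restrict_of_ae_restrict_of_subset ?_ h', ae_restrict_of_ae_restrict_of_subset ?_ h'⟩
    · exact fun t ht => ⟨ht.1.le, ht.2.trans (by norm_num)⟩
    · exact fun t ht => ⟨le_trans (by norm_num) ht.1.le, ht.2.trans (by norm_num)⟩
    · exact fun t ht => ⟨le_trans (by norm_num) ht.1.le, ht.2⟩
  · intro h
    rw [(h.hForm h).2]
    simp

theorem L2H_mk_eq_iff (F G : PreL2 H₀) :
    (SeparationQuotient.mk F : L2H H₀) = SeparationQuotient.mk G ↔ IsStep (F - G) 0 := by
  rw [SeparationQuotient.mk_eq_mk, Metric.inseparable_iff, dist_eq_norm,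
    PreL2.norm_eq_zero_iff_isStep]
  rfl

theorem exists_mem_Ioo_of_ae {a b x y : ℝ} {p : ℝ → Prop}
    (h : ∀ᵐ t ∂(volume.restrict (Set.Ioo a b)), p t) (hax : a ≤ x) (hyb : y ≤ b) (hxy : x < y) :
    ∃ t ∈ Set.Ioo x y, p t := by
  have h' := ae_restrict_of_ae_restrict_of_subset (Set.Ioo_subset_Ioo hax hyb) h
  have : (ae (volume.restrict (Set.Ioo x y))).NeBot := by
    rw [ae_restrict_neBot]
    simpa using hxy
  obtain ⟨t, ht, hp⟩ := ((ae_restrict_mem measurableSet_Ioo).and h').exists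
  exact ⟨t, ht, hp⟩

/-- Whatever the type, the interval is confined to one piece, and there the combination with cos θ
and sin θ is a multiple of the component on which F is constant. The type need not be normalized: θ
may be any solution of cos θ = 0 or of sin θ = 0. -/
theorem IsStep.const_of_isIndivisible {F : ℝ → Fin 2 → ℂ} {c : Fin 3 → ℂ} (hF : IsStep F c)
    {θ a b : ℝ} (h : IsIndivisible H₀ θ a b) :
    ∃ k : ℂ, ∀ᵐ t ∂(volume.restrict (Set.Ioo a b)),
      (Real.cos θ : ℂ) * F t 0 + (Real.sin θ : ℂ) * F t 1 = k := by
  obtain ⟨h0, hab, hb, hv⟩ := h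
  have hv' : ∀ᵐ t ∂(volume.restrict (Set.Ioo a b)),
      (t < 1 / 2 ∨ 9 / 2 ≤ t → Real.cos θ = 0) ∧
        (¬(t < 1 / 2 ∨ 9 / 2 ≤ t) → Real.sin θ = 0) := by
    filter_upwards [hv] with t ht
    have ht' : Matrix.vecMul ![Real.cos θ, Real.sin θ] (!![0, -1; 1, 0] * H₀fun t) = 0 := ht
    rw [vecMul_J_mul_H₀fun] at ht'
    constructor
    · intro hc
      rw [if_pos hc] at ht'
      simpa using congrFun ht' 1
    · intro hc
      rw [if_neg hc] at ht'
      simpa using congrFun ht' 0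
  have hcs := Real.sin_sq_add_cos_sq θ
  by_cases hc : Real.cos θ = 0
  · have hs : Real.sin θ ≠ 0 := by
      intro hs
      rw [hc, hs] at hcs
      norm_num at hcs
    -- Otherwise the interval meets the middle piece in a set of positive measure, which would force
    -- sin θ = 0.
    have hcase : b ≤ 1 / 2 ∨ 9 / 2 ≤ a := by
      by_contra! hcon
      obtain ⟨t, ht, hp⟩ := exists_mem_Ioo_of_ae (x := max a (1 / 2)) (y := min b (9 / 2)) hv'
        (le_max_left _ _) (min_le_left _ _)
        (max_lt (lt_min hab hcon.2) (lt_min hcon.1 (by norm_num)))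
      refine hs (hp.2 ?_)
      push Not
      exact ⟨(le_max_right _ _).trans ht.1.le, ht.2.trans_le (min_le_right _ _)⟩
    rcases hcase with hcase | hcase
    · refine ⟨Real.sin θ * c 0, ?_⟩
      filter_upwards [ae_restrict_of_ae_restrict_of_subset (Set.Ioo_subset_Ioo h0 hcase) hF.1]
        with t ht
      rw [ht, hc]
      simp
    · refine ⟨Real.sin θ * c 2, ?_⟩
      filter_upwards [ae_restrict_of_ae_restrict_of_subset (Set.Ioo_subset_Ioo hcase hb) hF.2.2]
        with t ht
      rw [ht, hc]
      simp
  · have ha : 1 / 2 ≤ a := by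
      by_contra! hcon
      obtain ⟨t, ht, hp⟩ := exists_mem_Ioo_of_ae (x := a) (y := min b (1 / 2)) hv'
        le_rfl (min_le_left _ _) (lt_min hab hcon)
      exact hc (hp.1 (Or.inl (ht.2.trans_le (min_le_right _ _))))
    have hb' : b ≤ 9 / 2 := by
      by_contra! hcon
      obtain ⟨t, ht, hp⟩ := exists_mem_Ioo_of_ae (x := max a (9 / 2)) (y := b) hv'
        (le_max_left _ _) le_rfl (max_lt hab hcon)
      exact hc (hp.1 (Or.inr ((le_max_right _ _).trans ht.1.le)))
    have hs : Real.sin θ = 0 := by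
      obtain ⟨t, ht, hp⟩ := exists_mem_Ioo_of_ae hv' le_rfl le_rfl hab
      refine hp.2 ?_
      push Not
      exact ⟨ha.trans ht.1.le, ht.2.trans_le hb'⟩
    refine ⟨Real.cos θ * c 1, ?_⟩
    filter_upwards [ae_restrict_of_ae_restrict_of_subset (Set.Ioo_subset_Ioo ha hb') hF.2.1]
      with t ht
    rw [ht, hs]
    simp

theorem IsStep.mk_mem_L2Hhat {F : PreL2 H₀} {c : Fin 3 → ℂ} (hF : IsStep F c) :
    (SeparationQuotient.mk F : L2H H₀) ∈ L2Hhat H₀ :=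
  ⟨F, ⟨F, rfl, rfl⟩, fun _ _ _ h => hF.const_of_isIndivisible h⟩

/-- It suffices to test the three maximal indivisible intervals, with types π/2, 0, π/2. -/
theorem exists_isStep_of_mem_L2Hhat {ξ : L2H H₀} (hξ : ξ ∈ L2Hhat H₀) :
    ∃ (F : PreL2 H₀) (c : Fin 3 → ℂ), IsStep F c ∧ ξ = SeparationQuotient.mk F := by
  obtain ⟨_, ⟨F, rfl, rfl⟩, h⟩ := hξ
  have key : ∀ θ t : ℝ, Matrix.vecMul ![Real.cos θ, Real.sin θ] (!![0, -1; 1, 0] * H₀.toFun t)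
      = if t < 1 / 2 ∨ 9 / 2 ≤ t then ![0, -Real.cos θ] else ![Real.sin θ, 0] :=
    fun θ t => vecMul_J_mul_H₀fun _ _ _
  obtain ⟨c₁, h₁⟩ := h (Real.pi / 2) 0 (1 / 2) ⟨le_rfl, by norm_num, by norm_num, by
    filter_upwards [ae_Ioo_left] with t ht
    rw [key, if_pos (Or.inl ht)]
    simp⟩
  obtain ⟨c₂, h₂⟩ := h 0 (1 / 2) (9 / 2) ⟨by norm_num, by norm_num, by norm_num, by
    filter_upwards [ae_Ioo_mid] with t ht
    rw [key, if_neg (by push Not; exact ht)]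
    simp⟩
  obtain ⟨c₃, h₃⟩ := h (Real.pi / 2) (9 / 2) 5 ⟨by norm_num, by norm_num, le_rfl, by
    filter_upwards [ae_Ioo_right] with t ht
    rw [key, if_pos (Or.inr ht)]
    simp⟩
  refine ⟨F, ![c₁, c₂, c₃], ⟨?_, ?_, ?_⟩, rfl⟩
  · filter_upwards [h₁] with t ht
    simpa using ht
  · filter_upwards [h₂] with t ht
    simpa using ht
  · filter_upwards [h₃] with t ht
    simpa using ht

/-- The step function with values `c`. -/
def stepFun (c : Fin 3 → ℂ) (t : ℝ) : Fin 2 → ℂ :=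
  if t < 1 / 2 then ![0, c 0] else if t < 9 / 2 then ![c 1, 0] else ![0, c 2]

theorem isStep_stepFun (c : Fin 3 → ℂ) : IsStep (stepFun c) c := by
  refine ⟨?_, ?_, ?_⟩
  · filter_upwards [ae_Ioo_left] with t ht
    simp only [stepFun, if_pos ht]
    rfl
  · filter_upwards [ae_Ioo_mid] with t ht
    simp only [stepFun, if_neg ht.1.not_gt, if_pos ht.2]
    rfl
  · filter_upwards [ae_Ioo_right] with t ht
    have h' : ¬ t < 1 / 2 := by linarith
    simp only [stepFun, if_neg h', if_neg ht.not_gt]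
    rfl

theorem measurable_stepFun (c : Fin 3 → ℂ) : Measurable (stepFun c) :=
  Measurable.ite measurableSet_Iio measurable_const
    (Measurable.ite measurableSet_Iio measurable_const measurable_const)

/-- The values of the step function with coordinates `v`. -/
def stepCoord (v : EuclideanSpace ℂ (Fin 3)) : Fin 3 → ℂ :=
  -- These are the visible components of √π(-v₀ row(0) + (v₁/√2) row(1) + (v₂/√2) row(-1)), where
  -- row(z) is [C(t,z) D(t,z)].
  ![Real.sqrt Real.pi * (-v 0 + Real.sqrt 2 * (v 1 + v 2) / 2),
    Real.sqrt Real.pi * (Real.sqrt 2 * (v 2 - v 1) / 4),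
    Real.sqrt Real.pi * (-v 0 - Real.sqrt 2 * (v 1 + v 2) / 2)]

/-- The element of `PreL2 H₀` with coordinates `v`. -/
def stepPre : EuclideanSpace ℂ (Fin 3) →ₗ[ℂ] PreL2 H₀ where
  toFun v := PreL2.toSubmodule.symm ⟨stepFun (stepCoord v),
    (isStep_stepFun _).mem_preL2 (measurable_stepFun _).aestronglyMeasurable⟩
  map_add' v w := by
    refine PreL2.toSubmodule.injective (Subtype.ext ?_)
    funext t i
    change stepFun _ t i = stepFun _ t i + stepFun _ t i
    simp only [stepFun]
    split_ifs <;> fin_cases i <;> simp [stepCoord] <;> ring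
  map_smul' k v := by
    refine PreL2.toSubmodule.injective (Subtype.ext ?_)
    funext t i
    change stepFun _ t i = k * stepFun _ t i
    simp only [stepFun]
    split_ifs <;> fin_cases i <;> simp [stepCoord] <;> ring

theorem isStep_stepPre (v : EuclideanSpace ℂ (Fin 3)) : IsStep (stepPre v) (stepCoord v) :=
  isStep_stepFun _

theorem sqrt_pi_mul_self : (Real.sqrt Real.pi : ℂ) * Real.sqrt Real.pi = Real.pi := by
  norm_cast
  exact Real.mul_self_sqrt Real.pi_pos.le

theorem inner_stepPre (v w : EuclideanSpace ℂ (Fin 3)) :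
    inner ℂ (stepPre v) (stepPre w) = inner ℂ v w := by
  have h : inner ℂ (stepPre v) (stepPre w)
      = (1 / Real.pi : ℂ) * ∫ t in Set.Ico (0 : ℝ) 5, hForm H₀ (stepPre v) (stepPre w) t := rfl
  have hpi : (Real.pi : ℂ) ≠ 0 := ofReal_ne_zero.2 Real.pi_ne_zero
  rw [h, ((isStep_stepPre v).hForm (isStep_stepPre w)).2]
  simp only [stepCoord, Matrix.cons_val_zero, Matrix.cons_val_one, Matrix.cons_val, map_mul,
    map_add, map_neg, map_sub, map_div₀, conj_ofReal, map_ofNat, PiLp.inner_apply,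
    RCLike.inner_apply, Fin.sum_univ_three]
  have e2 := sqrt_two_mul_self
  have ep := sqrt_pi_mul_self
  set p : ℂ := (Real.sqrt Real.pi : ℂ)
  set r : ℂ := (Real.sqrt 2 : ℂ)
  rw [← ep] at hpi ⊢
  have hp : p ≠ 0 := left_ne_zero_of_mul hpi
  field_simp
  linear_combination 16 * (conj (v 1) * w 1 + conj (v 2) * w 2) * e2

/-- Coordinates identify `ℂ³` with `L̂²(H₀)`. -/
def stepMap : EuclideanSpace ℂ (Fin 3) →ₗ[ℂ] L2Hhat H₀ where
  toFun v := ⟨SeparationQuotient.mk (stepPre v), (isStep_stepPre v).mk_mem_L2Hhat⟩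
  map_add' v w := by
    refine Subtype.ext ?_
    simp only [map_add]
    rfl
  map_smul' k v := by
    refine Subtype.ext ?_
    simp only [map_smul]
    rfl

theorem inner_stepMap (v w : EuclideanSpace ℂ (Fin 3)) :
    inner ℂ (stepMap v) (stepMap w) = inner ℂ v w :=
  inner_stepPre v w

theorem stepMap_surjective : Function.Surjective stepMap := by
  rintro ⟨ξ, hξ⟩
  obtain ⟨F, c, hF, rfl⟩ := exists_isStep_of_mem_L2Hhat hξ
  have hpi : (Real.sqrt Real.pi : ℂ) ≠ 0 := by
    simpa using (Real.sqrt_pos.2 Real.pi_pos).ne'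
  have hs : (Real.sqrt 2 : ℂ) ≠ 0 := by simp
  -- The system is solved through c₀ + c₂ = -2√π v₀, c₀ - c₂ = √(2π)(v₁ + v₂) and 4c₁ = √(2π)(v₂ -
  -- v₁).
  let v : EuclideanSpace ℂ (Fin 3) := WithLp.toLp 2
    ![-(c 0 + c 2) / (2 * Real.sqrt Real.pi),
      ((c 0 - c 2) / 2 - 2 * c 1) / (Real.sqrt Real.pi * Real.sqrt 2),
      ((c 0 - c 2) / 2 + 2 * c 1) / (Real.sqrt Real.pi * Real.sqrt 2)]
  have hv : stepCoord v = c := by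
    ext i
    fin_cases i <;> simp [stepCoord, v] <;> field_simp <;> ring
  refine ⟨v, Subtype.ext ?_⟩
  change SeparationQuotient.mk (stepPre v) = SeparationQuotient.mk F
  rw [L2H_mk_eq_iff]
  have := (isStep_stepPre v).sub hF
  rwa [hv, sub_self] at this

/-- Coordinates identify `ℂ³` with `L̂²(H₀)`. -/
def stepEquiv : EuclideanSpace ℂ (Fin 3) ≃ₗᵢ[ℂ] L2Hhat H₀ :=
  LinearIsometryEquiv.ofSurjective (stepMap.isometryOfInner inner_stepMap) stepMap_surjective

/-- Representatives of a class may differ freely in the component that `H₀` ignores. This lets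
`L₀fun φ`, which is not a step function in both components, represent one. -/
theorem represents_stepEquiv_iff (v : EuclideanSpace ℂ (Fin 3)) (F : ℝ → Fin 2 → ℂ) :
    Represents (stepEquiv v : L2H H₀) F ↔
      AEStronglyMeasurable F (volume.restrict (Set.Ico 0 5)) ∧ IsStep F (stepCoord v) := by
  have he : (stepEquiv v : L2H H₀) = SeparationQuotient.mk (stepPre v) := rfl
  constructor
  · rintro ⟨F, rfl, hF⟩
    refine ⟨F.toSubmodule.2.1, ?_⟩
    rw [he, L2H_mk_eq_iff] at hF
    have := (isStep_stepPre v).sub hF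
    simpa using this
  · rintro ⟨hm, hF⟩
    refine ⟨PreL2.toSubmodule.symm ⟨F, hF.mem_preL2 hm⟩, rfl, ?_⟩
    rw [he, L2H_mk_eq_iff]
    have := (isStep_stepPre v).sub hF
    rwa [sub_self] at this

/-! ### The map `𝖫₀` -/

theorem integrable_mul_screwExp (φ : TestSpace g₀) (z : ℂ) :
    Integrable fun s => φ s * screwExp z s := by
  refine Continuous.integrable_of_hasCompactSupport ?_
    (TestSpace.toSubmodule φ).2.2.1.mul_right
  refine (TestSpace.toSubmodule φ).2.1.mul ?_
  unfold screwExp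
  split_ifs <;> fun_prop

/-- The last sign changes because the quotient in Φ₁ at the node -1 is -(e^{-is} - 1). In the first
term, Φ₁ at 0 absorbs the factor is. -/
theorem L₀fun_apply (φ : TestSpace g₀) (t : ℝ) (i : Fin 2) :
    L₀fun φ t i = Real.sqrt Real.pi * (-Φ₁ φ 0 * row₀ t 0 i + Φ₁ φ 1 / 2 * row₀ t 1 i
      + Φ₁ φ (-1) / 2 * row₀ t (-1) i) := by
  have h0 := (integrable_mul_screwExp φ 0).const_mul
    (Real.sqrt Real.pi * -row₀ t 0 i : ℂ)
  have h1 := (integrable_mul_screwExp φ 1).const_mul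
    (Real.sqrt Real.pi * (row₀ t 1 i / 2) : ℂ)
  have h2 := (integrable_mul_screwExp φ (-1)).const_mul
    (Real.sqrt Real.pi * (row₀ t (-1) i / 2) : ℂ)
  have e : L₀fun φ t i = (Real.sqrt Real.pi * -row₀ t 0 i : ℂ) * Φ₁ φ 0
      + (Real.sqrt Real.pi * (row₀ t 1 i / 2) : ℂ) * Φ₁ φ 1
      + (Real.sqrt Real.pi * (row₀ t (-1) i / 2) : ℂ) * Φ₁ φ (-1) := by
    simp only [Φ₁]
    rw [← integral_const_mul, ← integral_const_mul, ← integral_const_mul, ← integral_add h0 h1]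
    refine Eq.trans ?_ (integral_add (h0.add h1) h2)
    refine integral_congr_ae (Eventually.of_forall fun s => ?_)
    simp only [L₀ker, screwExp, Pi.add_apply, Pi.smul_apply, Pi.sub_apply, smul_eq_mul,
      one_ne_zero, neg_eq_zero, if_false, if_true, mul_one, mul_neg, neg_mul]
    ring
  rw [e]
  ring

theorem measurable_row₀ (z : ℂ) : Measurable fun t => row₀ t z := by
  refine measurable_pi_iff.2 fun i => ?_
  fin_cases i
  · change Measurable fun t => C₀ t z
    exact Measurable.ite measurableSet_Iio (by fun_prop)
      (Measurable.ite measurableSet_Iio (by fun_prop) (by fun_prop))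
  · change Measurable fun t => D₀ t z
    exact Measurable.ite measurableSet_Iio (by fun_prop)
      (Measurable.ite measurableSet_Iio (by fun_prop) (by fun_prop))

theorem measurable_L₀fun (φ : TestSpace g₀) : Measurable (L₀fun φ) := by
  refine measurable_pi_iff.2 fun i => ?_
  have h : ∀ z, Measurable fun t => row₀ t z i := fun z => measurable_pi_iff.1 (measurable_row₀ z) i
  simp only [L₀fun_apply]
  exact ((((h 0).const_mul _).add ((h 1).const_mul _)).add ((h (-1)).const_mul _)).const_mul _

theorem sqrt_two_mul_div (a : ℂ) : (Real.sqrt 2 : ℂ) * (a / Real.sqrt 2) = a := by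
  have hs : (Real.sqrt 2 : ℂ) ≠ 0 := by simp
  field_simp

/-- The visible components 1, -z/2, 1 - 2z² of the rows at z = 0, 1, -1 do not depend on t within a
piece, and combining them gives the values in `stepCoord`. -/
theorem isStep_L₀fun (φ : TestSpace g₀) : IsStep (L₀fun φ) (stepCoord (testCoord φ)) := by
  refine ⟨?_, ?_, ?_⟩
  · filter_upwards [ae_Ioo_left] with t ht
    simp only [L₀fun_apply, row₀, D₀, Matrix.cons_val_one, Matrix.cons_val_fin_one, if_pos ht,
      stepCoord, Matrix.cons_val_zero, testCoord_zero, testCoord_one, testCoord_two, mul_add,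
      sqrt_two_mul_div]
    ring
  · filter_upwards [ae_Ioo_mid] with t ht
    simp only [L₀fun_apply, row₀, C₀, Matrix.cons_val_one, Matrix.cons_val_zero,
      if_neg ht.1.not_gt, if_pos ht.2,
      stepCoord, testCoord_zero, testCoord_one, testCoord_two, mul_sub,
      sqrt_two_mul_div]
    ring
  · filter_upwards [ae_Ioo_right] with t ht
    have h' : ¬ t < 1 / 2 := by linarith
    simp only [L₀fun_apply, row₀, D₀, Matrix.cons_val_one, Matrix.cons_val_fin_one, if_neg h',
      if_neg ht.not_gt, stepCoord, Matrix.cons_val, testCoord_zero, testCoord_one,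
      testCoord_two, mul_add, sqrt_two_mul_div]
    ring

theorem represents_L₀fun (φ : TestSpace g₀) :
    Represents (stepEquiv (testCoord φ) : L2H H₀) (L₀fun φ) :=
  (represents_stepEquiv_iff _ _).2 ⟨(measurable_L₀fun φ).aestronglyMeasurable, isStep_L₀fun φ⟩

/-! ### The fundamental solution -/

/-- The form with min and max makes continuity across the breakpoints evident. -/
theorem C₀_eq (t : ℝ) (z : ℂ) :
    C₀ t z = -((min t (1 / 2) : ℝ) : ℂ) * z + ((max 0 (t - 9 / 2) : ℝ) : ℂ) * (2 * z ^ 3 - z) := by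
  unfold C₀
  split_ifs with h1 h2
  · rw [min_eq_left h1.le, max_eq_left (by linarith)]
    simp
  · rw [min_eq_right (by linarith), max_eq_left (by linarith)]
    push_cast; ring
  · rw [min_eq_right (by linarith), max_eq_right (by linarith)]
    push_cast; ring

theorem D₀_eq (t : ℝ) (z : ℂ) :
    D₀ t z = 1 - ((max 0 (min t (9 / 2) - 1 / 2) : ℝ) : ℂ) * (z ^ 2 / 2) := by
  unfold D₀
  split_ifs with h1 h2
  · rw [min_eq_left (by linarith), max_eq_left (by linarith)]
    simp
  · rw [min_eq_left (by linarith), max_eq_right (by linarith)]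
    push_cast; ring
  · rw [min_eq_right (by linarith), max_eq_right (by norm_num)]
    push_cast; ring

theorem continuous_C₀ (z : ℂ) : Continuous fun t => C₀ t z := by
  simp only [C₀_eq]
  fun_prop

theorem continuous_D₀ (z : ℂ) : Continuous fun t => D₀ t z := by
  simp only [D₀_eq]
  fun_prop

theorem hasDerivAt_affine (a b : ℂ) (t : ℝ) : HasDerivAt (fun s : ℝ => (s : ℂ) * a + b) a t := by
  simpa using ((hasDerivAt_id t).ofReal_comp.mul_const a).add_const b

theorem hasDerivAt_of_pieces {f f' f₁ f₂ f₃ f₁' f₂' f₃' : ℝ → ℂ}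
    (e : ∀ t, f t = if t < 1 / 2 then f₁ t else if t < 9 / 2 then f₂ t else f₃ t)
    (e' : ∀ t, f' t = if t < 1 / 2 then f₁' t else if t < 9 / 2 then f₂' t else f₃' t)
    (h₁ : ∀ t, HasDerivAt f₁ (f₁' t) t) (h₂ : ∀ t, HasDerivAt f₂ (f₂' t) t)
    (h₃ : ∀ t, HasDerivAt f₃ (f₃' t) t) (t : ℝ) (ht : t ∉ ({1 / 2, 9 / 2} : Set ℝ)) :
    HasDerivAt f (f' t) t := by
  simp only [Set.mem_insert_iff, Set.mem_singleton_iff, not_or] at ht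
  rw [e']
  rcases lt_or_gt_of_ne ht.1 with h | h
  · rw [if_pos h]
    refine (h₁ t).congr_of_eventuallyEq ?_
    filter_upwards [Iio_mem_nhds h] with s hs
    rw [e, if_pos (Set.mem_Iio.1 hs)]
  rw [if_neg h.not_gt]
  rcases lt_or_gt_of_ne ht.2 with h' | h'
  · rw [if_pos h']
    refine (h₂ t).congr_of_eventuallyEq ?_
    filter_upwards [Ioo_mem_nhds h h'] with s hs
    rw [e, if_neg hs.1.not_gt, if_pos hs.2]
  · rw [if_neg h'.not_gt]
    refine (h₃ t).congr_of_eventuallyEq ?_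
    filter_upwards [Ioi_mem_nhds h', Ioi_mem_nhds h] with s hs hs'
    rw [e, if_neg (not_lt.2 (le_of_lt hs')), if_neg (not_lt.2 (le_of_lt hs))]

/-- Continuity of f permits the fundamental theorem of calculus with the two breakpoints as
exceptional set, although f' may jump there. -/
theorem integral_of_pieces {f f' f₁' f₂' f₃' : ℝ → ℂ} (hf : Continuous f)
    (e' : ∀ t, f' t = if t < 1 / 2 then f₁' t else if t < 9 / 2 then f₂' t else f₃' t)
    (c₁ : Continuous f₁') (c₂ : Continuous f₂') (c₃ : Continuous f₃')
    (h : ∀ t ∉ ({1 / 2, 9 / 2} : Set ℝ), HasDerivAt f (f' t) t) {t : ℝ}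
    (ht : t ∈ Set.Icc (0 : ℝ) 5) : ∫ s in (0 : ℝ)..t, f' s = f t - f 0 := by
  have hi := (integral_three_pieces (f := f') c₁ c₂ c₃
    (by filter_upwards [ae_Ioo_left] with t ht; rw [e', if_pos ht])
    (by filter_upwards [ae_Ioo_mid] with t ht; rw [e', if_neg ht.1.not_gt, if_pos ht.2])
    (by
      filter_upwards [ae_Ioo_right] with t ht
      have h' : ¬ t < 1 / 2 := by linarith
      rw [e', if_neg h', if_neg ht.not_gt])).1
  refine integral_eq_of_hasDerivAt_off_countable_of_le f f' ht.1
    (s := {1 / 2, 9 / 2}) (Set.to_countable _) hf.continuousOn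
    (fun x hx => h x hx.2) ?_
  rw [intervalIntegrable_iff_integrableOn_Ioc_of_le ht.1]
  refine IntegrableOn.mono_set (t := Set.Ioc 0 5) ?_ (Set.Ioc_subset_Ioc_right ht.2)
  rwa [integrableOn_Ioc_iff_integrableOn_Ioo, ← integrableOn_Ico_iff_integrableOn_Ioo]

/-- Since [C D]J = [D -C], the system says that D' = zC on the middle piece and -C' = zD on the
outer ones, the derivatives being zero elsewhere. -/
theorem isFundamentalRow_row₀ : IsFundamentalRow H₀ row₀ := by
  intro z t ht j
  have hrow : ∀ s, Matrix.vecMul (row₀ s z) ((H₀.toFun s).map ofReal) =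
      if s < 1 / 2 ∨ 9 / 2 ≤ s then ![0, D₀ s z] else ![C₀ s z, 0] := by
    intro s
    simp only [H₀, H₀fun, row₀]
    split_ifs <;> ext i <;> fin_cases i <;>
      simp [Matrix.vecMul, dotProduct, Fin.sum_univ_two]
  have hor : ∀ s : ℝ, ∀ a b : ℂ, (if s < 1 / 2 ∨ 9 / 2 ≤ s then a else b)
      = if s < 1 / 2 then a else if s < 9 / 2 then b else a := by
    intro s a b
    by_cases h1 : s < 1 / 2
    · rw [if_pos (Or.inl h1), if_pos h1]
    · by_cases h2 : s < 9 / 2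
      · rw [if_neg (by push Not; exact ⟨not_lt.1 h1, h2⟩), if_neg h1, if_pos h2]
      · rw [if_pos (Or.inr (not_lt.1 h2)), if_neg h1, if_neg h2]
  have hC0 : C₀ 0 z = 0 := by norm_num [C₀]
  have hD0 : D₀ 0 z = 1 := by norm_num [D₀]
  fin_cases j
  · have e1 : ∀ s, z * Matrix.vecMul (row₀ s z) ((H₀.toFun s).map ofReal) 0
        = if s < 1 / 2 then 0 else if s < 9 / 2 then -z ^ 2 / 2 else 0 := by
      intro s
      rw [hrow, apply_ite (fun v : Fin 2 → ℂ => v 0), hor]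
      simp only [C₀, Matrix.cons_val_zero]
      split_ifs <;> ring
    have h := integral_of_pieces (continuous_D₀ z) e1 continuous_const continuous_const
      continuous_const (hasDerivAt_of_pieces (f := fun t => D₀ t z) (fun t => rfl) e1
        (fun s => hasDerivAt_const s (1 : ℂ))
        (fun s => ((hasDerivAt_affine (-z ^ 2 / 2) (1 + z ^ 2 / 4) s).congr_of_eventuallyEq
          (Eventually.of_forall fun r => by ring)))
        (fun s => hasDerivAt_const s (1 - 2 * z ^ 2 : ℂ))) ht
    rw [intervalIntegral.integral_const_mul] at h
    change _ = _ + z * ∫ s in (0 : ℝ)..t, Matrix.vecMul (row₀ s z) ((H₀.toFun s).map ofReal) 0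
    rw [h, hD0]
    simp [Matrix.vecMul, dotProduct, Fin.sum_univ_two, row₀]
  · have e1 : ∀ s, z * Matrix.vecMul (row₀ s z) ((H₀.toFun s).map ofReal) 1
        = if s < 1 / 2 then z else if s < 9 / 2 then 0 else z - 2 * z ^ 3 := by
      intro s
      rw [hrow, apply_ite (fun v : Fin 2 → ℂ => v 1), hor]
      simp only [D₀, Matrix.cons_val_one, Matrix.cons_val_fin_one]
      split_ifs <;> ring
    have e0 : ∀ t, -C₀ t z = if t < 1 / 2 then (t : ℂ) * z + 0 else if t < 9 / 2 then z / 2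
        else (t : ℂ) * (z - 2 * z ^ 3) + (9 * z ^ 3 - 4 * z) := by
      intro t
      simp only [C₀]
      split_ifs <;> ring
    have h := integral_of_pieces (f := fun t => -C₀ t z) (continuous_C₀ z).neg e1 continuous_const continuous_const
      continuous_const (hasDerivAt_of_pieces (f := fun t => -C₀ t z) e0 e1
        (fun s => hasDerivAt_affine _ _ s) (fun s => hasDerivAt_const s (z / 2 : ℂ))
        (fun s => hasDerivAt_affine _ _ s)) ht
    rw [intervalIntegral.integral_const_mul] at h
    change _ = _ + z * ∫ s in (0 : ℝ)..t, Matrix.vecMul (row₀ s z) ((H₀.toFun s).map ofReal) 1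
    rw [h, hC0]
    simp [Matrix.vecMul, dotProduct, Fin.sum_univ_two, row₀]

theorem E₀_eq_row₀ (z : ℂ) : E₀ z = row₀ 5 z 0 - I * row₀ 5 z 1 := by
  have h1 : ¬ (5 : ℝ) < 1 / 2 := by norm_num
  have h2 : ¬ (5 : ℝ) < 9 / 2 := by norm_num
  simp only [E₀, row₀, C₀, D₀, if_neg h1, if_neg h2, Matrix.cons_val_zero, Matrix.cons_val_one,
    Matrix.cons_val_fin_one]
  push_cast
  ring

/-! ### Integrals of rational functions along the real line -/

theorem one_add_sq_le_of_re_eq {x : ℝ} {z : ℂ} (h : z.re = x) : 1 + x ^ 2 ≤ (1 + ‖z‖) ^ 2 := by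
  have h1 := abs_re_le_norm z
  have h2 : x ^ 2 ≤ ‖z‖ ^ 2 := by
    rw [← sq_abs, ← h]
    exact pow_le_pow_left₀ (abs_nonneg _) h1 2
  nlinarith [norm_nonneg z]

/-- Cauchy's theorem on the square [-R, R] × [0, R]·i doubled in width: its three sides off the real
axis have total length 4R, and G is at most C/R² on them. -/
theorem integral_ofReal_eq_zero_of_bound {G : ℂ → ℂ} {C : ℝ}
    (hc : ContinuousOn G {z | 0 ≤ z.im}) (hd : DifferentiableOn ℂ G {z | 0 < z.im})
    (hb : ∀ z : ℂ, 0 ≤ z.im → ‖G z‖ ≤ C / (1 + ‖z‖) ^ 2) :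
    Integrable (fun x : ℝ => G x) ∧ ∫ x : ℝ, G x = 0 := by
  have hC : 0 ≤ C := by
    have := (norm_nonneg _).trans (hb 0 le_rfl)
    simpa using this
  have hcont : Continuous fun x : ℝ => G x :=
    hc.comp_continuous continuous_ofReal fun x => by simp
  have hint : Integrable fun x : ℝ => G x := by
    refine Integrable.mono' (integrable_inv_one_add_sq.const_mul C) hcont.aestronglyMeasurable
      (Eventually.of_forall fun x => (hb x (by simp)).trans ?_)
    rw [div_eq_mul_inv]
    gcongr
    exact one_add_sq_le_of_re_eq (ofReal_re x)
  refine ⟨hint, ?_⟩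
  have hle : ∀ R : ℝ, 0 < R → ‖∫ x in (-R)..R, G x‖ ≤ 4 * C * R⁻¹ := by
    intro R hR
    have hrect := integral_boundary_rect_eq_zero_of_continuousOn_of_differentiableOn G
      (⟨-R, 0⟩ : ℂ) (⟨R, R⟩ : ℂ)
      (hc.mono fun z hz => by
        rw [mem_reProdIm] at hz
        have := hz.2
        simp only [Set.uIcc_of_le hR.le] at this
        exact this.1)
      (hd.mono fun z hz => by
        rw [mem_reProdIm] at hz
        have h : min 0 R < z.im := hz.2.1
        rwa [min_eq_left hR.le] at h)
    simp only [ofReal_zero, zero_mul, add_zero, smul_eq_mul] at hrect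
    have far : ∀ z : ℂ, 0 ≤ z.im → R ≤ ‖z‖ → ‖G z‖ ≤ C / R ^ 2 := by
      intro z hz hz'
      refine (hb z hz).trans ?_
      gcongr
      linarith
    have b1 : ‖∫ x in (-R)..R, G (x + R * I)‖ ≤ C / R ^ 2 * |R - -R| := by
      refine intervalIntegral.norm_integral_le_of_norm_le_const fun x _ => far _ ?_ ?_
      · simpa using hR.le
      · have := abs_im_le_norm ((x : ℂ) + R * I)
        rw [im_add_im_ofReal] at this
        exact (le_abs_self R).trans this
    have b2 : ∀ S : ℝ, |S| = R → ‖∫ y in (0 : ℝ)..R, G (S + y * I)‖ ≤ C / R ^ 2 * |R - 0| := by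
      intro S hS
      refine intervalIntegral.norm_integral_le_of_norm_le_const fun y hy => far _ ?_ ?_
      · rw [Set.uIoc_of_le hR.le] at hy
        simpa using hy.1.le
      · have := abs_re_le_norm ((S : ℂ) + y * I)
        rw [re_add_im_ofReal] at this
        exact hS ▸ this
    have b3 := b2 R (abs_of_pos hR)
    have b4 := b2 (-R) (by rw [abs_neg, abs_of_pos hR])
    have e : ∫ x in (-R)..R, G x = (∫ x in (-R)..R, G (x + R * I))
        - I * (∫ y in (0 : ℝ)..R, G (R + y * I))
        + I * ∫ y in (0 : ℝ)..R, G ((-R : ℝ) + y * I) := by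
      linear_combination hrect
    rw [e]
    refine (norm_add_le _ _).trans ((add_le_add (norm_sub_le _ _) le_rfl).trans ?_)
    rw [norm_mul, norm_mul, norm_I, one_mul, one_mul]
    refine (add_le_add (add_le_add b1 b3) b4).trans (le_of_eq ?_)
    rw [sub_zero, abs_of_pos hR, sub_neg_eq_add, abs_of_pos (by linarith)]
    field_simp
    ring
  have ht := intervalIntegral_tendsto_integral hint tendsto_neg_atTop_atBot tendsto_id
  have ht0 : Tendsto (fun R : ℝ => ∫ x in (-R)..R, G x) atTop (𝓝 0) := by
    refine squeeze_zero_norm' ((eventually_gt_atTop 0).mono hle) ?_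
    simpa using tendsto_inv_atTop_zero.const_mul (4 * C)
  exact tendsto_nhds_unique ht ht0

theorem E₀_ne_zero_of_im_nonneg {z : ℂ} (hz : 0 ≤ z.im) : E₀ z ≠ 0 := by
  rcases hz.eq_or_lt with h | h
  · have : z = (z.re : ℂ) := by
      apply Complex.ext <;> simp [← h]
    rw [this]
    exact E₀_ofReal_ne_zero _
  · intro h0
    have := E₀_im_pos z h
    rw [h0, norm_zero] at this
    exact (norm_nonneg _).not_gt this

theorem differentiable_E₀ : Differentiable ℂ E₀ := E₀_isHermiteBiehler.entire

/-- On the half-disc of radius 8 this is compactness and the absence of zeros. Beyond it the cubic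
term dominates: |E₀(z)| ≥ |z|³/2. -/
theorem exists_E₀_bound : ∃ C : ℝ, 0 < C ∧
    ∀ z : ℂ, 0 ≤ z.im → (1 + ‖z‖) ^ 3 ≤ C * ‖E₀ z‖ := by
  have hK : IsCompact (Metric.closedBall (0 : ℂ) 8 ∩ {z : ℂ | 0 ≤ z.im}) :=
    (isCompact_closedBall _ _).inter_right (isClosed_le continuous_const continuous_im)
  have hcont : ContinuousOn (fun z : ℂ => (1 + ‖z‖) ^ 3 / ‖E₀ z‖)
      (Metric.closedBall (0 : ℂ) 8 ∩ {z : ℂ | 0 ≤ z.im}) := by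
    refine ContinuousOn.div (by fun_prop) differentiable_E₀.continuous.norm.continuousOn ?_
    intro z hz
    exact norm_ne_zero_iff.2 (E₀_ne_zero_of_im_nonneg hz.2)
  obtain ⟨C, hC⟩ := hK.exists_bound_of_continuousOn hcont
  refine ⟨max C 16, by positivity, fun z hz => ?_⟩
  have hE : 0 < ‖E₀ z‖ := norm_pos_iff.2 (E₀_ne_zero_of_im_nonneg hz)
  rcases le_total ‖z‖ 8 with h | h
  · have := (le_abs_self _).trans (hC z ⟨by simpa using h, hz⟩)
    rw [div_le_iff₀ hE] at this
    exact this.trans (by gcongr; exact le_max_left _ _)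
  · have h1 : ‖z‖ ^ 3 / 2 ≤ ‖E₀ z‖ := by
      have e : z ^ 3 = E₀ z - (2 * I * z ^ 2 - z - I) := by rw [E₀]; ring
      have h2 : ‖z‖ ^ 3 ≤ ‖E₀ z‖ + (2 * ‖z‖ ^ 2 + ‖z‖ + 1) := by
        rw [← norm_pow, e]
        refine (norm_sub_le _ _).trans (add_le_add le_rfl ?_)
        refine (norm_sub_le _ _).trans (add_le_add ((norm_sub_le _ _).trans ?_) (by simp))
        simp
      nlinarith [mul_le_mul_of_nonneg_left h (sq_nonneg ‖z‖), mul_le_mul_of_nonneg_left h (norm_nonneg z)]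
    have h3 : (1 + ‖z‖) ^ 3 ≤ 8 * ‖z‖ ^ 3 := by
      have : (1 + ‖z‖) ^ 3 ≤ (2 * ‖z‖) ^ 3 := by gcongr; linarith
      linarith [this, mul_pow 2 ‖z‖ 3]
    calc (1 + ‖z‖) ^ 3 ≤ 16 * ‖E₀ z‖ := by linarith
      _ ≤ _ := by gcongr; exact le_max_right _ _

/-- The quadratic polynomial with coefficients `c`. -/
def quad (c : Fin 3 → ℂ) (z : ℂ) : ℂ := c 0 + c 1 * z + c 2 * z ^ 2

theorem differentiable_quad (c : Fin 3 → ℂ) : Differentiable ℂ (quad c) := by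
  unfold quad
  fun_prop

theorem norm_add_mul_le (a b z : ℂ) : ‖a + b * z‖ ≤ (‖a‖ + ‖b‖) * (1 + ‖z‖) := by
  refine (norm_add_le _ _).trans ?_
  rw [norm_mul]
  nlinarith [norm_nonneg a, norm_nonneg b, norm_nonneg z, mul_nonneg (norm_nonneg a) (norm_nonneg z)]

theorem norm_quad_le (c : Fin 3 → ℂ) (z : ℂ) :
    ‖quad c z‖ ≤ (‖c 0‖ + ‖c 1‖ + ‖c 2‖) * (1 + ‖z‖) ^ 2 := by
  have e : quad c z = c 0 + (c 1 + c 2 * z) * z := by rw [quad]; ring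
  have h1 := norm_add_mul_le (c 1) (c 2) z
  have h2 : ‖quad c z‖ ≤ ‖c 0‖ + (‖c 1‖ + ‖c 2‖) * (1 + ‖z‖) * ‖z‖ := by
    rw [e]
    refine (norm_add_le _ _).trans ?_
    rw [norm_mul]
    gcongr
  have h0 := norm_nonneg (c 0)
  have h3 : 0 ≤ ‖c 1‖ + ‖c 2‖ := by positivity
  have hz := norm_nonneg z
  nlinarith [mul_nonneg h0 hz, mul_nonneg h3 hz, mul_nonneg h0 (sq_nonneg ‖z‖)]

theorem exists_quad_div_E₀_bound (c : Fin 3 → ℂ) : ∃ C : ℝ, 0 ≤ C ∧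
    ∀ z : ℂ, 0 ≤ z.im → ‖quad c z / E₀ z‖ ≤ C / (1 + ‖z‖) := by
  obtain ⟨C, hC, hb⟩ := exists_E₀_bound
  refine ⟨(‖c 0‖ + ‖c 1‖ + ‖c 2‖) * C, by positivity, fun z hz => ?_⟩
  have hE : 0 < ‖E₀ z‖ := norm_pos_iff.2 (E₀_ne_zero_of_im_nonneg hz)
  have hz' : 0 < 1 + ‖z‖ := by positivity
  rw [norm_div, div_le_div_iff₀ hE hz']
  calc ‖quad c z‖ * (1 + ‖z‖) ≤ (‖c 0‖ + ‖c 1‖ + ‖c 2‖) * (1 + ‖z‖) ^ 2 * (1 + ‖z‖) := by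
        gcongr; exact norm_quad_le c z
    _ = (‖c 0‖ + ‖c 1‖ + ‖c 2‖) * (1 + ‖z‖) ^ 3 := by ring
    _ ≤ (‖c 0‖ + ‖c 1‖ + ‖c 2‖) * (C * ‖E₀ z‖) := by gcongr; exact hb z hz
    _ = _ := by ring

theorem continuousOn_div_E₀ {f : ℂ → ℂ} (hf : Continuous f) :
    ContinuousOn (fun z => f z / E₀ z) {z | 0 ≤ z.im} :=
  hf.continuousOn.div differentiable_E₀.continuous.continuousOn
    fun _ hz => E₀_ne_zero_of_im_nonneg hz

theorem differentiableOn_div_E₀ {f : ℂ → ℂ} {s : Set ℂ} (hf : DifferentiableOn ℂ f s)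
    (hs : s ⊆ {z | 0 ≤ z.im}) : DifferentiableOn ℂ (fun z => f z / E₀ z) s :=
  hf.div differentiable_E₀.differentiableOn fun _ hz => E₀_ne_zero_of_im_nonneg (hs hz)

theorem integral_affine_div_E₀ (a b : ℂ) : Integrable (fun x : ℝ => (a + b * x) / E₀ x) ∧
    ∫ x : ℝ, (a + b * x) / E₀ x = 0 := by
  obtain ⟨C, hC, hb⟩ := exists_E₀_bound
  refine integral_ofReal_eq_zero_of_bound (G := fun z => (a + b * z) / E₀ z)
    (C := (‖a‖ + ‖b‖) * C) (continuousOn_div_E₀ (by fun_prop))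
    (differentiableOn_div_E₀ (by fun_prop) fun z (hz : 0 < z.im) => hz.le) fun z hz => ?_
  have hE : 0 < ‖E₀ z‖ := norm_pos_iff.2 (E₀_ne_zero_of_im_nonneg hz)
  have hz' : 0 < (1 + ‖z‖) ^ 2 := by positivity
  rw [norm_div, div_le_div_iff₀ hE hz']
  calc ‖a + b * z‖ * (1 + ‖z‖) ^ 2 ≤ (‖a‖ + ‖b‖) * (1 + ‖z‖) * (1 + ‖z‖) ^ 2 := by
        gcongr; exact norm_add_mul_le a b z
    _ = (‖a‖ + ‖b‖) * (1 + ‖z‖) ^ 3 := by ring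
    _ ≤ (‖a‖ + ‖b‖) * (C * ‖E₀ z‖) := by gcongr; exact hb z hz
    _ = _ := by ring

/-- The extra pole a - i lies in the lower half-plane, so Cauchy's theorem still applies, and the
extra factor restores quadratic decay when the numerator has degree two. -/
theorem integral_quad_div_mul_E₀ (c : Fin 3 → ℂ) (a : ℝ) :
    Integrable (fun x : ℝ => quad c x / (E₀ x * (x - a + I))) ∧
    ∫ x : ℝ, quad c x / (E₀ x * (x - a + I)) = 0 := by
  obtain ⟨C, hC, hb⟩ := exists_quad_div_E₀_bound c
  have hw : ∀ z : ℂ, 0 ≤ z.im → 1 ≤ ‖z - a + I‖ := by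
    intro z hz
    refine le_trans ?_ (abs_im_le_norm _)
    simp only [add_im, sub_im, ofReal_im, sub_zero, I_im]
    rw [abs_of_nonneg (by linarith)]
    linarith
  have hw0 : ∀ z : ℂ, 0 ≤ z.im → z - a + I ≠ 0 := fun z hz h => by
    have := hw z hz
    rw [h, norm_zero] at this
    linarith
  refine integral_ofReal_eq_zero_of_bound (G := fun z => quad c z / (E₀ z * (z - a + I)))
    (C := C * (3 + |a|)) ?_ ?_ fun z hz => ?_
  · exact (differentiable_quad c).continuous.continuousOn.div
      (differentiable_E₀.continuous.mul (by fun_prop)).continuousOn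
      fun z hz => mul_ne_zero (E₀_ne_zero_of_im_nonneg hz) (hw0 z hz)
  · exact (differentiable_quad c).differentiableOn.div
      (differentiable_E₀.mul (by fun_prop)).differentiableOn
      fun z hz => mul_ne_zero (E₀_ne_zero_of_im_nonneg (le_of_lt hz)) (hw0 z (le_of_lt hz))
  · have h1 : 1 + ‖z‖ ≤ (3 + |a|) * ‖z - a + I‖ := by
      have h2 : ‖z‖ ≤ ‖z - a + I‖ + |a| + 1 := by
        have e : z = (z - a + I) + a - I := by ring
        calc ‖z‖ = ‖(z - a + I) + a - I‖ := by rw [← e]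
          _ ≤ ‖z - a + I‖ + ‖(a : ℂ)‖ + ‖I‖ :=
            (norm_sub_le _ _).trans (add_le_add (norm_add_le _ _) le_rfl)
          _ = _ := by rw [norm_I, norm_real, Real.norm_eq_abs]
      nlinarith [hw z hz, abs_nonneg a]
    have hw' := hw z hz
    have hz' : 0 < 1 + ‖z‖ := by positivity
    rw [← div_div, norm_div, div_le_div_iff₀ (by linarith) (by positivity)]
    calc ‖quad c z / E₀ z‖ * (1 + ‖z‖) ^ 2 ≤ C / (1 + ‖z‖) * (1 + ‖z‖) ^ 2 := by
          gcongr; exact hb z hz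
      _ = C * (1 + ‖z‖) := by field_simp
      _ ≤ C * ((3 + |a|) * ‖z - a + I‖) := by gcongr
      _ = _ := by ring

/-! ### The orthonormal basis of `𝓗(E₀)` -/

/-- `|E₀(x)|²` for real `x`. -/
def weight (x : ℝ) : ℝ := (x ^ 3 - x) ^ 2 + (2 * x ^ 2 - 1) ^ 2

theorem E₀_ofReal (x : ℝ) :
    E₀ x = ((x ^ 3 - x : ℝ) : ℂ) + ((2 * x ^ 2 - 1 : ℝ) : ℂ) * I := by
  unfold E₀; push_cast; ring

theorem conj_E₀_mul_E₀ (x : ℝ) : conj (E₀ x) * E₀ x = (weight x : ℂ) := by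
  rw [mul_comm, mul_conj, E₀_ofReal, normSq_add_mul_I]
  rfl

theorem weight_pos (x : ℝ) : 0 < weight x := by
  have h : (weight x : ℂ) ≠ 0 := by
    rw [← conj_E₀_mul_E₀]
    exact mul_ne_zero ((map_ne_zero _).2 (E₀_ofReal_ne_zero x)) (E₀_ofReal_ne_zero x)
  have h0 : 0 ≤ weight x := by unfold weight; positivity
  exact h0.lt_of_ne' (ofReal_ne_zero.1 h)

theorem div_re_of_eq {w u : ℂ} {a b p q : ℝ} (hw : w = a + b * I) (hu : u = p + q * I) :
    (w / u).re = (a * p + b * q) / (p ^ 2 + q ^ 2) := by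
  rw [hw, hu, div_re, normSq_add_mul_I, re_add_im_ofReal, re_add_im_ofReal, im_add_im_ofReal,
    im_add_im_ofReal]
  ring

/-- The integrand is the real part of (a + bx)/E₀(x), because Re E₀ = x³ - x on the real line. The
products of two different basis polynomials are, up to constants, x³ - x times a polynomial of
degree at most one. -/
theorem integral_cross (a b : ℝ) :
    ∫ x : ℝ, (x ^ 3 - x) * (a + b * x) / weight x = 0 := by
  obtain ⟨hi, h0⟩ := integral_affine_div_E₀ a b
  have h := integral_re hi
  rw [h0] at h
  have e : ∀ x : ℝ, RCLike.re (((a : ℂ) + b * x) / E₀ x)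
      = (x ^ 3 - x) * (a + b * x) / weight x := by
    intro x
    refine (div_re_of_eq (a := a + b * x) (b := 0) (by push_cast; ring) (E₀_ofReal x)).trans ?_
    rw [weight]
    ring
  simp only [e] at h
  simpa using h

theorem integral_inv_one_add_sq_sub (a : ℝ) : Integrable (fun x : ℝ => (1 + (x - a) ^ 2)⁻¹) ∧
    ∫ x : ℝ, (1 + (x - a) ^ 2)⁻¹ = Real.pi :=
  ⟨integrable_inv_one_add_sq.comp_sub_right a,
    (integral_sub_right_eq_self (fun x : ℝ => (1 + x ^ 2)⁻¹) a).trans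
      integral_univ_inv_one_add_sq⟩

/-- The integrand is the real part of (i(x² - 1) - x)/E₀(x), which decays only like i/x. Subtracting
i/(x + i), whose real part is 1/(1 + x²), leaves -ix/(E₀(x)(x + i)), of integral zero. So the
integral is π. -/
theorem integral_sq_zero : ∫ x : ℝ, (x ^ 2 - 1) ^ 2 / weight x = Real.pi := by
  obtain ⟨hi, h0⟩ := integral_quad_div_mul_E₀ ![0, -I, 0] 0
  obtain ⟨hj, hpi⟩ := integral_inv_one_add_sq_sub 0
  have h := integral_re hi
  rw [h0] at h
  have e : ∀ x : ℝ, (x ^ 2 - 1) ^ 2 / weight x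
      = RCLike.re (quad ![0, -I, 0] x / (E₀ x * (x - (0 : ℝ) + I))) + (1 + (x - 0) ^ 2)⁻¹ := by
    intro x
    have h1 : quad ![0, -I, 0] x = ((0 : ℝ) : ℂ) + ((-x : ℝ) : ℂ) * I := by
      simp [quad]; ring
    have h2 : E₀ x * (x - (0 : ℝ) + I) = (((x ^ 3 - x) * x - (2 * x ^ 2 - 1) : ℝ) : ℂ)
        + (((x ^ 3 - x) + (2 * x ^ 2 - 1) * x : ℝ) : ℂ) * I := by
      rw [E₀_ofReal]
      push_cast
      linear_combination (2 * (x : ℂ) ^ 2 - 1) * I_sq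
    refine Eq.trans ?_ (congrArg (· + _) (div_re_of_eq h1 h2).symm)
    have hw := (weight_pos x).ne'
    have hx : 1 + (x - 0) ^ 2 ≠ 0 := by positivity
    have hd : ((x ^ 3 - x) * x - (2 * x ^ 2 - 1)) ^ 2 + ((x ^ 3 - x) + (2 * x ^ 2 - 1) * x) ^ 2
        = weight x * (1 + (x - 0) ^ 2) := by rw [weight]; ring
    rw [hd]
    field_simp
    rw [weight]
    ring
  simp only [e]
  rw [integral_add hi.re hj, h, hpi]
  simp

/-- Here the integrand is the real part of (2i(x² + x) - 3x - 2)/E₀(x). Subtracting 2i/(x - 1 + i)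
produces the quadratic numerator below and contributes 2π. -/
theorem integral_sq_one : ∫ x : ℝ, (x * (x + 1)) ^ 2 / weight x = 2 * Real.pi := by
  obtain ⟨hi, h0⟩ := integral_quad_div_mul_E₀ ![-2 * I, -(1 + 3 * I), -1] 1
  obtain ⟨hj, hpi⟩ := integral_inv_one_add_sq_sub 1
  have h := integral_re hi
  rw [h0] at h
  have e : ∀ x : ℝ, (x * (x + 1)) ^ 2 / weight x
      = RCLike.re (quad ![-2 * I, -(1 + 3 * I), -1] x / (E₀ x * (x - (1 : ℝ) + I)))
        + 2 * (1 + (x - 1) ^ 2)⁻¹ := by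
    intro x
    have h1 : quad ![-2 * I, -(1 + 3 * I), -1] x
        = ((-x - x ^ 2 : ℝ) : ℂ) + ((-2 - 3 * x : ℝ) : ℂ) * I := by
      simp [quad]; ring
    have h2 : E₀ x * (x - (1 : ℝ) + I)
        = (((x ^ 3 - x) * (x - 1) - (2 * x ^ 2 - 1) : ℝ) : ℂ)
        + (((x ^ 3 - x) + (2 * x ^ 2 - 1) * (x - 1) : ℝ) : ℂ) * I := by
      rw [E₀_ofReal]
      push_cast
      linear_combination (2 * (x : ℂ) ^ 2 - 1) * I_sq
    refine Eq.trans ?_ (congrArg (· + _) (div_re_of_eq h1 h2).symm)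
    have hw := (weight_pos x).ne'
    have hx : 1 + (x - 1) ^ 2 ≠ 0 := by positivity
    have hd : ((x ^ 3 - x) * (x - 1) - (2 * x ^ 2 - 1)) ^ 2
        + ((x ^ 3 - x) + (2 * x ^ 2 - 1) * (x - 1)) ^ 2
        = weight x * (1 + (x - 1) ^ 2) := by rw [weight]; ring
    rw [hd]
    field_simp
    rw [weight]
    ring
  simp only [e]
  rw [integral_add hi.re (hj.const_mul 2), h, integral_const_mul, hpi]
  simp

theorem weight_neg (x : ℝ) : weight (-x) = weight x := by
  unfold weight
  ring

theorem integral_sq_neg_one : ∫ x : ℝ, (x * (x - 1)) ^ 2 / weight x = 2 * Real.pi := by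
  rw [← integral_sq_one, ← integral_neg_eq_self]
  refine integral_congr_ae (Eventually.of_forall fun x => ?_)
  simp only [weight_neg]
  ring

/-! ### Quadratic polynomials as elements of 𝓗(E₀). -/

theorem IsHardy.of_bound {F : ℂ → ℂ} {C : ℝ} (hd : DifferentiableOn ℂ F {z | 0 < z.im})
    (hb : ∀ z : ℂ, 0 < z.im → ‖F z‖ ≤ C / (1 + ‖z‖)) : IsHardy F := by
  refine ⟨hd, ?_⟩
  have hfin : ∫⁻ u : ℝ, ENNReal.ofReal (C ^ 2 * (1 + u ^ 2)⁻¹) < ∞ :=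
    (integrable_inv_one_add_sq.const_mul (C ^ 2)).lintegral_lt_top
  refine lt_of_le_of_lt (iSup₂_le fun v hv => lintegral_mono fun u => ?_) hfin
  have him : 0 < ((u : ℂ) + v * I).im := by simpa using hv
  have hre : ((u : ℂ) + v * I).re = u := re_add_im_ofReal u v
  rw [← ofReal_norm, ← ENNReal.ofReal_pow (norm_nonneg _)]
  refine ENNReal.ofReal_le_ofReal ?_
  calc ‖F (u + v * I)‖ ^ 2 ≤ (C / (1 + ‖(u : ℂ) + v * I‖)) ^ 2 :=
        pow_le_pow_left₀ (norm_nonneg _) (hb _ him) 2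
    _ = C ^ 2 * ((1 + ‖(u : ℂ) + v * I‖) ^ 2)⁻¹ := by rw [div_pow, div_eq_mul_inv]
    _ ≤ _ := by
        gcongr
        exact one_add_sq_le_of_re_eq hre

theorem isHardy_quad_div_E₀ (c : Fin 3 → ℂ) : IsHardy fun z => quad c z / E₀ z := by
  obtain ⟨C, _, hb⟩ := exists_quad_div_E₀_bound c
  exact IsHardy.of_bound
    (differentiableOn_div_E₀ (differentiable_quad c).differentiableOn fun z (hz : 0 < z.im) => hz.le)
    fun z hz => hb z hz.le

theorem sharp_quad (c : Fin 3 → ℂ) : sharp (quad c) = quad fun i => conj (c i) := by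
  ext z
  simp [sharp, quad]

theorem quad_mem_deBranges (c : Fin 3 → ℂ) : quad c ∈ deBrangesSubmodule E₀ := by
  refine ⟨differentiable_quad c, isHardy_quad_div_E₀ c, ?_⟩
  rw [sharp_quad]
  exact isHardy_quad_div_E₀ _

/-- The coefficients of `v₀ F₀ + v₁ F₁ + v₂ F₋₁`. -/
def quadCoord (v : EuclideanSpace ℂ (Fin 3)) : Fin 3 → ℂ :=
  ![-(v 0 / Real.sqrt Real.pi), (v 1 - v 2) / Real.sqrt (2 * Real.pi),
    v 0 / Real.sqrt Real.pi + (v 1 + v 2) / Real.sqrt (2 * Real.pi)]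

theorem quad_quadCoord (v : EuclideanSpace ℂ (Fin 3)) (z : ℂ) :
    quad (quadCoord v) z = v 0 * F₀ z + v 1 * F₁ z + v 2 * Fm₁ z := by
  simp only [quad, quadCoord, F₀, F₁, Fm₁, Matrix.cons_val_zero, Matrix.cons_val_one,
    Matrix.cons_val]
  ring

/-- The element of `𝓗(E₀)` with coordinates `v`. -/
def quadMap : EuclideanSpace ℂ (Fin 3) →ₗ[ℂ] HE₀ where
  toFun v := DeBrangesSpace.toSubmodule.symm ⟨quad (quadCoord v), quad_mem_deBranges _⟩
  map_add' v w := by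
    refine DeBrangesSpace.toSubmodule.injective (Subtype.ext (funext fun z => ?_))
    change quad (quadCoord (v + w)) z = quad (quadCoord v) z + quad (quadCoord w) z
    simp only [quad_quadCoord, PiLp.add_apply]
    ring
  map_smul' k v := by
    refine DeBrangesSpace.toSubmodule.injective (Subtype.ext (funext fun z => ?_))
    change quad (quadCoord (k • v)) z = k * quad (quadCoord v) z
    simp only [quad_quadCoord, PiLp.smul_apply, smul_eq_mul]
    ring

theorem quadMap_apply (v : EuclideanSpace ℂ (Fin 3)) (z : ℂ) :
    quadMap v z = v 0 * F₀ z + v 1 * F₁ z + v 2 * Fm₁ z :=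
  quad_quadCoord v z

theorem DeBrangesSpace.inner_eq_integral (f g : HE₀) :
    inner ℂ f g = ∫ x : ℝ, conj (f x / E₀ x) * (g x / E₀ x) := by
  have h : inner ℂ f g = inner ℂ (deBrangesToL2 f) (deBrangesToL2 g) := rfl
  rw [h, L2.inner_def]
  refine integral_congr_ae ?_
  filter_upwards [f.memLp_boundary.coeFn_toLp, g.memLp_boundary.coeFn_toLp] with x h1 h2
  rw [RCLike.inner_apply, mul_comm]
  exact congrArg₂ (fun a b => conj a * b) h1 h2

/-- A quotient of this kind is the product of two boundary functions of 𝓗(E₀), one conjugated, and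
both are in L². -/
theorem integrable_div_weight (a₀ a₁ a₂ b₀ b₁ b₂ : ℝ) : Integrable fun x : ℝ =>
    (a₀ + a₁ * x + a₂ * x ^ 2) * (b₀ + b₁ * x + b₂ * x ^ 2) / weight x := by
  let c : Fin 3 → ℂ := ![a₀, a₁, a₂]
  let d : Fin 3 → ℂ := ![b₀, b₁, b₂]
  let f : HE₀ := DeBrangesSpace.toSubmodule.symm ⟨quad c, quad_mem_deBranges c⟩
  let g : HE₀ := DeBrangesSpace.toSubmodule.symm ⟨quad d, quad_mem_deBranges d⟩
  have h := (f.memLp_boundary.star.integrable_mul g.memLp_boundary).re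
  refine h.congr (Eventually.of_forall fun x => ?_)
  change (conj (quad c x / E₀ x) * (quad d x / E₀ x)).re = _
  rw [map_div₀, div_mul_div_comm, conj_E₀_mul_E₀]
  have : conj (quad c x) * quad d x
      = (((a₀ + a₁ * x + a₂ * x ^ 2) * (b₀ + b₁ * x + b₂ * x ^ 2) : ℝ) : ℂ) := by
    simp [quad, c, d]
  rw [this, ← ofReal_div, ofReal_re]

theorem inner_quadMap (v w : EuclideanSpace ℂ (Fin 3)) :
    inner ℂ (quadMap v) (quadMap w) = inner ℂ v w := by
  have hpi : (Real.pi : ℂ) ≠ 0 := ofReal_ne_zero.2 Real.pi_ne_zero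
  have hp := sqrt_pi_mul_self
  have hq : (Real.sqrt (2 * Real.pi) : ℂ) * Real.sqrt (2 * Real.pi) = 2 * Real.pi := by
    norm_cast
    exact Real.mul_self_sqrt (by positivity)
  have hp0 : (Real.sqrt Real.pi : ℂ) ≠ 0 := by
    rintro h
    rw [h, zero_mul] at hp
    exact hpi hp.symm
  have hq0 : (Real.sqrt (2 * Real.pi) : ℂ) ≠ 0 := by
    rintro h
    rw [h, zero_mul] at hq
    exact mul_ne_zero two_ne_zero hpi hq.symm
  let e : Fin 3 → ℝ → ℝ := ![fun x => x ^ 2 - 1, fun x => x * (x + 1), fun x => x * (x - 1)]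
  have hint : ∀ i j, Integrable fun x => e i x * e j x / weight x := by
    have key : ∀ i, ∃ a b c : ℝ, ∀ x, e i x = a + b * x + c * x ^ 2 := by
      intro i
      fin_cases i
      · exact ⟨-1, 0, 1, fun x => by simp [e]; ring⟩
      · exact ⟨0, 1, 1, fun x => by simp [e]; ring⟩
      · exact ⟨0, -1, 1, fun x => by simp [e]; ring⟩
    intro i j
    obtain ⟨a, b, c, h⟩ := key i
    obtain ⟨a', b', c', h'⟩ := key j
    simp only [h, h']
    exact integrable_div_weight _ _ _ _ _ _
  have h00 : ∫ x, e 0 x * e 0 x / weight x = Real.pi := by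
    rw [← integral_sq_zero]
    simp [e, pow_two]
  have h11 : ∫ x, e 1 x * e 1 x / weight x = 2 * Real.pi := by
    rw [← integral_sq_one]
    simp [e, pow_two]
  have h22 : ∫ x, e 2 x * e 2 x / weight x = 2 * Real.pi := by
    rw [← integral_sq_neg_one]
    simp [e, pow_two]
  have h01 : ∫ x, e 0 x * e 1 x / weight x = 0 := by
    rw [← integral_cross 1 1]
    congr 1; ext x; simp only [e, Matrix.cons_val]; ring
  have h02 : ∫ x, e 0 x * e 2 x / weight x = 0 := by
    rw [← integral_cross (-1) 1]
    congr 1; ext x; simp only [e, Matrix.cons_val]; ring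
  have h12 : ∫ x, e 1 x * e 2 x / weight x = 0 := by
    rw [← integral_cross 0 1]
    congr 1; ext x; simp only [e, Matrix.cons_val]; ring
  have term : ∀ (k : ℂ) (i j : Fin 3), Integrable (fun x => k * ((e i x * e j x / weight x : ℝ) : ℂ))
      ∧ ∫ x, k * ((e i x * e j x / weight x : ℝ) : ℂ)
        = k * ((∫ x, e i x * e j x / weight x : ℝ) : ℂ) := fun k i j =>
    ⟨(hint i j).ofReal.const_mul k, by rw [integral_const_mul, integral_complex_ofReal]⟩
  have add : ∀ {f g : ℝ → ℂ} {a b : ℂ}, (Integrable f ∧ ∫ x, f x = a) →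
      (Integrable g ∧ ∫ x, g x = b) →
      Integrable (fun x => f x + g x) ∧ ∫ x, (f x + g x) = a + b := by
    rintro f g a b ⟨hf, rfl⟩ ⟨hg, rfl⟩
    exact ⟨hf.add hg, integral_add hf hg⟩
  set p : ℂ := (Real.sqrt Real.pi : ℂ)
  set q : ℂ := (Real.sqrt (2 * Real.pi) : ℂ)
  -- The sesquilinear expansion has nine terms. The basis polynomials are real, so the mixed ones
  -- pair up and six integrals remain.
  have total := (add (add (add (add (add (term (conj (v 0) * w 0 / (p * p)) 0 0)
    (term (conj (v 1) * w 1 / (q * q)) 1 1)) (term (conj (v 2) * w 2 / (q * q)) 2 2))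
    (term ((conj (v 0) * w 1 + conj (v 1) * w 0) / (p * q)) 0 1))
    (term ((conj (v 0) * w 2 + conj (v 2) * w 0) / (p * q)) 0 2))
    (term ((conj (v 1) * w 2 + conj (v 2) * w 1) / (q * q)) 1 2)).2
  rw [h00, h11, h22, h01, h02, h12] at total
  rw [DeBrangesSpace.inner_eq_integral]
  have hcong : ∀ x : ℝ, conj (quadMap v x / E₀ x) * (quadMap w x / E₀ x) = _ := fun x => by
    rw [map_div₀, div_mul_div_comm, conj_E₀_mul_E₀]
  simp only [hcong]
  refine Eq.trans (integral_congr_ae (Eventually.of_forall fun x => ?_)) (total.trans ?_)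
  · have hw : (weight x : ℂ) ≠ 0 := ofReal_ne_zero.2 (weight_pos x).ne'
    have cp : conj p = p := conj_ofReal _
    have cq : conj q = q := conj_ofReal _
    simp only [quadMap_apply, F₀, F₁, Fm₁, e, Matrix.cons_val, map_add, map_mul, map_sub,
      map_div₀, map_pow, conj_ofReal, map_one]
    push_cast
    change (conj (v 0) * (((x : ℂ) ^ 2 - 1) / p) + conj (v 1) * ((x : ℂ) * (x + 1) / q)
      + conj (v 2) * ((x : ℂ) * (x - 1) / q)) * (w 0 * (((x : ℂ) ^ 2 - 1) / p)
      + w 1 * ((x : ℂ) * (x + 1) / q) + w 2 * ((x : ℂ) * (x - 1) / q)) / weight x = _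
    field_simp
    ring
  · simp only [PiLp.inner_apply, RCLike.inner_apply, Fin.sum_univ_three]
    rw [hp, hq]
    push_cast
    field_simp
    ring

/-! ### Division in the Hardy space -/

theorem IsHardy.congr {F G : ℂ → ℂ} (hF : IsHardy F) (h : ∀ z : ℂ, 0 < z.im → F z = G z) :
    IsHardy G := by
  refine ⟨hF.1.congr fun z hz => (h z hz).symm, lt_of_eq_of_lt ?_ hF.2⟩
  refine iSup_congr fun v => iSup_congr fun hv => lintegral_congr fun u => ?_
  rw [h _ (by simpa using hv)]

theorem IsHardy.sub {F G : ℂ → ℂ} (hF : IsHardy F) (hG : IsHardy G) :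
    IsHardy fun z => F z - G z :=
  (hF.add (hG.smul (-1))).congr fun z _ => by simp [sub_eq_add_neg]

theorem isOpen_upperHalfPlane : IsOpen {z : ℂ | 0 < z.im} :=
  isOpen_lt continuous_const continuous_im

theorem sub_conj_ne_zero {a z : ℂ} (ha : 0 < a.im) (hz : 0 < z.im) : z - conj a ≠ 0 := by
  intro h
  have := congrArg im h
  simp at this
  linarith

theorem norm_sub_conj_le {a z : ℂ} (ha : 0 < a.im) (h : a.im / 2 ≤ ‖z - a‖) :
    ‖z - conj a‖ ≤ 5 * ‖z - a‖ := by
  have e : z - conj a = (z - a) + (a - conj a) := by ring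
  have h2 : ‖a - conj a‖ = 2 * a.im := by
    rw [sub_conj, norm_mul, norm_I, mul_one, norm_real, Real.norm_of_nonneg (by linarith)]
  calc ‖z - conj a‖ ≤ ‖z - a‖ + 2 * a.im := by
        rw [e, ← h2]
        exact norm_add_le _ _
    _ ≤ _ := by linarith

/-- A Blaschke factor can be divided out of a function of `H²`. -/
theorem IsHardy.of_blaschke_mul {G : ℂ → ℂ} {a : ℂ} (ha : 0 < a.im)
    (hG : DifferentiableOn ℂ G {z | 0 < z.im})
    (h : IsHardy fun z => (z - a) / (z - conj a) * G z) : IsHardy G := by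
  refine ⟨hG, ?_⟩
  have hsub : Metric.closedBall a (a.im / 2) ⊆ {z | 0 < z.im} := by
    intro z hz
    rw [Metric.mem_closedBall, dist_eq_norm] at hz
    have := (neg_abs_le _).trans' (neg_le_neg ((abs_im_le_norm (z - a)).trans hz))
    rw [sub_im] at this
    change 0 < z.im
    linarith
  -- Near the zero a of the Blaschke factor nothing can be gained by division. There G is bounded by
  -- compactness, and the disc projects to a bounded real interval, so its contribution is finite
  -- uniformly in the height.
  obtain ⟨M, hM⟩ := (isCompact_closedBall a (a.im / 2)).exists_bound_of_continuousOn
    (hG.continuousOn.mono hsub)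
  let S : Set ℝ := Set.Icc (a.re - a.im / 2) (a.re + a.im / 2)
  -- Off the disc the Blaschke factor has modulus at least 1/5, whence 25 = 5².
  have hbound : ∀ (v u : ℝ), 0 < v → ‖G (u + v * I)‖ₑ ^ 2 ≤
      25 * ‖((u : ℂ) + v * I - a) / (u + v * I - conj a) * G (u + v * I)‖ₑ ^ 2
        + S.indicator (fun _ => ENNReal.ofReal (M ^ 2)) u := by
    intro v u hv
    have hz : 0 < ((u : ℂ) + v * I).im := by simpa using hv
    have hre : ((u : ℂ) + v * I).re = u := re_add_im_ofReal u v
    set z : ℂ := (u : ℂ) + v * I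
    by_cases hza : z ∈ Metric.closedBall a (a.im / 2)
    · have hu : u ∈ S := by
        rw [Metric.mem_closedBall, dist_eq_norm] at hza
        have := abs_le.1 ((abs_re_le_norm (z - a)).trans hza)
        rw [sub_re, hre] at this
        exact ⟨by linarith [this.1], by linarith [this.2]⟩
      rw [Set.indicator_of_mem hu]
      refine le_trans ?_ le_add_self
      rw [← ofReal_norm, ← ENNReal.ofReal_pow (norm_nonneg _)]
      exact ENNReal.ofReal_le_ofReal (pow_le_pow_left₀ (norm_nonneg _) (hM z hza) 2)
    · rw [Metric.mem_closedBall, dist_eq_norm, not_le] at hza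
      have h1 := norm_sub_conj_le ha hza.le
      have h0 : 0 < ‖z - conj a‖ := norm_pos_iff.2 (sub_conj_ne_zero ha hz)
      have h2 : ‖G z‖ ≤ 5 * ‖(z - a) / (z - conj a) * G z‖ := by
        rw [norm_mul, norm_div, ← mul_assoc, ← mul_div_assoc]
        refine le_mul_of_one_le_left (norm_nonneg _) ?_
        rwa [one_le_div h0]
      refine le_trans ?_ le_self_add
      rw [← ofReal_norm, ← ofReal_norm, ← ENNReal.ofReal_pow (norm_nonneg _),
        ← ENNReal.ofReal_pow (norm_nonneg _), show (25 : ℝ≥0∞) = ENNReal.ofReal 25 by simp,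
        ← ENNReal.ofReal_mul (by norm_num)]
      refine ENNReal.ofReal_le_ofReal ((pow_le_pow_left₀ (norm_nonneg _) h2 2).trans_eq ?_)
      ring
  have hlt : 25 * (⨆ (v : ℝ) (_ : 0 < v), ∫⁻ u : ℝ,
      ‖((u : ℂ) + v * I - a) / (u + v * I - conj a) * G (u + v * I)‖ₑ ^ 2)
        + ENNReal.ofReal (M ^ 2) * volume S < ∞ :=
    ENNReal.add_lt_top.2 ⟨ENNReal.mul_lt_top (by simp) h.2,
      ENNReal.mul_lt_top (by simp) (by simp [S])⟩
  refine lt_of_le_of_lt (iSup₂_le fun v hv => ?_) hlt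
  refine (lintegral_mono fun u => hbound v u hv).trans ?_
  rw [lintegral_add_right _ (measurable_const.indicator measurableSet_Icc),
    lintegral_const_mul' _ _ (by simp), lintegral_indicator_const measurableSet_Icc]
  gcongr
  exact le_iSup₂ (f := fun (v : ℝ) (_ : 0 < v) => ∫⁻ u : ℝ,
      ‖((u : ℂ) + v * I - a) / (u + v * I - conj a) * G (u + v * I)‖ₑ ^ 2) v hv

theorem sharp_sharp (f : ℂ → ℂ) : sharp (sharp f) = f := by
  ext z
  simp [sharp]

/-- The zeros of E₀♯ are the conjugates of those of E₀, which lie in the open lower half-plane. -/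
theorem im_pos_of_sharp_E₀_eq_zero {a : ℂ} (h : sharp E₀ a = 0) : 0 < a.im := by
  by_contra! hle
  refine E₀_ne_zero_of_im_nonneg (z := conj a) (by simpa using hle) ?_
  simpa [sharp] using h

theorem exists_sharp_E₀_factor : ∃ a b c : ℂ, 0 < a.im ∧ 0 < b.im ∧ 0 < c.im ∧
    ∀ z, sharp E₀ z = (z - a) * (z - b) * (z - c) := by
  obtain ⟨a, ha⟩ : ∃ a, sharp E₀ a = 0 := by
    open Polynomial in
    let P : ℂ[X] := X ^ 3 - C (2 * I) * X ^ 2 - X + C I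
    have hdeg : P.degree = 3 := by
      simp only [P]
      compute_degree!
    obtain ⟨a, ha⟩ := Complex.exists_root (f := P) (by rw [hdeg]; norm_num)
    refine ⟨a, ?_⟩
    rw [sharp_E₀]
    simpa [P, Polynomial.IsRoot] using ha
  -- s is a square root of the discriminant of the cofactor z² + (a - 2i)z + (a² - 2ia - 1).
  obtain ⟨s, hs⟩ := IsAlgClosed.exists_eq_mul_self
    ((a - 2 * I) ^ 2 - 4 * (a ^ 2 - 2 * I * a - 1))
  have hf : ∀ z, sharp E₀ z = (z - a) * (z - (-(a - 2 * I) + s) / 2)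
      * (z - (-(a - 2 * I) - s) / 2) := by
    intro z
    rw [sharp_E₀] at ha ⊢
    linear_combination ha - (z - a) / 4 * hs
  refine ⟨a, _, _, im_pos_of_sharp_E₀_eq_zero ha, im_pos_of_sharp_E₀_eq_zero ?_,
    im_pos_of_sharp_E₀_eq_zero ?_, hf⟩
  · rw [hf]; ring
  · rw [hf]; ring

/-- Newton interpolation at the three zeros of E₀♯. Iterated `dslope` stays holomorphic and takes
care of coinciding zeros without a case distinction. The set s is the whole plane for 𝓗(E₀) and the
half-plane for 𝓚(Θ₀). -/
theorem exists_eq_quad_add {f : ℂ → ℂ} {s : Set ℂ} (hs : IsOpen s) (hU : {z : ℂ | 0 < z.im} ⊆ s)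
    (hf : DifferentiableOn ℂ f s) : ∃ (c : Fin 3 → ℂ) (q : ℂ → ℂ), DifferentiableOn ℂ q s ∧
      ∀ z, f z = quad c z + sharp E₀ z * q z := by
  obtain ⟨a₁, a₂, a₃, h₁, h₂, h₃, hE⟩ := exists_sharp_E₀_factor
  have step : ∀ {g : ℂ → ℂ} {a : ℂ}, 0 < a.im → DifferentiableOn ℂ g s →
      DifferentiableOn ℂ (dslope g a) s ∧ ∀ z, g z = g a + (z - a) * dslope g a z := by
    intro g a ha hg
    refine ⟨(differentiableOn_dslope (hs.mem_nhds (hU ha))).2 hg, fun z => ?_⟩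
    have := sub_smul_dslope g a z
    rw [smul_eq_mul] at this
    linear_combination -this
  obtain ⟨d₁, e₁⟩ := step h₁ hf
  obtain ⟨d₂, e₂⟩ := step h₂ d₁
  obtain ⟨d₃, e₃⟩ := step h₃ d₂
  refine ⟨![f a₁ - a₁ * dslope f a₁ a₂ + a₁ * a₂ * dslope (dslope f a₁) a₂ a₃,
    dslope f a₁ a₂ - (a₁ + a₂) * dslope (dslope f a₁) a₂ a₃, dslope (dslope f a₁) a₂ a₃],
    _, d₃, fun z => ?_⟩
  rw [hE]
  simp only [quad, Matrix.cons_val]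
  linear_combination e₁ z + (z - a₁) * e₂ z + (z - a₁) * (z - a₂) * e₃ z

/-- The inner function `Θ₀` can be divided out of a function of `H²`. -/
theorem IsHardy.of_Θ₀_mul {G : ℂ → ℂ} (hG : DifferentiableOn ℂ G {z | 0 < z.im})
    (h : IsHardy fun z => sharp E₀ z * G z / E₀ z) : IsHardy G := by
  obtain ⟨a, b, c, ha, hb, hc, hE⟩ := exists_sharp_E₀_factor
  have hE' : ∀ z, E₀ z = (z - conj a) * (z - conj b) * (z - conj c) := by
    intro z
    have : E₀ z = sharp (sharp E₀) z := by rw [sharp_sharp]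
    rw [this, sharp, hE]
    simp
  have hd : ∀ {a : ℂ}, 0 < a.im → DifferentiableOn ℂ (fun z => (z - a) / (z - conj a))
      {z | 0 < z.im} := fun ha =>
    DifferentiableOn.div (by fun_prop) (by fun_prop) fun z hz => sub_conj_ne_zero ha hz
  refine IsHardy.of_blaschke_mul ha hG (IsHardy.of_blaschke_mul hb ((hd ha).mul hG)
    (IsHardy.of_blaschke_mul hc ((hd hb).mul ((hd ha).mul hG)) (h.congr fun z hz => ?_)))
  rw [hE, hE']
  have := sub_conj_ne_zero ha hz
  have := sub_conj_ne_zero hb hz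
  have := sub_conj_ne_zero hc hz
  field_simp

/-! ### Entire functions with square integrable restrictions to lines -/

/-- For a primitive P of q, the difference P(z + s) - P(z) is the integral of q over a horizontal
segment, hence bounded in z. Liouville makes it constant, so q has every positive period s and is
constant on horizontal lines. Square integrability then forces the constant to be zero. -/
theorem eq_zero_of_lintegral_lines_le {q : ℂ → ℂ} (hq : Differentiable ℂ q) {M : ℝ≥0∞}
    (hM : M < ∞) (hb : ∀ v : ℝ, v ≠ 0 → ∫⁻ u : ℝ, ‖q (u + v * I)‖ₑ ^ 2 ≤ M) : q = 0 := by
  have hdense : Dense {z : ℂ | z.im ≠ 0} := (dense_compl_singleton (0 : ℝ)).preimage isOpenMap_im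
  have hline : ∀ v : ℝ, Continuous fun u : ℝ => ‖q (u + v * I)‖ ^ 2 := fun v =>
    (hq.continuous.comp (by fun_prop)).norm.pow 2
  have hint : ∀ v : ℝ, v ≠ 0 → Integrable (fun u : ℝ => ‖q (u + v * I)‖ ^ 2) ∧
      ∫ u : ℝ, ‖q (u + v * I)‖ ^ 2 ≤ M.toReal := by
    intro v hv
    have he : ∀ u : ℝ, ENNReal.ofReal (‖q (u + v * I)‖ ^ 2) = ‖q (u + v * I)‖ₑ ^ 2 := fun u => by
      rw [ENNReal.ofReal_pow (norm_nonneg _), ofReal_norm]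
    constructor
    · refine ⟨(hline v).aestronglyMeasurable, ?_⟩
      rw [hasFiniteIntegral_iff_ofReal (Eventually.of_forall fun u => by positivity)]
      simp only [he]
      exact (hb v hv).trans_lt hM
    · rw [integral_eq_lintegral_of_nonneg_ae (Eventually.of_forall fun u => by positivity)
        (hline v).aestronglyMeasurable]
      simp only [he]
      exact ENNReal.toReal_mono hM.ne (hb v hv)
  obtain ⟨P, hP⟩ := hq.isExactOn_univ
  have hper : ∀ s : ℝ, 0 < s → ∀ z, q (z + s) = q z := by
    intro s hs
    have hΔ : ∀ z, HasDerivAt (fun z => P (z + s) - P z) (q (z + s) - q z) z := fun z =>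
      ((hP (z + s) trivial).comp_add_const z (s : ℂ)).sub (hP z trivial)
    have hΔd : Differentiable ℂ fun z => P (z + s) - P z := fun z => (hΔ z).differentiableAt
    have hbd : ∀ z : ℂ, ‖P (z + s) - P z‖ ≤ s + M.toReal := by
      -- The hypothesis says nothing about the real line itself, so the bound is proved off it and
      -- extended by closedness.
      have hcl : IsClosed {z : ℂ | ‖P (z + s) - P z‖ ≤ s + M.toReal} :=
        isClosed_le hΔd.continuous.norm continuous_const
      have hsub : {z : ℂ | z.im ≠ 0} ⊆ {z : ℂ | ‖P (z + s) - P z‖ ≤ s + M.toReal} := by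
        intro z hz
        obtain ⟨hi, hle⟩ := hint z.im hz
        have hz' : ∀ t : ℝ, z + t = ((z.re + t : ℝ) : ℂ) + z.im * I := by
          intro t
          conv_lhs => rw [← re_add_im z]
          push_cast
          ring
        have hi' : Integrable fun t : ℝ => ‖q (z + t)‖ ^ 2 := by
          simp only [hz']
          exact hi.comp_add_left z.re
        have hle' : ∫ t : ℝ, ‖q (z + t)‖ ^ 2 ≤ M.toReal := by
          simp only [hz']
          rwa [integral_add_left_eq_self (fun u : ℝ => ‖q (u + z.im * I)‖ ^ 2) z.re]
        have hftc : ∫ t in (0 : ℝ)..s, q (z + t) = P (z + s) - P z := by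
          have hc : Continuous fun t : ℝ => q (z + t) := hq.continuous.comp (by fun_prop)
          have := intervalIntegral.integral_eq_sub_of_hasDerivAt
            (f := fun t : ℝ => P (z + t)) (f' := fun t : ℝ => q (z + t)) (a := 0) (b := s)
            (fun t _ => by
              have h1 : HasDerivAt (fun w : ℂ => P (z + w)) (q (z + t)) (t : ℂ) :=
                (hP (z + t) trivial).comp_const_add z (t : ℂ)
              exact h1.comp_ofReal) (hc.intervalIntegrable _ _)
          simpa using this
        change ‖P (z + s) - P z‖ ≤ s + M.toReal
        have hi1 : IntervalIntegrable (fun t : ℝ => 1 + ‖q (z + t)‖ ^ 2) volume 0 s :=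
          (continuous_const.add ((hq.continuous.comp (by fun_prop)).norm.pow 2)).intervalIntegrable
            _ _
        rw [← hftc]
        refine (intervalIntegral.norm_integral_le_of_norm_le hs.le
          (Eventually.of_forall fun t _ => ?_) hi1).trans ?_
        -- The bound |q| ≤ 1 + |q|² replaces Cauchy–Schwarz and accounts for the two summands s and
        -- M.
        · nlinarith [sq_nonneg (‖q (z + t)‖ - 1), norm_nonneg (q (z + t))]
        · rw [intervalIntegral.integral_add (by simp) hi'.intervalIntegrable,
            intervalIntegral.integral_const]
          refine add_le_add (by simp) (le_trans ?_ hle')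
          rw [intervalIntegral.integral_of_le hs.le]
          exact setIntegral_le_integral hi' (Eventually.of_forall fun t => by positivity)
      intro z
      exact hcl.closure_subset_iff.2 hsub (hdense z)
    intro z
    have hconst : ∀ w, P (w + s) - P w = P (0 + s) - P 0 := fun w =>
      hΔd.apply_eq_apply_of_bounded
        (isBounded_iff_forall_norm_le.2 ⟨_, by rintro _ ⟨w, rfl⟩; exact hbd w⟩) w 0
    have h1 := (hΔ z).deriv
    have h2 : deriv (fun z => P (z + s) - P z) z = 0 := by
      simp only [hconst, deriv_const]
    rw [h2] at h1
    exact (sub_eq_zero.1 h1.symm)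
  have hzero : ∀ z : ℂ, z.im ≠ 0 → q z = 0 := by
    intro z hz
    by_contra hne
    have hle := hb z.im hz
    have hge : (∫⁻ _ in Set.Ioi z.re, ‖q z‖ₑ ^ 2) ≤ ∫⁻ u : ℝ, ‖q (u + z.im * I)‖ₑ ^ 2 := by
      refine le_trans (setLIntegral_mono' measurableSet_Ioi fun u hu => le_of_eq ?_)
        (setLIntegral_le_lintegral (Set.Ioi z.re) _)
      have := hper (u - z.re) (sub_pos.2 hu) z
      have e : z + ((u - z.re : ℝ) : ℂ) = u + z.im * I := by
        push_cast
        linear_combination -(re_add_im z)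
      rw [e] at this
      rw [this]
    have htop : (∫⁻ _ in Set.Ioi z.re, ‖q z‖ₑ ^ 2) = ∞ := by
      rw [setLIntegral_const, Real.volume_Ioi, ENNReal.mul_top]
      simpa using hne
    rw [htop] at hge
    exact (hge.trans hle).not_gt hM
  exact Continuous.ext_on hdense hq.continuous continuous_const fun z hz => hzero z hz

/-- Reflection turns lines below the real axis for q into lines above it for q♯. -/
theorem eq_zero_of_isHardy_of_isHardy_sharp {q : ℂ → ℂ} (hd : Differentiable ℂ q)
    (h : IsHardy q) (h' : IsHardy (sharp q)) : q = 0 := by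
  refine eq_zero_of_lintegral_lines_le hd (max_lt h.2 h'.2) fun v hv => ?_
  rcases lt_or_gt_of_ne hv with hv | hv
  · refine le_trans (le_of_eq ?_) ((le_iSup₂ (f := fun (v : ℝ) (_ : 0 < v) =>
      ∫⁻ u : ℝ, ‖sharp q (u + v * I)‖ₑ ^ 2) (-v) (by linarith)).trans (le_max_right _ _))
    refine lintegral_congr fun u => ?_
    congr 1
    simp only [sharp]
    rw [← ofReal_norm, ← ofReal_norm, norm_conj]
    simp
  · exact (le_iSup₂ (f := fun (v : ℝ) (_ : 0 < v) =>
      ∫⁻ u : ℝ, ‖q (u + v * I)‖ₑ ^ 2) v hv).trans (le_max_left _ _)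

/-- Write f = p + E₀♯q. The condition on f/E₀ puts Θ₀q in H², and Θ₀ cancels. Since f♯ = p♯ + E₀q♯,
the condition on f♯/E₀ gives q♯ in H² directly. Hence q = 0. -/
theorem exists_eq_quad_of_mem_deBranges {f : ℂ → ℂ} (hf : f ∈ deBrangesSubmodule E₀) :
    ∃ c, f = quad c := by
  obtain ⟨hd, h, h'⟩ := hf
  obtain ⟨c, q, hq, he⟩ := exists_eq_quad_add isOpen_univ (Set.subset_univ _) hd.differentiableOn
  have hqd : Differentiable ℂ q := differentiableOn_univ.1 hq
  have hq0 : q = 0 := by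
    refine eq_zero_of_isHardy_of_isHardy_sharp hqd ?_ ?_
    · refine IsHardy.of_Θ₀_mul hqd.differentiableOn
        ((h.sub (isHardy_quad_div_E₀ c)).congr fun z _ => ?_)
      rw [he z]
      ring
    · have h2 := isHardy_quad_div_E₀ fun i => conj (c i)
      rw [← sharp_quad] at h2
      refine (h'.sub h2).congr fun z hz => ?_
      have hE := E₀_ne_zero_of_im_nonneg (le_of_lt hz)
      have e : sharp f z = sharp (quad c) z + E₀ z * sharp q z := by
        simp [sharp, he]
      rw [e]
      field_simp
      ring
  refine ⟨c, funext fun z => ?_⟩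
  rw [he, hq0]
  simp

theorem quadMap_surjective : Function.Surjective quadMap := by
  intro f
  obtain ⟨c, hc⟩ := exists_eq_quad_of_mem_deBranges f.toSubmodule.2
  have hp : (Real.sqrt Real.pi : ℂ) ≠ 0 := by
    simpa using (Real.sqrt_pos.2 Real.pi_pos).ne'
  have hq : (Real.sqrt (2 * Real.pi) : ℂ) ≠ 0 := by
    simpa using (Real.sqrt_pos.2 (by positivity : 0 < 2 * Real.pi)).ne'
  -- The coordinates are rescaled values of the polynomial at 0, 1, -1, since each basis polynomial
  -- vanishes at the two other nodes.
  let v : EuclideanSpace ℂ (Fin 3) := WithLp.toLp 2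
    ![-c 0 * Real.sqrt Real.pi, (c 0 + c 1 + c 2) / 2 * Real.sqrt (2 * Real.pi),
      (c 0 - c 1 + c 2) / 2 * Real.sqrt (2 * Real.pi)]
  have hv : quadCoord v = c := by
    ext i
    fin_cases i <;>
      simp only [quadCoord, v, Fin.zero_eta, Fin.mk_one, Fin.reduceFinMk, Matrix.cons_val] <;>
      field_simp <;> ring
  refine ⟨v, DeBrangesSpace.toSubmodule.injective (Subtype.ext ?_)⟩
  change quad (quadCoord v) = _
  rw [hv, hc]

/-- Coordinates identify `ℂ³` with `𝓗(E₀)`. -/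
def quadEquiv : EuclideanSpace ℂ (Fin 3) ≃ₗᵢ[ℂ] HE₀ :=
  LinearIsometryEquiv.ofSurjective (quadMap.isometryOfInner inner_quadMap) quadMap_surjective

theorem quadEquiv_apply (v : EuclideanSpace ℂ (Fin 3)) (z : ℂ) :
    quadEquiv v z = v 0 * F₀ z + v 1 * F₁ z + v 2 * Fm₁ z :=
  quadMap_apply v z

/-! ### The model space -/

theorem IsHardy.sq_line {F : ℂ → ℂ} (hF : IsHardy F) {v : ℝ} (hv : 0 < v) :
    Integrable (fun u : ℝ => ‖F (u + v * I)‖ ^ 2) ∧ ∫ u : ℝ, ‖F (u + v * I)‖ ^ 2 ≤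
      (⨆ (v : ℝ) (_ : 0 < v), ∫⁻ u : ℝ, ‖F (u + v * I)‖ₑ ^ 2).toReal := by
  have hle := le_iSup₂ (f := fun (v : ℝ) (_ : 0 < v) => ∫⁻ u : ℝ, ‖F (u + v * I)‖ₑ ^ 2) v hv
  have he : ∀ u : ℝ, ENNReal.ofReal (‖F (u + v * I)‖ ^ 2) = ‖F (u + v * I)‖ₑ ^ 2 := fun u => by
    rw [ENNReal.ofReal_pow (norm_nonneg _), ofReal_norm]
  have hm : AEStronglyMeasurable (fun u : ℝ => ‖F (u + v * I)‖ ^ 2) volume :=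
    ((hF.continuous_line hv).norm.pow 2).aestronglyMeasurable
  constructor
  · refine ⟨hm, ?_⟩
    rw [hasFiniteIntegral_iff_ofReal (Eventually.of_forall fun u => by positivity)]
    simp only [he]
    exact hle.trans_lt hF.2
  · rw [integral_eq_lintegral_of_nonneg_ae (Eventually.of_forall fun u => by positivity) hm]
    simp only [he]
    exact ENNReal.toReal_mono hF.2.ne hle

theorem norm_mul_le_sq_add_sq (a b : ℂ) : ‖a * b‖ ≤ ‖a‖ ^ 2 + ‖b‖ ^ 2 := by
  rw [norm_mul]
  nlinarith [sq_nonneg (‖a‖ - ‖b‖), sq_nonneg ‖a‖, sq_nonneg ‖b‖]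

theorem IsHardy.integrable_mul_line {F g : ℂ → ℂ} (hF : IsHardy F) (hg : IsHardy g) {v : ℝ}
    (hv : 0 < v) : Integrable fun u : ℝ => F (u + v * I) * g (u + v * I) :=
  Integrable.mono' ((hF.sq_line hv).1.add (hg.sq_line hv).1)
    ((hF.continuous_line hv).mul (hg.continuous_line hv)).aestronglyMeasurable
    (Eventually.of_forall fun _ => norm_mul_le_sq_add_sq _ _)

/-- This supplies good radii for contour shifts without any pointwise decay. -/
theorem frequently_lt_of_lintegral_lt_top {J : ℝ → ℝ≥0∞} (hJ : ∫⁻ x, J x < ∞) {ε : ℝ≥0∞}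
    (hε : ε ≠ 0) : ∃ᶠ R in atTop, J R < ε := by
  intro hcon
  obtain ⟨N, hN⟩ := eventually_atTop.1 hcon
  have h1 : (∫⁻ _ in Set.Ici N, ε) ≤ ∫⁻ x, J x :=
    (setLIntegral_mono' measurableSet_Ici fun x hx => not_lt.1 (hN x hx)).trans
      (setLIntegral_le_lintegral _ _)
  rw [setLIntegral_const, Real.volume_Ici, ENNReal.mul_top hε] at h1
  exact h1.not_gt hJ

/-- The integral of a product of two functions of `H²` along a horizontal line does not depend on
the line. -/
theorem IsHardy.integral_mul_line_eq {F g : ℂ → ℂ} (hF : IsHardy F) (hg : IsHardy g) {y Y : ℝ}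
    (hy : 0 < y) (hyY : y ≤ Y) : ∫ u : ℝ, F (u + y * I) * g (u + y * I)
      = ∫ u : ℝ, F (u + Y * I) * g (u + Y * I) := by
  set H : ℂ → ℂ := fun z => F z * g z with hH
  have hHd : DifferentiableOn ℂ H {z | 0 < z.im} := hF.1.mul hg.1
  have him : ∀ u v : ℝ, ((u : ℂ) + v * I).im = v := fun u v => im_add_im_ofReal u v
  -- Truncating the height at y keeps the argument in the half-plane, so K is continuous everywhere
  -- and Tonelli applies without measurability issues.
  let K : ℝ → ℝ → ℝ≥0∞ := fun R v => ‖H (R + (max v y : ℝ) * I)‖ₑ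
  have hKc : Continuous (Function.uncurry K) := by
    refine Continuous.enorm (hHd.continuousOn.comp_continuous (by fun_prop) fun p => ?_)
    change 0 < ((p.1 : ℂ) + (max p.2 y : ℝ) * I).im
    rw [him]
    exact hy.trans_le (le_max_right _ _)
  have hK : ∀ R v, y ≤ v → K R v = ‖H (R + v * I)‖ₑ := fun R v hv => by
    simp only [K, max_eq_left hv]
  let J : ℝ → ℝ≥0∞ := fun R => ∫⁻ v in Set.Ioc y Y, K R v
  set B : ℝ≥0∞ := (⨆ (v : ℝ) (_ : 0 < v), ∫⁻ u : ℝ, ‖F (u + v * I)‖ₑ ^ 2)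
    + ⨆ (v : ℝ) (_ : 0 < v), ∫⁻ u : ℝ, ‖g (u + v * I)‖ₑ ^ 2 with hB
  have hBlt : B < ∞ := ENNReal.add_lt_top.2 ⟨hF.2, hg.2⟩
  have hKB : ∀ v, ∫⁻ R, K R v ≤ B := by
    intro v
    have hv : 0 < max v y := hy.trans_le (le_max_right _ _)
    have hm : Measurable fun R : ℝ => ‖F (R + (max v y : ℝ) * I)‖ₑ ^ 2 :=
      (hF.continuous_line hv).enorm.measurable.pow_const 2
    calc ∫⁻ R, K R v ≤ ∫⁻ R : ℝ, (‖F (R + (max v y : ℝ) * I)‖ₑ ^ 2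
          + ‖g (R + (max v y : ℝ) * I)‖ₑ ^ 2) := by
          refine lintegral_mono fun R => ?_
          simp only [K]
          rw [← ofReal_norm, ← ofReal_norm, ← ofReal_norm, ← ENNReal.ofReal_pow (norm_nonneg _),
            ← ENNReal.ofReal_pow (norm_nonneg _), ← ENNReal.ofReal_add (by positivity)
              (by positivity)]
          exact ENNReal.ofReal_le_ofReal (norm_mul_le_sq_add_sq _ _)
      _ ≤ B := by
          rw [lintegral_add_left hm]
          exact add_le_add
            (le_iSup₂ (f := fun (v : ℝ) (_ : 0 < v) => ∫⁻ u : ℝ, ‖F (u + v * I)‖ₑ ^ 2) _ hv)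
            (le_iSup₂ (f := fun (v : ℝ) (_ : 0 < v) => ∫⁻ u : ℝ, ‖g (u + v * I)‖ₑ ^ 2) _ hv)
  -- By Tonelli the vertical side integrals are integrable in R, so they are small for arbitrarily
  -- large R. That is enough, since the horizontal integrals converge as R grows.
  have hJfin : ∫⁻ R, J R < ∞ := by
    have : ∫⁻ R, J R = ∫⁻ v in Set.Ioc y Y, ∫⁻ R, K R v :=
      lintegral_lintegral_swap hKc.measurable.aemeasurable
    rw [this]
    refine (lintegral_mono fun v => hKB v).trans_lt ?_
    rw [setLIntegral_const]
    exact ENNReal.mul_lt_top hBlt (by simp)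
  have hJm : Measurable J := hKc.measurable.lintegral_prod_right
  have hJJ : ∫⁻ R, (J R + J (-R)) < ∞ := by
    rw [lintegral_add_left hJm, lintegral_neg_eq_self]
    exact ENNReal.add_lt_top.2 ⟨hJfin, hJfin⟩
  have hside : ∀ R : ℝ, ‖∫ v in y..Y, H (R + v * I)‖ₑ ≤ J R := by
    intro R
    rw [intervalIntegral.integral_of_le hyY]
    refine (enorm_integral_le_lintegral_enorm _).trans (le_of_eq ?_)
    exact setLIntegral_congr_fun measurableSet_Ioc fun v hv => (hK R v hv.1.le).symm
  have hrect : ∀ R : ℝ, 0 < R → ‖(∫ x in (-R)..R, H (x + y * I))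
      - ∫ x in (-R)..R, H (x + Y * I)‖ₑ ≤ J R + J (-R) := by
    intro R hR
    have h := integral_boundary_rect_eq_zero_of_differentiableOn H (⟨-R, y⟩ : ℂ) (⟨R, Y⟩ : ℂ)
      (hHd.mono fun z hz => by
        rw [mem_reProdIm] at hz
        have := hz.2
        simp only [Set.uIcc_of_le hyY] at this
        exact hy.trans_le this.1)
    simp only [smul_eq_mul] at h
    have e : (∫ x in (-R)..R, H (x + y * I)) - ∫ x in (-R)..R, H (x + Y * I)
        = I * (∫ v in y..Y, H ((-R : ℝ) + v * I)) - I * ∫ v in y..Y, H (R + v * I) := by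
      linear_combination h
    rw [e, add_comm]
    refine (enorm_sub_le).trans (add_le_add ?_ ?_)
    · rw [enorm_mul, ← ofReal_norm I, norm_I, ENNReal.ofReal_one, one_mul]
      exact hside (-R)
    · rw [enorm_mul, ← ofReal_norm I, norm_I, ENNReal.ofReal_one, one_mul]
      exact hside R
  have hlim := ((intervalIntegral_tendsto_integral (hF.integrable_mul_line hg hy)
      tendsto_neg_atTop_atBot tendsto_id).sub
    (intervalIntegral_tendsto_integral (hF.integrable_mul_line hg (hy.trans_le hyY))
      tendsto_neg_atTop_atBot tendsto_id)).enorm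
  rw [← sub_eq_zero, ← enorm_eq_zero, ← nonpos_iff_eq_zero]
  refine le_of_forall_gt_imp_ge_of_dense fun ε hε => ?_
  refine le_of_tendsto_of_frequently hlim ?_
  refine ((frequently_lt_of_lintegral_lt_top hJJ hε.ne').and_eventually
    (eventually_gt_atTop 0)).mono fun R hR => ?_
  exact (hrect R hR.2).trans hR.1.le

/-- A variant of the dominated convergence theorem, with a bound by the product of functions
bounded in `L²` and a fixed function of `L²`. -/
theorem tendsto_integral_of_sq_bounded {h : ℕ → ℝ → ℂ} {k : ℝ → ℂ} {u : ℕ → ℝ → ℝ} {G : ℝ → ℝ}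
    {S : ℝ} (hi : ∀ n, Integrable (h n)) (hk : Integrable k)
    (hu : ∀ n, Integrable fun x => u n x ^ 2) (hS : ∀ n, ∫ x, u n x ^ 2 ≤ S)
    (hG : Integrable fun x => G x ^ 2) (u0 : ∀ n x, 0 ≤ u n x) (G0 : ∀ x, 0 ≤ G x)
    (hb : ∀ n, ∀ᵐ x, ‖h n x - k x‖ ≤ u n x * G x)
    (hlim : ∀ᵐ x, Tendsto (fun n => h n x) atTop (𝓝 (k x))) :
    Tendsto (fun n => ∫ x, h n x) atTop (𝓝 (∫ x, k x)) := by
  have hS0 : 0 ≤ S := (integral_nonneg fun x => sq_nonneg _).trans (hS 0)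
  rw [Metric.tendsto_atTop']
  intro ε hε
  -- The product u G is at most K G² + u²/K. The first part is a fixed dominating function, and this
  -- K makes the integral of the second less than ε/2.
  set K : ℝ := 2 * (S + 1) / ε with hK
  have hK0 : 0 < K := by positivity
  have him : ∀ n, Integrable fun x => min ‖h n x - k x‖ (K * G x ^ 2) := fun n =>
    ((hi n).sub hk).norm.inf (hG.const_mul K)
  have hdct : Tendsto (fun n => ∫ x, min ‖h n x - k x‖ (K * G x ^ 2)) atTop (𝓝 0) := by
    have := tendsto_integral_of_dominated_convergence (F := fun n x =>
      min ‖h n x - k x‖ (K * G x ^ 2)) (f := fun _ => (0 : ℝ)) (fun x => K * G x ^ 2)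
      (fun n => (him n).aestronglyMeasurable) (hG.const_mul K)
      (fun n => Eventually.of_forall fun x => by
        rw [Real.norm_of_nonneg (le_min (norm_nonneg _) (by positivity))]
        exact min_le_right _ _) ?_
    · simpa using this
    · filter_upwards [hlim] with x hx
      have h1 : Tendsto (fun n => ‖h n x - k x‖) atTop (𝓝 0) := by
        simpa using (hx.sub_const (k x)).norm
      exact squeeze_zero (fun n => le_min (norm_nonneg _) (by positivity))
        (fun n => min_le_left _ _) h1
  obtain ⟨N, hN⟩ := eventually_atTop.1 (hdct.eventually (gt_mem_nhds (half_pos hε)))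
  refine ⟨N, fun n hn => ?_⟩
  rw [dist_eq_norm, ← integral_sub (hi n) hk]
  have hle : ∫ x, ‖h n x - k x‖ ≤ ∫ x, (min ‖h n x - k x‖ (K * G x ^ 2) + u n x ^ 2 / K) := by
    refine integral_mono_ae ((hi n).sub hk).norm ((him n).add ((hu n).div_const K)) ?_
    filter_upwards [hb n] with x hx
    have hq : 0 ≤ u n x ^ 2 / K := by positivity
    rcases le_total ‖h n x - k x‖ (K * G x ^ 2) with hc | hc
    · change _ ≤ min ‖h n x - k x‖ (K * G x ^ 2) + u n x ^ 2 / K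
      rw [min_eq_left hc]
      linarith
    · change _ ≤ min ‖h n x - k x‖ (K * G x ^ 2) + u n x ^ 2 / K
      rw [min_eq_right hc]
      have h1 : u n x * G x ≤ K * G x ^ 2 + u n x ^ 2 / K := by
        have : 0 ≤ (K * G x - u n x) ^ 2 / K + u n x * G x := by
          have := u0 n x; have := G0 x; positivity
        have e : (K * G x - u n x) ^ 2 / K + u n x * G x
            = K * G x ^ 2 + u n x ^ 2 / K - u n x * G x := by
          field_simp; ring
        linarith
      exact hx.trans h1
  have h2 : (∫ x, u n x ^ 2) / K < ε / 2 := by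
    rw [div_lt_iff₀ hK0, hK]
    have : ε / 2 * (2 * (S + 1) / ε) = S + 1 := by field_simp
    rw [this]
    linarith [hS n]
  calc ‖∫ x, (h n x - k x)‖ ≤ ∫ x, ‖h n x - k x‖ := norm_integral_le_integral_norm _
    _ ≤ _ := hle
    _ = (∫ x, min ‖h n x - k x‖ (K * G x ^ 2)) + (∫ x, u n x ^ 2) / K := by
        rw [integral_add (him n) ((hu n).div_const K), integral_div]
    _ < ε := by linarith [hN n (hn.le)]

theorem tendsto_one_div_atTop : Tendsto (fun n : ℕ => 1 / ((n : ℝ) + 1)) atTop (𝓝 0) :=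
  tendsto_one_div_add_atTop_nhds_zero_nat

/-- The vertical ray lies in every cone, so the cone of aperture 1 suffices. -/
theorem HasNontangentialLimit.tendsto_vertical {F : ℂ → ℂ} {x : ℝ} {c : ℂ}
    (h : HasNontangentialLimit F x c) :
    Tendsto (fun n : ℕ => F (x + (1 / ((n : ℝ) + 1) : ℝ) * I)) atTop (𝓝 c) := by
  refine (h 1 one_pos).comp (tendsto_nhdsWithin_iff.2 ⟨?_, Eventually.of_forall fun n => ?_⟩)
  · have := (((continuous_ofReal.tendsto 0).comp tendsto_one_div_atTop).mul_const I).const_add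
      (x : ℂ)
    simpa using this
  · have hp : (0 : ℝ) < 1 / ((n : ℝ) + 1) := by positivity
    change 0 < ((x : ℂ) + (1 / ((n : ℝ) + 1) : ℝ) * I).im ∧
      |((x : ℂ) + (1 / ((n : ℝ) + 1) : ℝ) * I).re - x|
        < 1 * ((x : ℂ) + (1 / ((n : ℝ) + 1) : ℝ) * I).im
    rw [re_add_im_ofReal, im_add_im_ofReal, sub_self, abs_zero, one_mul]
    exact ⟨hp, hp⟩

theorem exists_quad_div_E₀_sq_bound (c : Fin 3 → ℂ) : ∃ C : ℝ, 0 ≤ C ∧ ∀ (u v : ℝ), 0 ≤ v →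
    ‖quad c (u + v * I) / E₀ (u + v * I)‖ ^ 2 ≤ C ^ 2 * (1 + u ^ 2)⁻¹ ∧
    ‖quad c (u + v * I) / E₀ (u + v * I)‖ ≤ C / (1 + v) := by
  obtain ⟨C, hC, hb⟩ := exists_quad_div_E₀_bound c
  refine ⟨C, hC, fun u v hv => ?_⟩
  have h := hb (u + v * I) (by simpa using hv)
  constructor
  · calc ‖quad c (u + v * I) / E₀ (u + v * I)‖ ^ 2 ≤ (C / (1 + ‖(u : ℂ) + v * I‖)) ^ 2 :=
          pow_le_pow_left₀ (norm_nonneg _) h 2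
      _ = C ^ 2 * ((1 + ‖(u : ℂ) + v * I‖) ^ 2)⁻¹ := by rw [div_pow, div_eq_mul_inv]
      _ ≤ _ := by
          gcongr
          exact one_add_sq_le_of_re_eq (re_add_im_ofReal u v)
  · refine h.trans ?_
    gcongr
    have := (le_abs_self _).trans (abs_im_le_norm ((u : ℂ) + v * I))
    rwa [im_add_im_ofReal] at this

/-- The line may be pushed to infinity. There the L² norm of p/E₀ tends to zero by dominated
convergence, while that of F stays bounded. -/
theorem IsHardy.integral_mul_quad_line {F : ℂ → ℂ} (hF : IsHardy F) (c : Fin 3 → ℂ) {y : ℝ}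
    (hy : 0 < y) : ∫ u : ℝ, F (u + y * I) * (quad c (u + y * I) / E₀ (u + y * I)) = 0 := by
  obtain ⟨C, hC, hb⟩ := exists_quad_div_E₀_sq_bound c
  have hg := isHardy_quad_div_E₀ c
  set S : ℝ := (⨆ (v : ℝ) (_ : 0 < v), ∫⁻ u : ℝ, ‖F (u + v * I)‖ₑ ^ 2).toReal with hS
  have hS0 : 0 ≤ S := ENNReal.toReal_nonneg
  set g : ℂ → ℂ := fun z => quad c z / E₀ z with hgdef
  have hgt : Tendsto (fun n : ℕ => ∫ u : ℝ, ‖g (u + (y + n : ℝ) * I)‖ ^ 2) atTop (𝓝 0) := by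
    have := tendsto_integral_of_dominated_convergence
      (F := fun (n : ℕ) (u : ℝ) => ‖g (u + (y + n : ℝ) * I)‖ ^ 2) (f := fun _ => (0 : ℝ))
      (fun u => C ^ 2 * (1 + u ^ 2)⁻¹)
      (fun n => (hg.sq_line (by positivity : 0 < y + n)).1.aestronglyMeasurable)
      (integrable_inv_one_add_sq.const_mul _)
      (fun n => Eventually.of_forall fun u => by
        rw [Real.norm_of_nonneg (by positivity)]
        exact (hb u (y + n) (by positivity)).1)
      (Eventually.of_forall fun u => by
        have h1 : Tendsto (fun n : ℕ => C / (1 + (y + n : ℝ))) atTop (𝓝 0) :=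
          (tendsto_atTop_add_const_left _ 1
            (tendsto_atTop_add_const_left _ y tendsto_natCast_atTop_atTop)).const_div_atTop C
        have h2 : Tendsto (fun n : ℕ => ‖g (u + (y + n : ℝ) * I)‖) atTop (𝓝 0) :=
          squeeze_zero (fun n => norm_nonneg _)
            (fun n => (hb u (y + n) (by positivity)).2) h1
        simpa using h2.pow 2)
    simpa using this
  rw [← norm_le_zero_iff]
  -- The inequality ab ≤ δa² + b²/δ replaces Cauchy–Schwarz: the height goes to infinity first, then
  -- δ goes to zero.
  have key : ∀ δ : ℝ, 0 < δ → ‖∫ u : ℝ, F (u + y * I) * g (u + y * I)‖ ≤ δ * S := by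
    intro δ hδ
    have hle : ∀ n : ℕ, ‖∫ u : ℝ, F (u + y * I) * g (u + y * I)‖
        ≤ δ * S + δ⁻¹ * ∫ u : ℝ, ‖g (u + (y + n : ℝ) * I)‖ ^ 2 := by
      intro n
      have hyn : 0 < y + n := by positivity
      rw [hF.integral_mul_line_eq hg hy (by linarith [n.cast_nonneg (α := ℝ)] : y ≤ y + n)]
      have hi1 := (hF.sq_line hyn).1.const_mul δ
      have hi2 := (hg.sq_line hyn).1.const_mul δ⁻¹
      calc ‖∫ u : ℝ, F (u + (y + n : ℝ) * I) * g (u + (y + n : ℝ) * I)‖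
          ≤ ∫ u : ℝ, (δ * ‖F (u + (y + n : ℝ) * I)‖ ^ 2
              + δ⁻¹ * ‖g (u + (y + n : ℝ) * I)‖ ^ 2) := by
            refine norm_integral_le_of_norm_le (hi1.add hi2) (Eventually.of_forall fun u => ?_)
            rw [norm_mul]
            set a := ‖F (u + (y + n : ℝ) * I)‖
            set b := ‖g (u + (y + n : ℝ) * I)‖
            have ha : 0 ≤ a := norm_nonneg _
            have hb : 0 ≤ b := norm_nonneg _
            have h1 : 0 ≤ δ⁻¹ * (δ * a - b) ^ 2 + a * b := by positivity
            have h2 : δ⁻¹ * (δ * a - b) ^ 2 + a * b = δ * a ^ 2 + δ⁻¹ * b ^ 2 - a * b := by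
              field_simp; ring
            linarith
        _ = δ * (∫ u : ℝ, ‖F (u + (y + n : ℝ) * I)‖ ^ 2)
              + δ⁻¹ * ∫ u : ℝ, ‖g (u + (y + n : ℝ) * I)‖ ^ 2 := by
            rw [integral_add hi1 hi2, integral_const_mul, integral_const_mul]
        _ ≤ _ := by
            gcongr
            exact (hF.sq_line hyn).2
    have hlim := (hgt.const_mul δ⁻¹).const_add (δ * S)
    rw [mul_zero, add_zero] at hlim
    exact ge_of_tendsto' hlim hle
  refine le_of_forall_gt_imp_ge_of_dense fun ε hε => ?_
  refine (key (ε / (S + 1)) (by positivity)).trans ?_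
  rw [div_mul_eq_mul_div, div_le_iff₀ (by positivity)]
  nlinarith

/-- The boundary function of an element of `H²` is orthogonal to the conjugates of the functions
`p/E₀`, `p` a polynomial of degree at most two. -/
theorem integral_mul_quad_div_E₀ {f : Lp ℂ 2 (volume : Measure ℝ)} (hf : f ∈ hardySubspace)
    (c : Fin 3 → ℂ) : ∫ x : ℝ, f x * (quad c x / E₀ x) = 0 := by
  obtain ⟨F, hF, hlim⟩ := hf
  obtain ⟨C, hC, hb⟩ := exists_quad_div_E₀_sq_bound c
  have hg := isHardy_quad_div_E₀ c
  set g : ℂ → ℂ := fun z => quad c z / E₀ z with hgdef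
  set S : ℝ := (⨆ (v : ℝ) (_ : 0 < v), ∫⁻ u : ℝ, ‖F (u + v * I)‖ₑ ^ 2).toReal with hS
  let y : ℕ → ℝ := fun n => 1 / ((n : ℝ) + 1)
  have hy : ∀ n, 0 < y n := fun n => by positivity
  have hgc : ∀ x : ℝ, ContinuousAt g x := fun x =>
    (differentiable_quad c).continuous.continuousAt.div differentiable_E₀.continuous.continuousAt
      (E₀_ofReal_ne_zero x)
  have hf2 : Integrable fun x => ‖f x‖ ^ 2 := (Lp.memLp f).integrable_norm_pow (by norm_num)
  let G : ℝ → ℝ := fun x => Real.sqrt (C ^ 2 * (1 + x ^ 2)⁻¹)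
  have hGsq : ∀ x, G x ^ 2 = C ^ 2 * (1 + x ^ 2)⁻¹ := fun x => Real.sq_sqrt (by positivity)
  have hG : Integrable fun x => G x ^ 2 := by
    simp only [hGsq]
    exact integrable_inv_one_add_sq.const_mul _
  have hgG : ∀ (x v : ℝ), 0 ≤ v → ‖g (x + v * I)‖ ≤ G x := fun x v hv =>
    Real.le_sqrt_of_sq_le (hb x v hv).1
  have hgG0 : ∀ x : ℝ, ‖g x‖ ≤ G x := fun x => by simpa using hgG x 0 le_rfl
  have hk : Integrable fun x : ℝ => f x * g x := by
    refine Integrable.mono' (hf2.add hG) ?_ (Eventually.of_forall fun x => ?_)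
    · exact (Lp.aestronglyMeasurable f).mul
        (continuous_iff_continuousAt.2 fun x =>
          (hgc x).comp continuous_ofReal.continuousAt).aestronglyMeasurable
    · refine (norm_mul_le_sq_add_sq _ _).trans (add_le_add le_rfl ?_)
      exact pow_le_pow_left₀ (norm_nonneg _) (hgG0 x) 2
  -- The limit at the boundary uses only almost everywhere convergence and the uniform L² bound.
  -- Convergence of F in L² to its boundary function is not needed, because p/E₀ is dominated by a
  -- fixed function of L².
  have htend := tendsto_integral_of_sq_bounded
    (h := fun n x => F (x + y n * I) * g (x + y n * I)) (k := fun x => f x * g x)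
    (u := fun n x => ‖F (x + y n * I)‖ + ‖f x‖) (G := G)
    (S := 2 * S + 2 * ∫ x, ‖f x‖ ^ 2)
    (fun n => hF.integrable_mul_line hg (hy n)) hk ?_ ?_ hG (fun n x => by positivity)
    (fun x => Real.sqrt_nonneg _) ?_ ?_
  · have h0 : ∀ n, ∫ x : ℝ, F (x + y n * I) * g (x + y n * I) = 0 := fun n =>
      hF.integral_mul_quad_line c (hy n)
    simp only [h0] at htend
    exact (tendsto_nhds_unique htend tendsto_const_nhds)
  · intro n
    refine Integrable.mono' (((hF.sq_line (hy n)).1.const_mul 2).add (hf2.const_mul 2)) ?_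
      (Eventually.of_forall fun x => ?_)
    · exact ((hF.continuous_line (hy n)).norm.aestronglyMeasurable.add
        (Lp.aestronglyMeasurable f).norm).pow 2
    · rw [Real.norm_of_nonneg (by positivity)]
      exact (add_sq_le).trans (by simp only [Pi.add_apply]; linarith)
  · intro n
    have h1 := (hF.sq_line (hy n)).1.const_mul 2
    have h2 := hf2.const_mul 2
    calc ∫ x : ℝ, (‖F (x + y n * I)‖ + ‖f x‖) ^ 2
        ≤ ∫ x : ℝ, (2 * ‖F (x + y n * I)‖ ^ 2 + 2 * ‖f x‖ ^ 2) := by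
          refine integral_mono_of_nonneg (Eventually.of_forall fun x => by positivity)
            (h1.add h2) (Eventually.of_forall fun x => ?_)
          exact (add_sq_le).trans (by linarith)
      _ = 2 * (∫ x : ℝ, ‖F (x + y n * I)‖ ^ 2) + 2 * ∫ x, ‖f x‖ ^ 2 := by
          rw [integral_add h1 h2, integral_const_mul, integral_const_mul]
      _ ≤ _ := by
          gcongr
          exact (hF.sq_line (hy n)).2
  · intro n
    refine Eventually.of_forall fun x => (norm_sub_le _ _).trans ?_
    rw [norm_mul, norm_mul, add_mul]
    gcongr
    · exact hgG x (y n) (hy n).le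
    · exact hgG0 x
  · filter_upwards [hlim] with x hx
    refine hx.tendsto_vertical.mul ((hgc x).tendsto.comp ?_)
    have := (((continuous_ofReal.tendsto 0).comp tendsto_one_div_atTop).mul_const I).const_add
      (x : ℂ)
    simpa [y] using this

/-! ### Identification of 𝓚(Θ₀) with 𝓗(E₀). -/

theorem sharp_ofReal (f : ℂ → ℂ) (x : ℝ) : sharp f x = conj (f x) := by
  simp [sharp]

theorem norm_Θ₀_ofReal (x : ℝ) : ‖Θ₀ x‖ = 1 := by
  rw [Θ₀, sharp_ofReal, norm_div, norm_conj, div_self]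
  exact norm_ne_zero_iff.2 (E₀_ofReal_ne_zero x)

theorem DeBrangesSpace.toL2_coeFn (f : HE₀) :
    deBrangesToL2 f =ᵐ[volume] fun x : ℝ => f x / E₀ x :=
  f.memLp_boundary.coeFn_toLp

/-- On the real line conj(Θ₀)f/E₀ = f/conj(E₀), the conjugate of f♯/E₀. The inner product with Θ₀h
is therefore the conjugate of ∫ h f♯/E₀, which vanishes for h in H². -/
theorem deBrangesToL2_mem_modelSpace (f : HE₀) : deBrangesToL2 f ∈ modelSpace Θ₀ := by
  refine ⟨⟨fun z => f z / E₀ z, f.toSubmodule.2.2.1, ?_⟩, ?_⟩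
  · filter_upwards [f.toL2_coeFn] with x hx α _
    rw [hx]
    exact ((f.toSubmodule.2.1.continuous.continuousAt.div
      differentiable_E₀.continuous.continuousAt (E₀_ofReal_ne_zero x)).tendsto).mono_left
      nhdsWithin_le_nhds
  · obtain ⟨c, hc⟩ := exists_eq_quad_of_mem_deBranges f.toSubmodule.2
    refine (Submodule.mem_orthogonal _ _).2 fun k hk => ?_
    refine Submodule.span_induction (p := fun k _ => inner ℂ k (deBrangesToL2 f) = 0) ?_ ?_ ?_ ?_ hk
    · rintro k ⟨h, hh, hkh⟩
      have h0 := integral_mul_quad_div_E₀ hh fun i => conj (c i)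
      rw [← map_eq_zero (starRingEnd ℂ), ← integral_conj] at h0
      rw [L2.inner_def, ← h0]
      refine integral_congr_ae ?_
      filter_upwards [hkh, f.toL2_coeFn] with x h1 h2
      have hE := E₀_ofReal_ne_zero x
      have hE' : conj (E₀ x) ≠ 0 := (map_ne_zero _).2 hE
      have hq : conj (quad (fun i => conj (c i)) x) = f x := by
        rw [← sharp_quad, sharp_ofReal, conj_conj, ← hc]
      rw [h1, h2, RCLike.inner_apply]
      simp only [Θ₀, sharp_ofReal, map_mul, map_div₀, conj_conj, hq]
      field_simp
    · simp
    · intro a b _ _ ha hb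
      rw [inner_add_left, ha, hb, add_zero]
    · intro r a _ ha
      rw [inner_smul_left, ha, mul_zero]

theorem conj_Θ₀_mul_Θ₀ (x : ℝ) : conj (Θ₀ x) * Θ₀ x = 1 := by
  rw [mul_comm, mul_conj, normSq_eq_norm_sq, norm_Θ₀_ofReal]
  simp

theorem continuous_Θ₀_ofReal : Continuous fun x : ℝ => Θ₀ x := by
  have : (fun x : ℝ => Θ₀ x) = fun x : ℝ => conj (E₀ x) / E₀ x := by
    ext x
    rw [Θ₀, sharp_ofReal]
  rw [this]
  have hE : Continuous fun x : ℝ => E₀ x := differentiable_E₀.continuous.comp continuous_ofReal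
  exact (continuous_conj.comp hE).div hE E₀_ofReal_ne_zero

/-- Dividing E₀F by E₀♯ in the half-plane gives F = p/E₀ + Θ₀q, with q in H² after cancelling Θ₀.
The difference k - p/E₀ then lies both in Θ₀H² and in its orthogonal complement. -/
theorem exists_deBranges_of_mem_modelSpace {k : Lp ℂ 2 (volume : Measure ℝ)}
    (hk : k ∈ modelSpace Θ₀) : ∃ f : HE₀, deBrangesToL2 f = k := by
  obtain ⟨F, hF, hlim⟩ := hk.1
  obtain ⟨c, q, hq, he⟩ := exists_eq_quad_add (f := fun z => E₀ z * F z) isOpen_upperHalfPlane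
    subset_rfl (differentiable_E₀.differentiableOn.mul hF.1)
  let f : HE₀ := DeBrangesSpace.toSubmodule.symm ⟨quad c, quad_mem_deBranges c⟩
  have hfc : ∀ z, f z = quad c z := fun z => rfl
  have hqH : IsHardy q := by
    refine IsHardy.of_Θ₀_mul hq ((hF.sub (isHardy_quad_div_E₀ c)).congr fun z hz => ?_)
    have hE := E₀_ne_zero_of_im_nonneg (le_of_lt hz)
    field_simp
    linear_combination he z
  set r : Lp ℂ 2 (volume : Measure ℝ) := k - deBrangesToL2 f with hr
  have hrmem : r ∈ modelSpace Θ₀ := Submodule.sub_mem _ hk (deBrangesToL2_mem_modelSpace f)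
  have hrcoe : r =ᵐ[volume] fun x => k x - f x / E₀ x := by
    filter_upwards [Lp.coeFn_sub k (deBrangesToL2 f), f.toL2_coeFn] with x h1 h2
    rw [h1, Pi.sub_apply, h2]
  have hmem : MemLp (fun x : ℝ => conj (Θ₀ x) * r x) 2 volume := by
    refine (Lp.memLp r).of_le
      ((continuous_conj.comp continuous_Θ₀_ofReal).aestronglyMeasurable.mul
        (Lp.aestronglyMeasurable r)) (Eventually.of_forall fun x => ?_)
    rw [norm_mul, norm_conj, norm_Θ₀_ofReal, one_mul]
  -- The function conj(Θ₀)r must be recognized as the boundary function of q. Near a real point E₀♯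
  -- does not vanish, so q = (E₀F - p)/E₀♯ inherits its nontangential limit from F.
  have hh : hmem.toLp _ ∈ hardySubspace := by
    refine ⟨q, hqH, ?_⟩
    filter_upwards [hlim, hmem.coeFn_toLp, hrcoe] with x h1 h2 h3 α hα
    have hE := E₀_ofReal_ne_zero x
    have hS : sharp E₀ x ≠ 0 := by
      rw [sharp_ofReal]
      exact (map_ne_zero _).2 hE
    have hSc : Continuous (sharp E₀) := by
      unfold sharp
      exact continuous_conj.comp (differentiable_E₀.continuous.comp continuous_conj)
    have hval : hmem.toLp _ x = (E₀ x * k x - quad c x) / sharp E₀ x := by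
      rw [h2, h3, hfc, Θ₀, map_div₀, sharp_ofReal, conj_conj]
      have hE' : conj (E₀ x) ≠ 0 := (map_ne_zero _).2 hE
      field_simp
    rw [hval]
    have ht : Tendsto (fun z => (E₀ z * F z - quad c z) / sharp E₀ z)
        (𝓝[{z : ℂ | 0 < z.im ∧ |z.re - x| < α * z.im}] (x : ℂ))
        (𝓝 ((E₀ x * k x - quad c x) / sharp E₀ x)) := by
      have t1 : ∀ {u : ℂ → ℂ}, Continuous u → Tendsto u
          (𝓝[{z : ℂ | 0 < z.im ∧ |z.re - x| < α * z.im}] (x : ℂ)) (𝓝 (u x)) := fun hu =>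
        hu.continuousAt.tendsto.mono_left nhdsWithin_le_nhds
      exact (((t1 differentiable_E₀.continuous).mul (h1 α hα)).sub
        (t1 (differentiable_quad c).continuous)).div (t1 hSc) hS
    refine ht.congr' ?_
    have hne : ∀ᶠ z in 𝓝 (x : ℂ), sharp E₀ z ≠ 0 := hSc.continuousAt.eventually_ne hS
    filter_upwards [nhdsWithin_le_nhds hne] with z hz
    rw [div_eq_iff hz]
    linear_combination he z
  have hrΘ : r ∈ Submodule.span ℂ (mulHardy Θ₀) := by
    refine Submodule.subset_span ⟨hmem.toLp _, hh, ?_⟩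
    filter_upwards [hmem.coeFn_toLp] with x hx
    rw [hx]
    linear_combination -(r x) * conj_Θ₀_mul_Θ₀ x
  have hr0 : r = 0 := by
    have := (Submodule.mem_orthogonal _ _).1 hrmem.2 r hrΘ
    exact inner_self_eq_zero.1 this
  exact ⟨f, (sub_eq_zero.1 hr0).symm⟩

/-- The map `f ↦ f/E₀` onto the model space. -/
def modelMap : HE₀ →ₗᵢ[ℂ] K₀ where
  toLinearMap := (deBrangesToL2 : HE₀ →ₗ[ℂ] _).codRestrict _ deBrangesToL2_mem_modelSpace
  norm_map' _ := rfl

theorem modelMap_surjective : Function.Surjective modelMap := by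
  rintro ⟨k, hk⟩
  obtain ⟨f, rfl⟩ := exists_deBranges_of_mem_modelSpace hk
  exact ⟨f, rfl⟩

/-- The isometry `f ↦ f/E₀` of `𝓗(E₀)` onto `𝓚(Θ₀)`. -/
def modelEquiv : HE₀ ≃ₗᵢ[ℂ] K₀ := LinearIsometryEquiv.ofSurjective modelMap modelMap_surjective

theorem modelEquiv_apply (f : HE₀) :
    (modelEquiv f : Lp ℂ 2 (volume : Measure ℝ)) =ᵐ[volume] fun x : ℝ => f x / E₀ x :=
  f.toL2_coeFn

/-! ### The isometries of the diagram -/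

/-- The constant of the map `M`. -/
def clarkConst : ℂ := -I / Real.sqrt Real.pi

theorem normSq_clarkConst : normSq clarkConst * Real.pi = 1 := by
  rw [clarkConst, normSq_div, normSq_neg, normSq_I, normSq_ofReal,
    Real.mul_self_sqrt Real.pi_pos.le]
  have := Real.pi_ne_zero
  field_simp

/-- Coordinates identify `ℂ³` with `L²(τ₀)`. -/
def τ₀Equiv : EuclideanSpace ℂ (Fin 3) ≃ₗᵢ[ℂ] Lp ℂ 2 τ₀ :=
  nodeEquiv (κ := 1) τ₀_eq_atoms one_pos (by simp)

/-- Coordinates identify `ℂ³` with `L²(μ_{Θ₀})`. -/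
def clarkEquiv : EuclideanSpace ℂ (Fin 3) ≃ₗᵢ[ℂ] Lp ℂ 2 (clarkMeasure Θ₀) :=
  nodeEquiv clarkMeasure_Θ₀ Real.pi_pos normSq_clarkConst

theorem τ₀Equiv_apply (v : EuclideanSpace ℂ (Fin 3)) : τ₀Equiv v =ᵐ[τ₀] nodeFun v := by
  refine (nodeEquiv_apply τ₀_eq_atoms one_pos _ v).trans (Eventually.of_forall fun x => ?_)
  simp

theorem clarkEquiv_apply (v : EuclideanSpace ℂ (Fin 3)) :
    clarkEquiv v =ᵐ[clarkMeasure Θ₀] fun x => clarkConst * nodeFun v x :=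
  nodeEquiv_apply clarkMeasure_Θ₀ Real.pi_pos _ v

theorem ae_τ₀_iff {p : ℝ → Prop} : (∀ᵐ x ∂τ₀, p x) ↔ p 0 ∧ p 1 ∧ p (-1) := by
  rw [τ₀_eq_atoms, ae_atoms_iff one_pos (by norm_num)]
  simp [Fin.forall_fin_succ, node]

theorem ae_clarkMeasure_iff {p : ℝ → Prop} :
    (∀ᵐ x ∂(clarkMeasure Θ₀), p x) ↔ p 0 ∧ p 1 ∧ p (-1) := by
  rw [clarkMeasure_Θ₀, ae_atoms_iff Real.pi_pos (by positivity)]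
  simp [Fin.forall_fin_succ, node]

theorem finrank_eq_three {X : Type*} [NormedAddCommGroup X] [InnerProductSpace ℂ X]
    (e : EuclideanSpace ℂ (Fin 3) ≃ₗᵢ[ℂ] X) : Module.finrank ℂ X = 3 := by
  rw [← e.toLinearEquiv.finrank_eq]
  simp

/-! ### Agreement of the coordinates with the stated formulas. -/

theorem nodeFun_testCoord_ae (φ : TestSpace g₀) :
    nodeFun (testCoord φ) =ᵐ[τ₀] fun γ : ℝ => Φ₁ φ γ := by
  rw [EventuallyEq, ae_τ₀_iff]
  simp only [nodeFun_zero, nodeFun_one, nodeFun_neg_one, testCoord_zero, testCoord_one,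
    testCoord_two, sqrt_two_mul_div]
  simp

theorem sqrt_two_mul_pi : (Real.sqrt (2 * Real.pi) : ℂ) = Real.sqrt 2 * Real.sqrt Real.pi := by
  rw [Real.sqrt_mul (by norm_num)]
  push_cast
  rfl

theorem sqrt_pi_div_two : (Real.sqrt (Real.pi / 2) : ℂ) = Real.sqrt Real.pi / Real.sqrt 2 := by
  rw [Real.sqrt_div Real.pi_pos.le]
  push_cast
  rfl

theorem sqrt_pi_ne_zero : (Real.sqrt Real.pi : ℂ) ≠ 0 := by
  simpa using (Real.sqrt_pos.2 Real.pi_pos).ne'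

theorem sqrt_two_ne_zero : (Real.sqrt 2 : ℂ) ≠ 0 := by simp

theorem Phat_eq (φ : TestSpace g₀) (z : ℂ) : Phat φ z =
    Real.sqrt Real.pi * (F₀ z / E₀ z) * Φ₁ φ 0
      + Real.sqrt (Real.pi / 2) * (F₁ z / E₀ z) * Φ₁ φ 1
      + Real.sqrt (Real.pi / 2) * (Fm₁ z / E₀ z) * Φ₁ φ (-1) := by
  have h0 := (integrable_mul_screwExp φ 0).const_mul (Real.sqrt Real.pi * (F₀ z / E₀ z) : ℂ)
  have h1 := (integrable_mul_screwExp φ 1).const_mul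
    (Real.sqrt (Real.pi / 2) * (F₁ z / E₀ z) : ℂ)
  have h2 := (integrable_mul_screwExp φ (-1)).const_mul
    (Real.sqrt (Real.pi / 2) * (Fm₁ z / E₀ z) : ℂ)
  simp only [Φ₁]
  rw [← integral_const_mul, ← integral_const_mul, ← integral_const_mul, ← integral_add h0 h1]
  refine Eq.trans ?_ (integral_add (h0.add h1) h2)
  refine integral_congr_ae (Eventually.of_forall fun s => ?_)
  simp only [screwS, screwExp, one_ne_zero, neg_eq_zero, if_false, if_true,
    mul_one, mul_neg, neg_mul]
  ring

/-- At zeros of E₀ the right side loses its meaning through division by zero, while the left side is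
a polynomial. Hence the restriction on z. -/
theorem quadEquiv_testCoord (φ : TestSpace g₀) {z : ℂ} (hz : E₀ z ≠ 0) :
    quadEquiv (testCoord φ) z = (1 / Real.sqrt Real.pi : ℂ) * E₀ z * Phat φ z := by
  rw [quadEquiv_apply, Phat_eq, sqrt_pi_div_two, testCoord_zero, testCoord_one, testCoord_two]
  have := sqrt_pi_ne_zero
  have := sqrt_two_ne_zero
  field_simp

theorem weyl_stepEquiv {v : EuclideanSpace ℂ (Fin 3)} {F : ℝ → Fin 2 → ℂ}
    (hF : Represents (stepEquiv v : L2H H₀) F) (z : ℂ) : quadEquiv v z = weyl F z := by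
  rw [((represents_stepEquiv_iff v F).1 hF).2.weyl z, quadEquiv_apply]
  simp only [stepCoord, F₀, F₁, Fm₁, Matrix.cons_val, sqrt_two_mul_pi]
  have hp := sqrt_pi_ne_zero
  have hs := sqrt_two_ne_zero
  rw [← sqrt_pi_mul_self]
  have h2 := sqrt_two_mul_self
  field_simp
  linear_combination (-8 * z * (v 1 - v 2) - 8 * z ^ 2 * (v 1 + v 2)) * h2

/-- At each node only one basis function survives. Since E₀(0) = -i and E₀(±1) = i, the quotients
there are -i/√π at 0 and -i√2/√π at ±1, which is `clarkConst` times the values of `nodeFun`. -/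
theorem quadEquiv_div_E₀_ae (v : EuclideanSpace ℂ (Fin 3)) :
    clarkEquiv v =ᵐ[clarkMeasure Θ₀] fun x : ℝ => quadEquiv v x / E₀ x := by
  refine (clarkEquiv_apply v).trans ?_
  have hp := sqrt_pi_ne_zero
  have hs := sqrt_two_ne_zero
  have h2 := sqrt_two_mul_self
  rw [EventuallyEq, ae_clarkMeasure_iff]
  simp only [nodeFun_zero, nodeFun_one, nodeFun_neg_one, clarkConst, quadEquiv_apply, F₀, F₁,
    Fm₁, sqrt_two_mul_pi, ofReal_zero, ofReal_one, ofReal_neg, E₀_zero, E₀_one, E₀_neg_one]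
  refine ⟨?_, ?_, ?_⟩
  · field_simp
    simp
  · field_simp
    linear_combination -I ^ 2 * v 1 * h2 - 2 * v 1 * I_sq
  · field_simp
    linear_combination -I ^ 2 * v 2 * h2 - 2 * v 2 * I_sq

end ScrewLine

end

/-! ### Assembly of the diagram. -/

theorem mainTheorem1 :
    (∀ z : ℂ, E₀ z = row₀ 5 z 0 - I * row₀ 5 z 1) ∧ IsFundamentalRow H₀ row₀ ∧
    Module.finrank ℂ ScrewHilbert = 3 ∧
    Module.finrank ℂ (Lp ℂ 2 τ₀) = 3 ∧
    Module.finrank ℂ (Lp ℂ 2 (clarkMeasure Θ₀)) = 3 ∧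
    Module.finrank ℂ K₀ = 3 ∧
    Module.finrank ℂ HE₀ = 3 ∧
    Module.finrank ℂ (L2Hhat H₀) = 3 ∧
    ∃ (Phi : ScrewHilbert ≃ₗᵢ[ℂ] Lp ℂ 2 τ₀)
      (P : ScrewHilbert ≃ₗᵢ[ℂ] HE₀)
      (L : ScrewHilbert ≃ₗᵢ[ℂ] L2Hhat H₀)
      (W : L2Hhat H₀ ≃ₗᵢ[ℂ] HE₀)
      (D : HE₀ ≃ₗᵢ[ℂ] K₀)
      (R : K₀ ≃ₗᵢ[ℂ] Lp ℂ 2 (clarkMeasure Θ₀))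
      (M : Lp ℂ 2 τ₀ ≃ₗᵢ[ℂ] Lp ℂ 2 (clarkMeasure Θ₀)),
      (∀ φ : TestSpace g₀, Phi (screwClass φ) =ᵐ[τ₀] fun γ : ℝ => Φ₁ φ γ) ∧
      (∀ φ : TestSpace g₀, ∀ z : ℂ, E₀ z ≠ 0 →
        P (screwClass φ) z = (1 / Real.sqrt Real.pi : ℂ) * E₀ z * Phat φ z) ∧
      (∀ φ : TestSpace g₀, Represents (L (screwClass φ) : L2H H₀) (L₀fun φ)) ∧
      (∀ (ξ : L2Hhat H₀) (F : ℝ → Fin 2 → ℂ), Represents (ξ : L2H H₀) F →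
        ∀ z : ℂ, W ξ z = weyl F z) ∧
      (∀ f : HE₀, (D f : Lp ℂ 2 (volume : Measure ℝ)) =ᵐ[volume] fun x : ℝ => f x / E₀ x) ∧
      (∀ F : K₀, ∃ u : ℝ → ℂ, Continuous u ∧
        (F : Lp ℂ 2 (volume : Measure ℝ)) =ᵐ[volume] u ∧ R F =ᵐ[clarkMeasure Θ₀] u) ∧
      (∀ f : Lp ℂ 2 τ₀,
        M f =ᵐ[clarkMeasure Θ₀] fun γ : ℝ => (-I / Real.sqrt Real.pi : ℂ) * f γ) ∧
      (∀ x : ScrewHilbert, W (L x) = P x) ∧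
      (∀ x : ScrewHilbert, R (D (P x)) = M (Phi x)) := by
  refine ⟨E₀_eq_row₀, isFundamentalRow_row₀, finrank_eq_three screwEquiv.symm,
    finrank_eq_three τ₀Equiv, finrank_eq_three clarkEquiv,
    finrank_eq_three (quadEquiv.trans modelEquiv), finrank_eq_three quadEquiv,
    finrank_eq_three stepEquiv,
    screwEquiv.trans τ₀Equiv, screwEquiv.trans quadEquiv, screwEquiv.trans stepEquiv,
    stepEquiv.symm.trans quadEquiv, modelEquiv,
    -- The restriction map is defined through coordinates. That it restricts the continuous
    -- representative is checked below with f/E₀, which is continuous because E₀ has no real zeros.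
    (quadEquiv.trans modelEquiv).symm.trans clarkEquiv, τ₀Equiv.symm.trans clarkEquiv,
    fun φ => ?_, fun φ z hz => ?_, fun φ => ?_, fun ξ F hF z => ?_, modelEquiv_apply,
    fun F => ?_, fun f => ?_, fun x => ?_, fun x => ?_⟩
  · rw [LinearIsometryEquiv.trans_apply, screwEquiv_screwClass]
    exact (τ₀Equiv_apply _).trans (nodeFun_testCoord_ae φ)
  · rw [LinearIsometryEquiv.trans_apply, screwEquiv_screwClass]
    exact quadEquiv_testCoord φ hz
  · rw [LinearIsometryEquiv.trans_apply, screwEquiv_screwClass]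
    exact represents_L₀fun φ
  · obtain ⟨v, rfl⟩ := stepEquiv.surjective ξ
    rw [LinearIsometryEquiv.trans_apply, LinearIsometryEquiv.symm_apply_apply]
    exact weyl_stepEquiv hF z
  · obtain ⟨v, rfl⟩ := (quadEquiv.trans modelEquiv).surjective F
    refine ⟨_, (quadEquiv v).continuous_boundary, modelEquiv_apply (quadEquiv v), ?_⟩
    rw [LinearIsometryEquiv.trans_apply, LinearIsometryEquiv.symm_apply_apply]
    exact quadEquiv_div_E₀_ae v
  · obtain ⟨v, rfl⟩ := τ₀Equiv.surjective f
    rw [LinearIsometryEquiv.trans_apply, LinearIsometryEquiv.symm_apply_apply]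
    refine (clarkEquiv_apply v).trans ?_
    rw [EventuallyEq, ae_clarkMeasure_iff]
    have h := τ₀Equiv_apply v
    rw [EventuallyEq, ae_τ₀_iff] at h
    rw [h.1, h.2.1, h.2.2]
    exact ⟨rfl, rfl, rfl⟩
  · simp only [LinearIsometryEquiv.trans_apply, LinearIsometryEquiv.symm_apply_apply]
  · change clarkEquiv ((quadEquiv.trans modelEquiv).symm
      ((quadEquiv.trans modelEquiv) (screwEquiv x))) = _
    rw [LinearIsometryEquiv.symm_apply_apply]
    simp only [LinearIsometryEquiv.trans_apply, LinearIsometryEquiv.symm_apply_apply]
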